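/- All graphs are finite, simple, connected and undirected. Let $G=(V,E)$ be such a graph with maximum degree $\Delta$. *The relation.* Two edges that share a vertex, $e=ab$ and $f=ac$ with $b\neq c$, span the square $abxc$ if $x\neq a$ is a common neighbour of $b$ and $c$; the square is chordless if $ax,bc\notin E$. Two edges $e,f\in E$ are in relation $\delta(G)$ if (i) $e$ and $f$ share exactly one vertex and it is not the case that they span exactly one square and this square is chordless, or (ii) $e$ and $f$ are opposite edges of a chordless square, or (iii) $e=f$. For a relation $R$, $R^*$ denotes its transitive closure; $\delta(G)^*$ is an equivalence relation on $E$. For $v\in V$ let $E_v$ be the set of edges incident with $v$ and let $\mathfrak d_v=((E_v\times E)\cup(E\times E_v))\cap\delta(G)$. The partial star product $S_v$ is the subgraph whose edges are those of $E_v$ together with the edges opposite to them in the chordless squares spanned by two edges $e,e'\in E_v$ with $(e,e')\notin\mathfrak d_v^*$. *The algorithm.* Algorithm 1 has as input a graph $G$ and a set $W\subseteq V$. It scans the vertices $v\in W$ in any order; for each of them it computes, from the squares in the closed 2-neighbourhood of $v$, the relation $\mathfrak d_v^*$ and the partial star product $S_v$, adds one new colour for each class of the restriction of $\mathfrak d_v^*$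 to the edges of $S_v$ as a new vertex to an (initially empty) colour graph $\Gamma$, gives every edge of $S_v$ the colour of its class, and, if the edge had a colour already, joins its old and its new colour by an edge of $\Gamma$. Finally it computes the connected components of $\Gamma$ and puts two coloured edges of $G$ into the same output class if and only if their colours lie in the same component. The algorithm is implemented by an explicit program for a random access machine with unit cost (each access to a register or an array, addition, comparison, assignment and loop round is one step). $G$ is given by adjacency lists and $W$ by a list, in any order; the output is an array that contains, for every entry of the adjacency lists, the number of the class of the corresponding edge. **Statement.** There is an absolute constant $C$ such that for every connected graph $G=(V,E)$ with maximum degree $\Delta$, every numbering of its vertices, every order of its adjacency lists and every order of the list of $W$, the program, called with input $G$ and $W=V$, stops after at most $C\,|V|\,\max(1,\Delta)^4$ steps, and its output is the partition of $E$ into the equivalence classes of $\delta(G)^*$, numbered $1,\dots,m$. In particular, $\delta(G)^*$ is computed in $O(|V|\Delta^4)$ time for all connected graphs with at least one edge. -/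

import Mathlib

set_option linter.constructorNameAsVariable false

namespace PSP

/-! ### The relation `δ(G)` -/

section Graph

variable {V : Type*}

/-- The edges `ab` and `ac` span a square (a cycle on four vertices, possibly with chords)
whose vertex opposite to `a` is `x`. -/
def Square (G : SimpleGraph V) (a b x c : V) : Prop :=
  G.Adj a b ∧ G.Adj b x ∧ G.Adj x c ∧ G.Adj c a ∧ a ≠ x ∧ b ≠ c

/-- A square `a b x c` that is an induced subgraph. -/
def ChordlessSquare (G : SimpleGraph V) (a b x c : V) : Prop :=
  Square G a b x c ∧ ¬ G.Adj a x ∧ ¬ G.Adj b c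

/-- Condition (i): `e = ab` and `f = ac` are adjacent edges and they do not span a unique square
that, moreover, is chordless. -/
def DeltaAdjacent (G : SimpleGraph V) (e f : G.edgeSet) : Prop :=
  ∃ a b c : V, b ≠ c ∧ (e : Sym2 V) = s(a, b) ∧ (f : Sym2 V) = s(a, c) ∧
    ¬ ∃ x, ChordlessSquare G a b x c ∧ ∀ y, Square G a b y c → y = x

/-- Condition (ii): `e` and `f` are opposite edges of a chordless square. -/
def DeltaOpposite (G : SimpleGraph V) (e f : G.edgeSet) : Prop :=
  ∃ a b x c : V, ChordlessSquare G a b x c ∧ (e : Sym2 V) = s(a, b) ∧ (f : Sym2 V) = s(x, c)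

/-- The relation `δ(G)` on the edge set of `G`. -/
def Delta (G : SimpleGraph V) (e f : G.edgeSet) : Prop :=
  DeltaAdjacent G e f ∨ DeltaOpposite G e f ∨ e = f

/-- `δ(G)^*`, the transitive closure of the reflexive and symmetric relation `δ(G)`. -/
def DeltaStar (G : SimpleGraph V) : G.edgeSet → G.edgeSet → Prop :=
  Relation.TransGen (Delta G)

end Graph

/-! ### Random access programs with unit cost

A program works on finitely many registers and finitely many arrays that hold natural numbers.
Every access to a register or an array, every addition, every comparison, every assignment
and every round of a loop costs one step. -/

/-- The registers. -/
inductive Reg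
  | n | k | t | v | p | u | s | w | r | x | q | i | j | y | e | f
  | cnt | chord | fl | la | lb | old | new | nc | ne | c | qh | qt | ptr | numComp
  deriving DecidableEq

/-- The arrays. -/
inductive Arr
  | off | tgt | lst | eid | lc | num | gc | head | gdeg | nxt | dst | comp | que | out
  deriving DecidableEq

/-- The memory. -/
structure Store where
  reg : Reg → ℕ
  arr : Arr → ℕ → ℕ

def Store.setReg (s : Store) (x : Reg) (a : ℕ) : Store :=
  ⟨Function.update s.reg x a, s.arr⟩

def Store.setArr (s : Store) (A : Arr) (i a : ℕ) : Store :=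
  ⟨s.reg, Function.update s.arr A (Function.update (s.arr A) i a)⟩

/-- Expressions: constants, registers, array cells and sums. -/
inductive Exp
  | const (a : ℕ)
  | reg (x : Reg)
  | get (A : Arr) (i : Exp)
  | add (a b : Exp)

def Exp.val (s : Store) : Exp → ℕ
  | const a => a
  | reg x => s.reg x
  | get A i => s.arr A (i.val s)
  | add a b => a.val s + b.val s

/-- The number of steps in the evaluation of an expression. -/
def Exp.cost : Exp → ℕ
  | const _ => 1
  | reg _ => 1
  | get _ i => i.cost + 1
  | add a b => a.cost + b.cost + 1

inductive Test
  | eq (a b : Exp)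
  | lt (a b : Exp)

def Test.val (s : Store) : Test → Bool
  | eq a b => decide (a.val s = b.val s)
  | lt a b => decide (a.val s < b.val s)

def Test.cost : Test → ℕ
  | eq a b => a.cost + b.cost + 1
  | lt a b => a.cost + b.cost + 1

/-- Programs. `loop x a b c` executes `c` for `x = a, a + 1, …, b - 1`, where the bounds are
evaluated once, before the first round. -/
inductive Cmd
  | skip
  | set (x : Reg) (a : Exp)
  | put (A : Arr) (i a : Exp)
  | seq (c d : Cmd)
  | ite (b : Test) (c d : Cmd)
  | loop (x : Reg) (a b : Exp) (c : Cmd)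

/-- The first `m` rounds of a loop in which `x` counts upwards from `a`, with body `f`; a pair
consists of a memory and the number of steps made so far. -/
def rounds (f : Store → Store × ℕ) (x : Reg) (a : ℕ) (s : Store × ℕ) : ℕ → Store × ℕ
  | 0 => s
  | m + 1 =>
    let s₁ := rounds f x a s m
    let s₂ := f (s₁.1.setReg x (a + m))
    (s₂.1, s₁.2 + 1 + s₂.2)

/-- The result of a program on a memory: the final memory and the number of steps. -/
def Cmd.run : Cmd → Store → Store × ℕ
  | skip, s => (s, 1)
  | set x a, s => (s.setReg x (a.val s), a.cost + 1)
  | put A i a, s => (s.setArr A (i.val s) (a.val s), i.cost + a.cost + 1)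
  | seq c d, s =>
    let s₁ := c.run s
    let s₂ := d.run s₁.1
    (s₂.1, s₁.2 + s₂.2)
  | ite b c d, s =>
    let s₁ := if b.val s then c.run s else d.run s
    (s₁.1, b.cost + s₁.2)
  | loop x a b c, s => rounds c.run x (a.val s) (s, a.cost + b.cost + 1) (b.val s - a.val s)

instance : Coe Reg Exp := ⟨Exp.reg⟩
instance (a : ℕ) : OfNat Exp a := ⟨Exp.const a⟩
instance : Add Exp := ⟨Exp.add⟩

infixr:60 " ;; " => Cmd.seq
infix:62 " ::= " => Cmd.set

def Cmd.ifThen (b : Test) (c : Cmd) : Cmd := Cmd.ite b c Cmd.skip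

def Cmd.ifNot (b : Test) (c : Cmd) : Cmd := Cmd.ite b Cmd.skip c

/-! ### The algorithm

The input graph has the vertices `0, …, n - 1` and is given by adjacency lists: the neighbours
of `v` are the entries `tgt[p]` with `off[v] ≤ p < off[v + 1]` (the *slots* of `v`). The set `W`
is given as a list `lst[0], …, lst[k - 1]`. -/

open PSP.Exp PSP.Cmd

/-- Let `p` run through the slots of `x`. -/
def forSlots (p x : Reg) (c : Cmd) : Cmd :=
  loop p (get .off x) (get .off (x + 1)) c

/-- Name the edges: the two slots of an edge get a common name `eid`, namely the slot
that belongs to its smaller end. -/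
def nameEdges : Cmd :=
  loop .v 0 (reg .n) (forSlots .p .v (
    .w ::= get .tgt Reg.p ;;
    ite (.lt Reg.v Reg.w)
      (put .eid Reg.p Reg.p)
      (forSlots .q .w (
        ifThen (.eq (get .tgt Reg.q) Reg.v) (put .eid Reg.p Reg.q)))))

/-- Set `fl` to `1` if `a` and `b` are adjacent and to `0` otherwise. -/
def testAdj (a b : Reg) : Cmd :=
  .fl ::= 0 ;;
  forSlots .i a (ifThen (.eq (get .tgt Reg.i) b) (.fl ::= 1))

/-- For edges `ab` and `ac` with `b ≠ c`, count in `cnt` the squares spanned by them. If `cnt > 0`,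
then `chord` becomes `0` if none of these squares has a chord, and `1` otherwise. -/
def countSquares (a b c : Reg) : Cmd :=
  .cnt ::= 0 ;;
  testAdj b c ;;
  .chord ::= Reg.fl ;;
  forSlots .r b (
    .x ::= get .tgt Reg.r ;;
    ifNot (.eq Reg.x a) (
      testAdj .x c ;;
      ifThen (.eq Reg.fl 1) (
        .cnt ::= Reg.cnt + 1 ;;
        testAdj .x a ;;
        ifThen (.eq Reg.fl 1) (.chord ::= 1))))

/-- Execute `d` unless the counted square is unique and chordless. -/
def unlessUniqueChordless (d : Cmd) : Cmd :=
  ite (.eq Reg.cnt 1) (ifNot (.eq Reg.chord 0) d) d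

/-- Merge the local classes of the edges `e` and `f`; `lc` holds the class of each edge that is
incident with a neighbour of `v`. -/
def mergeClasses : Cmd :=
  .la ::= get .lc Reg.e ;;
  .lb ::= get .lc Reg.f ;;
  ifNot (.eq Reg.la Reg.lb) (
    forSlots .i .v (
      .y ::= get .tgt Reg.i ;;
      forSlots .j .y (
        ifThen (.eq (get .lc (get .eid Reg.j)) Reg.lb) (
          put .lc (get .eid Reg.j) Reg.la))))

/-- Compute the classes of `𝔡_v^*`, where `𝔡_v` consists of all pairs of edges in `δ` of which at
least one is incident with `v`. All squares that matter lie in the subgraph induced by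
the closed 2-neighbourhood of `v`. -/
def localClasses : Cmd :=
  -- every edge forms a class of its own
  forSlots .p .v (
    .u ::= get .tgt Reg.p ;;
    forSlots .q .u (
      put .lc (get .eid Reg.q) (get .eid Reg.q) ;;
      put .num (get .eid Reg.q) 0)) ;;
  -- pairs `vu`, `vw` in condition (i), and pairs `vu`, `wx` in condition (ii)
  forSlots .p .v (
    .u ::= get .tgt Reg.p ;;
    .e ::= get .eid Reg.p ;;
    forSlots .s .v (
      .w ::= get .tgt Reg.s ;;
      ifNot (.eq Reg.u Reg.w) (
        countSquares .v .u .w ;;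
        unlessUniqueChordless (.f ::= get .eid Reg.s ;; mergeClasses) ;;
        testAdj .u .w ;;
        ifThen (.eq Reg.fl 0) (
          forSlots .r .u (
            .x ::= get .tgt Reg.r ;;
            ifNot (.eq Reg.x Reg.v) (
              testAdj .x .v ;;
              ifThen (.eq Reg.fl 0) (
                forSlots .q .w (
                  ifThen (.eq (get .tgt Reg.q) Reg.x) (
                    .f ::= get .eid Reg.q ;; mergeClasses))))))))) ;;
  -- pairs `uv`, `uw` in condition (i)
  forSlots .p .v (
    .u ::= get .tgt Reg.p ;;
    .e ::= get .eid Reg.p ;;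
    forSlots .q .u (
      .w ::= get .tgt Reg.q ;;
      ifNot (.eq Reg.w Reg.v) (
        countSquares .u .v .w ;;
        unlessUniqueChordless (.f ::= get .eid Reg.q ;; mergeClasses))))

/-- Add the edge between the colours `a` and `b` to the list of neighbours of `a` in the colour
graph. -/
def addColourArc (a b : Reg) : Cmd :=
  .ne ::= Reg.ne + 1 ;;
  put .dst Reg.ne b ;;
  put .nxt Reg.ne (get .head a) ;;
  put .head a Reg.ne ;;
  put .gdeg a (get .gdeg a + 1)

/-- Give the edge in slot `p` its new colour; if it has an old colour already, join the old and the
new colour in the colour graph. -/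
def colourEdge (p : Reg) : Cmd :=
  .f ::= get .eid p ;;
  .new ::= get .num (get .lc Reg.f) ;;
  .old ::= get .gc Reg.f ;;
  ifNot (.eq Reg.old 0) (addColourArc .old .new ;; addColourArc .new .old) ;;
  put .gc Reg.f Reg.new

/-- Add one new colour for each class of `𝔡_v^*` restricted to the partial star product `S_v`
(each of them contains an edge at `v`), and colour the edges of `S_v`: the edges at `v`, and the
edges opposite to them in the squares spanned by two edges at `v` in different classes. -/
def colourStarProduct : Cmd :=
  forSlots .p .v (
    .la ::= get .lc (get .eid Reg.p) ;;
    ifThen (.eq (get .num Reg.la) 0) (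
      .nc ::= Reg.nc + 1 ;;
      put .num Reg.la Reg.nc ;;
      put .head Reg.nc 0 ;;
      put .gdeg Reg.nc 0 ;;
      put .comp Reg.nc 0)) ;;
  forSlots .p .v (colourEdge .p) ;;
  forSlots .p .v (
    .u ::= get .tgt Reg.p ;;
    forSlots .s .v (
      .w ::= get .tgt Reg.s ;;
      ifNot (.eq (get .lc (get .eid Reg.p)) (get .lc (get .eid Reg.s))) (
        forSlots .r .u (
          .x ::= get .tgt Reg.r ;;
          ifNot (.eq Reg.x Reg.v) (
            testAdj .x .w ;;
            ifThen (.eq Reg.fl 1) (colourEdge .r))))))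

/-- Take the next colour from the queue and put its neighbours that were not reached before into
the same component. -/
def exploreColour : Cmd :=
  .y ::= get .que Reg.qh ;;
  .qh ::= Reg.qh + 1 ;;
  .ptr ::= get .head Reg.y ;;
  loop .i 0 (get .gdeg Reg.y) (
    .x ::= get .dst Reg.ptr ;;
    ifThen (.eq (get .comp Reg.x) 0) (
      put .comp Reg.x Reg.numComp ;;
      put .que Reg.qt Reg.x ;;
      .qt ::= Reg.qt + 1) ;;
    .ptr ::= get .nxt Reg.ptr)

/-- Compute the connected components `1, …, numComp` of the colour graph, whose vertices are the
colours `1, …, nc`, by breadth-first search. Each round explores a colour in the queue or, if the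
queue is empty, passes on to the next colour. -/
def components : Cmd :=
  put .comp 0 0 ;;
  .numComp ::= 0 ;;
  .qh ::= 0 ;;
  .qt ::= 0 ;;
  .c ::= 0 ;;
  loop .t 0 (Reg.nc + Reg.nc) (
    ite (.lt Reg.qh Reg.qt)
      exploreColour
      (.c ::= Reg.c + 1 ;;
        ifThen (.eq (get .comp Reg.c) 0) (
          .numComp ::= Reg.numComp + 1 ;;
          put .comp Reg.c Reg.numComp ;;
          put .que Reg.qt Reg.c ;;
          .qt ::= Reg.qt + 1)))

/-- The algorithm with input `G` and `W`. At the end, `out[p] = 0` if the edge in slot `p` does not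
belong to the union of the `S_v`, `v ∈ W`, and otherwise `out[p]` is the number in
`1, …, numComp` of the class of this edge. -/
def localColouring : Cmd :=
  nameEdges ;;
  -- no edge is coloured, and the colour graph is empty
  loop .p 0 (get .off Reg.n) (put .gc Reg.p 0) ;;
  .nc ::= 0 ;;
  .ne ::= 0 ;;
  loop .t 0 Reg.k (
    .v ::= get .lst Reg.t ;;
    localClasses ;;
    colourStarProduct) ;;
  components ;;
  loop .p 0 (get .off Reg.n) (
    put .out Reg.p (get .comp (get .gc (get .eid Reg.p))))

/-! ### Input and output -/

section InOut

variable {V : Type*} [Fintype V]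

/-- The memory `s` holds adjacency lists of `G` and a list of `W`, both in any order, where `idx`
numbers the vertices. Nothing is assumed about the rest of the memory. -/
structure IsInput (G : SimpleGraph V) [DecidableRel G.Adj] (W : Finset V)
    (idx : V ≃ Fin (Fintype.card V)) (s : Store) : Prop where
  card_eq : s.reg .n = Fintype.card V
  off_zero : s.arr .off 0 = 0
  off_succ : ∀ v, s.arr .off (idx v + 1) = s.arr .off (idx v) + G.degree v
  tgt_bijOn : ∀ v, Set.BijOn (s.arr .tgt)
    (Set.Ico (s.arr .off (idx v)) (s.arr .off (idx v + 1)))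
    ((fun w => (idx w : ℕ)) '' G.neighborSet v)
  length_eq : s.reg .k = W.card
  lst_bijOn : Set.BijOn (s.arr .lst) (Set.Iio W.card) ((fun w => (idx w : ℕ)) '' W)

/-- With the input `s`, the output in the memory `s'` is the partition of the edge set of `G` into
the classes `1, …, numComp` of the relation `R`: all numbers occur, both slots of an edge hold the
number of its class, and two edges have the same number if and only if they are related. -/
def OutputsClasses (G : SimpleGraph V) (idx : V ≃ Fin (Fintype.card V)) (s s' : Store)
    (R : G.edgeSet → G.edgeSet → Prop) : Prop :=
  ∃ φ : G.edgeSet → ℕ,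
    Set.range φ = Set.Icc 1 (s'.reg .numComp) ∧
    (∀ e f, φ e = φ f ↔ R e f) ∧
    ∀ (v w : V) (h : G.Adj v w) (p : ℕ),
      p ∈ Set.Ico (s.arr .off (idx v)) (s.arr .off (idx v + 1)) →
      s.arr .tgt p = idx w → s'.arr .out p = φ ⟨s(v, w), h⟩

end InOut

end PSP

/-!
The program is verified with a calculus of weakest preconditions that speaks of the final memory
and of the number of steps at once (`Cmd.wp`); what a command leaves unchanged is read off its
text (`Cmd.Frame`), and loops through adjacency lists are treated with `wp_forSlots`, whose
potential function allows for an amortized count of the steps.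

*Local classes.* At a vertex `v`, the array `lc` describes a partition of the edges incident with
neighbours of `v`. It is enough to know that edges in the same class are related by `δ(G)^*`
(`LocalClasses`), and that the pairs of `δ(G)` consisting of two edges at `v`, or of an edge at
`v` and the opposite edge in a chordless square, are in the same class (`PairMerged`). Merging two
classes costs `O(Δ²)` steps, but there are at most `Δ²` classes to begin with, hence all mergings
at `v` together cost `O(Δ⁴)` steps. This is what the `potential` accounts for; the search for
squares is `O(Δ⁴)` anyway.

*Colours.* In the colour graph, adjacent colours belong to edges that are related by `δ(G)^*`,
since an arc is drawn only when one edge gets both colours (`Colouring`). Conversely, when the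
star at `v` has been treated, `StarDone` holds: the pairs of edges at `v` in `δ(G)` have colours
in the same component, and so have `vu` and `xw` for a chordless square `v u x w`, unless `vu` and
`vw` have. This suffices (`StarDone.sameClass_of_delta`): for opposite edges `ab` and `xc` of a
chordless square `a b x c`, either the star at `a` or the star at `c` connects their colours, or
both pairs `ab`, `ac` and `ca`, `cx` are connected, hence `ab` and `xc` are. So the components of
the colour graph yield the classes of `δ(G)^*` (`conn_iff_deltaStar`).

*Components.* The breadth-first search keeps the invariant that the number of the round is the sum
of the number of explored colours and of the number of colours passed (`Search`). As neither can
exceed the number `nc` of colours, both are equal to `nc` after `2 nc` rounds. The number of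
colours and the number of arcs are bounded by the number of steps in which they were created, so
the search takes `O(|V| Δ⁴)` steps, too.
-/

set_option linter.unusedSectionVars false

namespace PSP

/-! ### Reasoning about programs with unit cost -/

@[simp] theorem Store.setReg_arr (s : Store) (x : Reg) (a : ℕ) : (s.setReg x a).arr = s.arr := rfl

@[simp] theorem Store.setReg_reg (s : Store) (x y : Reg) (a : ℕ) :
    (s.setReg x a).reg y = if y = x then a else s.reg y := by
  simp [Store.setReg, Function.update_apply]

@[simp] theorem Store.setArr_reg (s : Store) (A : Arr) (i a : ℕ) :
    (s.setArr A i a).reg = s.reg := rfl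

theorem Store.setArr_arr_self (s : Store) (A : Arr) (i a : ℕ) :
    (s.setArr A i a).arr A = Function.update (s.arr A) i a := by
  simp [Store.setArr]

theorem Store.setArr_arr_of_ne (s : Store) {A B : Arr} (i a : ℕ) (h : B ≠ A) :
    (s.setArr A i a).arr B = s.arr B := by
  simp [Store.setArr, h]

@[simp] theorem Store.setArr_arr (s : Store) (A B : Arr) (i a : ℕ) :
    (s.setArr A i a).arr B = if B = A then Function.update (s.arr B) i a else s.arr B := by
  split_ifs with h
  · subst h; exact s.setArr_arr_self _ i a
  · exact s.setArr_arr_of_ne i a h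

namespace Exp

@[simp] theorem val_zero (s : Store) : (0 : Exp).val s = 0 := rfl
@[simp] theorem val_one (s : Store) : (1 : Exp).val s = 1 := rfl
@[simp] theorem cost_zero : (0 : Exp).cost = 1 := rfl
@[simp] theorem cost_one : (1 : Exp).cost = 1 := rfl
@[simp] theorem val_reg (s : Store) (x : Reg) : (Exp.reg x).val s = s.reg x := rfl
@[simp] theorem cost_reg (x : Reg) : (Exp.reg x).cost = 1 := rfl
@[simp] theorem val_get (s : Store) (A : Arr) (i : Exp) : (Exp.get A i).val s = s.arr A (i.val s) :=
  rfl
@[simp] theorem cost_get (A : Arr) (i : Exp) : (Exp.get A i).cost = i.cost + 1 := rfl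
@[simp] theorem val_add (s : Store) (a b : Exp) : (a + b).val s = a.val s + b.val s := rfl
@[simp] theorem cost_add (a b : Exp) : (a + b).cost = a.cost + b.cost + 1 := rfl

end Exp

namespace Test

@[simp] theorem val_eq (s : Store) (a b : Exp) :
    ((Test.eq a b).val s = true) ↔ a.val s = b.val s := by simp [Test.val]
@[simp] theorem val_lt (s : Store) (a b : Exp) :
    ((Test.lt a b).val s = true) ↔ a.val s < b.val s := by simp [Test.val]
@[simp] theorem cost_eq (a b : Exp) : (Test.eq a b).cost = a.cost + b.cost + 1 := rfl
@[simp] theorem cost_lt (a b : Exp) : (Test.lt a b).cost = a.cost + b.cost + 1 := rfl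

end Test

namespace Cmd

/-- Whether the register `y` is assigned to somewhere in the program. -/
def writesReg : Cmd → Reg → Bool
  | skip, _ => false
  | set x _, y => decide (x = y)
  | put _ _ _, _ => false
  | seq c d, y => c.writesReg y || d.writesReg y
  | ite _ c d, y => c.writesReg y || d.writesReg y
  | loop x _ _ c, y => decide (x = y) || c.writesReg y

/-- Whether a cell of the array `B` is assigned to somewhere in the program. -/
def writesArr : Cmd → Arr → Bool
  | skip, _ => false
  | set _ _, _ => false
  | put A _ _, B => decide (A = B)
  | seq c d, B => c.writesArr B || d.writesArr B
  | ite _ c d, B => c.writesArr B || d.writesArr B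
  | loop _ _ _ c, B => c.writesArr B

/-- The memories `s` and `s'` differ at most in registers and arrays that `c` assigns to. -/
structure Frame (c : Cmd) (s s' : Store) : Prop where
  reg' : ∀ x, c.writesReg x = false → s'.reg x = s.reg x
  arr' : ∀ A, c.writesArr A = false → s'.arr A = s.arr A

theorem Frame.reg {c : Cmd} {s s' : Store} (h : Frame c s s') (x : Reg)
    (hx : c.writesReg x = false := by rfl) : s'.reg x = s.reg x := h.reg' x hx

theorem Frame.arr {c : Cmd} {s s' : Store} (h : Frame c s s') (A : Arr)
    (hA : c.writesArr A = false := by rfl) : s'.arr A = s.arr A := h.arr' A hA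

/-- Induction on the number of rounds of a loop, for a property of the memory and of the number of
steps. -/
theorem rounds_induction {f : Store → Store × ℕ} {x : Reg} {a : ℕ} {s : Store × ℕ} {m : ℕ}
    (I : ℕ → Store → ℕ → Prop) (h0 : I 0 s.1 s.2)
    (hs : ∀ i < m, ∀ s₁ k, I i s₁ k →
      I (i + 1) (f (s₁.setReg x (a + i))).1 (k + 1 + (f (s₁.setReg x (a + i))).2)) :
    I m (rounds f x a s m).1 (rounds f x a s m).2 := by
  induction m with
  | zero => exact h0
  | succ m ih =>
    exact hs m (Nat.lt_succ_self m) _ _ (ih fun i hi => hs i (hi.trans (Nat.lt_succ_self m)))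

/-- A program changes only the registers and arrays that it assigns to. -/
theorem frame_run (c : Cmd) : ∀ s, Frame c s (c.run s).1 := by
  induction c with
  | skip => exact fun s => ⟨fun _ _ => rfl, fun _ _ => rfl⟩
  | set x a =>
    refine fun s => ⟨fun y hy => ?_, fun _ _ => rfl⟩
    have : y ≠ x := by rintro rfl; simp [writesReg] at hy
    simp [run, this]
  | put A i a =>
    refine fun s => ⟨fun _ _ => rfl, fun B hB => ?_⟩
    have : B ≠ A := by rintro rfl; simp [writesArr] at hB
    simp [run, this]
  | seq c d hc hd =>
    refine fun s => ⟨fun y hy => ?_, fun B hB => ?_⟩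
    · simp only [writesReg, Bool.or_eq_false_iff] at hy
      exact ((hd _).reg' y hy.2).trans ((hc s).reg' y hy.1)
    · simp only [writesArr, Bool.or_eq_false_iff] at hB
      exact ((hd _).arr' B hB.2).trans ((hc s).arr' B hB.1)
  | ite b c d hc hd =>
    refine fun s => ⟨fun y hy => ?_, fun B hB => ?_⟩
    · simp only [writesReg, Bool.or_eq_false_iff] at hy
      by_cases hb : b.val s
      · simpa [run, hb] using (hc s).reg' y hy.1
      · simpa [run, hb] using (hd s).reg' y hy.2
    · simp only [writesArr, Bool.or_eq_false_iff] at hB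
      by_cases hb : b.val s
      · simpa [run, hb] using (hc s).arr' B hB.1
      · simpa [run, hb] using (hd s).arr' B hB.2
  | loop x a b c hc =>
    intro s
    refine rounds_induction (fun _ s₁ _ => Frame (loop x a b c) s s₁)
      ⟨fun _ _ => rfl, fun _ _ => rfl⟩ ?_
    refine fun i _ s₁ k h => ⟨fun y hy => ?_, fun B hB => ?_⟩
    · rw [← h.reg' y hy]
      simp only [writesReg, Bool.or_eq_false_iff, decide_eq_false_iff_not] at hy
      rw [(hc _).reg' y hy.2, Store.setReg_reg, if_neg (Ne.symm hy.1)]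
    · rw [← h.arr' B hB, (hc _).arr' B hB, Store.setReg_arr]

/-- The program `c`, started in the memory `s`, ends in a memory and after a number of steps that
satisfy `Q`. -/
def wp (c : Cmd) (s : Store) (Q : Store → ℕ → Prop) : Prop := Q (c.run s).1 (c.run s).2

theorem wp_set {s : Store} {x a Q} :
    (set x a).wp s Q ↔ Q (s.setReg x (a.val s)) (a.cost + 1) := Iff.rfl

theorem wp_put {s : Store} {A i a Q} :
    (put A i a).wp s Q ↔ Q (s.setArr A (i.val s) (a.val s)) (i.cost + a.cost + 1) := Iff.rfl

theorem wp_seq {s : Store} {c d Q} :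
    (seq c d).wp s Q ↔ c.wp s fun s₁ k₁ => d.wp s₁ fun s₂ k₂ => Q s₂ (k₁ + k₂) := Iff.rfl

theorem wp_ite {s : Store} {b c d Q} :
    (ite b c d).wp s Q ↔ (b.val s = true → c.wp s fun s' k => Q s' (b.cost + k)) ∧
      (¬ b.val s = true → d.wp s fun s' k => Q s' (b.cost + k)) := by
  by_cases hb : b.val s <;> simp [wp, run, hb]

theorem wp_ifThen {s : Store} {b c Q} :
    (ifThen b c).wp s Q ↔ (b.val s = true → c.wp s fun s' k => Q s' (b.cost + k)) ∧
      (¬ b.val s = true → Q s (b.cost + 1)) := wp_ite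

theorem wp_ifNot {s : Store} {b c Q} :
    (ifNot b c).wp s Q ↔ (b.val s = true → Q s (b.cost + 1)) ∧
      (¬ b.val s = true → c.wp s fun s' k => Q s' (b.cost + k)) := wp_ite

theorem wp_mono {s : Store} {c : Cmd} {Q Q' : Store → ℕ → Prop} (h : c.wp s Q)
    (hQ : ∀ s' k, Frame c s s' → Q s' k → Q' s' k) : c.wp s Q' :=
  hQ _ _ (c.frame_run s) h

/-- The invariant rule for loops. The invariant `I i` speaks of the memory and of the number of
steps after `i` rounds. -/
theorem wp_loop {s : Store} {x : Reg} {a b : Exp} {c : Cmd} (I : ℕ → Store → ℕ → Prop) (h0 : I 0 s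
    0)
    (hs : ∀ i s₁ k, i < b.val s - a.val s → Frame (loop x a b c) s s₁ → I i s₁ k →
      c.wp (s₁.setReg x (a.val s + i)) fun s' k' => I (i + 1) s' (k + 1 + k')) :
    (loop x a b c).wp s fun s' k =>
      ∃ k', k = a.cost + b.cost + 1 + k' ∧ I (b.val s - a.val s) s' k' := by
  have key : ∀ m ≤ b.val s - a.val s, ∀ k₀,
      (fun s' k => ∃ k', k = k₀ + k' ∧ I m s' k' ∧ Frame (loop x a b c) s s')
        (rounds c.run x (a.val s) (s, k₀) m).1 (rounds c.run x (a.val s) (s, k₀) m).2 := by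
    intro m hm k₀
    refine rounds_induction (I := fun i s' k => ∃ k', k = k₀ + k' ∧ I i s' k' ∧
      Frame (loop x a b c) s s') ⟨0, rfl, h0, fun _ _ => rfl, fun _ _ => rfl⟩ ?_
    rintro i hi s₁ k ⟨k', rfl, hI, hf⟩
    refine ⟨_, ?_, hs i s₁ k' (hi.trans_le hm) hf hI, fun y hy => ?_, fun B hB => ?_⟩
    · ring
    · rw [← hf.reg' y hy]
      simp only [writesReg, Bool.or_eq_false_iff, decide_eq_false_iff_not] at hy
      rw [(c.frame_run _).reg' y hy.2, Store.setReg_reg, if_neg (Ne.symm hy.1)]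
    · rw [← hf.arr' B hB, (c.frame_run _).arr' B hB, Store.setReg_arr]
  obtain ⟨k', hk, hI, -⟩ := key _ le_rfl (a.cost + b.cost + 1)
  exact ⟨k', hk, hI⟩

end Cmd

open Cmd

/-! ### Adjacency lists -/

section Lists

variable {V : Type*} [Fintype V] [DecidableEq V] {G : SimpleGraph V} [DecidableRel G.Adj]
  {idx : V ≃ Fin (Fintype.card V)} {D : ℕ} {M : Arr → ℕ → ℕ}

/-- The entry `q` of the adjacency lists in the arrays `M` belongs to `v` and holds `w`. -/
def IsSlot (idx : V ≃ Fin (Fintype.card V)) (M : Arr → ℕ → ℕ) (v w : V) (q : ℕ) : Prop :=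
  M .off (idx v) ≤ q ∧ q < M .off (idx v + 1) ∧ M .tgt q = idx w

/-- The arrays `M` hold adjacency lists of `G`, and `D` is a positive bound on the degrees. -/
structure Lists (G : SimpleGraph V) [DecidableRel G.Adj] (idx : V ≃ Fin (Fintype.card V)) (D : ℕ)
    (M : Arr → ℕ → ℕ) : Prop where
  off_succ : ∀ v, M .off (idx v + 1) = M .off (idx v) + G.degree v
  tgt_bijOn : ∀ v, Set.BijOn (M .tgt) (Set.Ico (M .off (idx v)) (M .off (idx v + 1)))
    ((fun w => (idx w : ℕ)) '' G.neighborSet v)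
  degree_le : ∀ v, G.degree v ≤ D
  one_le : 1 ≤ D

theorem Lists.congr {M' : Arr → ℕ → ℕ} (h : Lists G idx D M) (ho : M' .off = M .off)
    (ht : M' .tgt = M .tgt) : Lists G idx D M' := by
  obtain ⟨h1, h2, h3, h4⟩ := h
  exact ⟨by rwa [ho], by rwa [ho, ht], h3, h4⟩

theorem IsSlot.congr {M' : Arr → ℕ → ℕ} {v w : V} {q : ℕ} (h : IsSlot idx M v w q)
    (ho : M' .off = M .off) (ht : M' .tgt = M .tgt) : IsSlot idx M' v w q := by
  unfold IsSlot at *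
  rwa [ho, ht]

theorem coe_idx_inj {v w : V} : (idx v : ℕ) = idx w ↔ v = w := by
  rw [Fin.val_inj, idx.apply_eq_iff_eq]

theorem Lists.exists_slot (h : Lists G idx D M) {v w : V} (hvw : G.Adj v w) :
    ∃ q, IsSlot idx M v w q := by
  obtain ⟨q, hq, hqw⟩ := (h.tgt_bijOn v).surjOn ⟨w, hvw, rfl⟩
  exact ⟨q, hq.1, hq.2, hqw⟩

theorem Lists.exists_adj (h : Lists G idx D M) {v : V} {q : ℕ} (h1 : M .off (idx v) ≤ q)
    (h2 : q < M .off (idx v + 1)) : ∃ w, G.Adj v w ∧ IsSlot idx M v w q := by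
  obtain ⟨w, hw, hwq⟩ := (h.tgt_bijOn v).mapsTo ⟨h1, h2⟩
  exact ⟨w, hw, h1, h2, hwq.symm⟩

theorem IsSlot.right_unique {v w w' : V} {q : ℕ} (h : IsSlot idx M v w q)
    (h' : IsSlot idx M v w' q) : w = w' := coe_idx_inj.1 (h.2.2.symm.trans h'.2.2)

theorem Lists.slot_unique (h : Lists G idx D M) {v w : V} {q q' : ℕ} (hq : IsSlot idx M v w q)
    (hq' : IsSlot idx M v w q') : q = q' :=
  (h.tgt_bijOn v).injOn ⟨hq.1, hq.2.1⟩ ⟨hq'.1, hq'.2.1⟩ (hq.2.2.trans hq'.2.2.symm)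

theorem Lists.adj_of_isSlot (h : Lists G idx D M) {v w : V} {q : ℕ} (hq : IsSlot idx M v w q) :
    G.Adj v w := by
  obtain ⟨w', hw, hq'⟩ := h.exists_adj hq.1 hq.2.1
  exact hq.right_unique hq' ▸ hw

/-- The rule for a loop through the slots of a vertex `v`. The invariant `I S` holds when the
neighbours in `S` have been treated, and `Φ` is a potential for the amortized analysis of the number
of steps. -/
theorem wp_forSlots {s : Store} {p x : Reg} {c : Cmd} {v : V} (I : Finset V → Store → Prop)
    (Φ : Store → ℕ) (T : ℕ) (hL : Lists G idx D s.arr) (hv : s.reg x = idx v) (h0 : I ∅ s)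
    (hs : ∀ S s₁ w q, Frame (forSlots p x c) s s₁ → Lists G idx D s₁.arr → I S s₁ → w ∉ S →
      G.Adj v w → IsSlot idx s₁.arr v w q → c.wp (s₁.setReg p q) fun s' k =>
        I (insert w S) s' ∧ k + Φ s' ≤ T + Φ s₁)
    (ho : c.writesArr .off = false := by rfl) (ht : c.writesArr .tgt = false := by rfl) :
    (forSlots p x c).wp s fun s' k =>
      I (G.neighborFinset v) s' ∧ k + Φ s' ≤ (T + 8) * D + Φ s := by
  classical
  set o := s.arr .off (idx v) with ho_def
  let N : ℕ → Finset V := fun i => {w ∈ G.neighborFinset v | ∃ q < o + i, IsSlot idx s.arr v w q}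
  have hval : ((Exp.get .off (Exp.reg x + 1)).val s - (Exp.get .off (Exp.reg x)).val s) =
      G.degree v := by
    have := hL.off_succ v
    simp only [Exp.val_get, Exp.val_add, Exp.val_reg, Exp.val_one, hv]
    omega
  refine wp_mono (wp_loop (fun i s₁ k => I (N i) s₁ ∧ k + Φ s₁ ≤ i * (T + 1) + Φ s) ?_ ?_) ?_
  · have : N 0 = ∅ := by
      ext w
      simp only [N, Finset.mem_filter, Finset.notMem_empty, iff_false]
      rintro ⟨-, q, hq, hq'⟩
      have := hq'.1
      omega
    rw [this]
    exact ⟨h0, by simp⟩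
  · rintro i s₁ k hi hf ⟨hI, hk⟩
    have hoff := hf.arr .off ho
    have htgt := hf.arr .tgt ht
    rw [hval] at hi
    obtain ⟨w, hvw, hw⟩ := hL.exists_adj (v := v) (q := o + i) (by omega)
      (by have := hL.off_succ v; omega)
    have hwS : w ∉ N i := by
      simp only [N, Finset.mem_filter, not_and, not_exists]
      rintro - q hq hq'
      have := hL.slot_unique hw hq'
      omega
    have hN : N (i + 1) = insert w (N i) := by
      ext w'
      simp only [N, Finset.mem_filter, Finset.mem_insert, SimpleGraph.mem_neighborFinset]
      constructor
      · rintro ⟨h1, q, hq, hq'⟩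
        rcases Nat.lt_or_ge q (o + i) with h | h
        · exact Or.inr ⟨h1, q, h, hq'⟩
        · obtain rfl : q = o + i := by omega
          exact Or.inl (hq'.right_unique hw)
      · rintro (rfl | ⟨h1, q, hq, hq'⟩)
        · exact ⟨hvw, _, by omega, hw⟩
        · exact ⟨h1, q, by omega, hq'⟩
    have hq0 : (Exp.get .off (Exp.reg x)).val s + i = o + i := by simp [hv, ho_def]
    rw [hq0]
    refine wp_mono (hs (N i) s₁ w (o + i) hf (hL.congr hoff htgt) hI hwS hvw (hw.congr hoff htgt))
      ?_
    rintro s' k' - ⟨h1, h2⟩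
    exact ⟨hN ▸ h1, by rw [Nat.add_mul, Nat.one_mul]; omega⟩
  · rintro s' k - ⟨k', rfl, h1, h2⟩
    rw [hval] at h1 h2
    have hN : N (G.degree v) = G.neighborFinset v := by
      ext w
      simp only [N, Finset.mem_filter, SimpleGraph.mem_neighborFinset, and_iff_left_iff_imp]
      intro hw
      obtain ⟨q, hq⟩ := hL.exists_slot hw
      have := hq.2.1
      have := hL.off_succ v
      exact ⟨q, by omega, hq⟩
    refine ⟨hN ▸ h1, ?_⟩
    have hd := Nat.mul_le_mul_right (T + 1) (hL.degree_le v)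
    have h3 := hL.one_le
    simp only [Exp.cost_get, Exp.cost_add, Exp.cost_reg, Exp.cost_one]
    nlinarith

/-- The rule for a loop through the slots of `v` whose body establishes `A w` for the current
neighbour `w`, where all rounds are steps in a preorder that preserves these properties. -/
theorem wp_forSlots_forall {s : Store} {p x : Reg} {c : Cmd} {v : V} (Inv : Store → Prop)
    (Step : Store → Store → Prop) (A : V → Store → Prop) (Φ : Store → ℕ) (T : ℕ)
    (hL : Lists G idx D s.arr) (hv : s.reg x = idx v) (h0 : Inv s)
    (hrefl : ∀ s, Step s s) (htrans : ∀ {s₁ s₂ s₃}, Step s₁ s₂ → Step s₂ s₃ → Step s₁ s₃)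
    (hA : ∀ {w s₁ s₂}, Step s₁ s₂ → A w s₁ → A w s₂)
    (hs : ∀ s₁ w q, Frame (forSlots p x c) s s₁ → Lists G idx D s₁.arr → Inv s₁ → Step s s₁ →
      G.Adj v w → IsSlot idx s₁.arr v w q → c.wp (s₁.setReg p q) fun s' k =>
        Inv s' ∧ Step s₁ s' ∧ A w s' ∧ k + Φ s' ≤ T + Φ s₁)
    (ho : c.writesArr .off = false := by rfl) (ht : c.writesArr .tgt = false := by rfl) :
    (forSlots p x c).wp s fun s' k =>
      Inv s' ∧ Step s s' ∧ (∀ w, G.Adj v w → A w s') ∧ k + Φ s' ≤ (T + 8) * D + Φ s := by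
  refine wp_mono (wp_forSlots (fun S s' => Inv s' ∧ Step s s' ∧ ∀ w ∈ S, A w s') Φ T hL hv
    ⟨h0, hrefl s, by simp⟩ ?_ ho ht) ?_
  · rintro S s₁ w q hf hL₁ ⟨h1, h2, h3⟩ hwS hvw hq
    refine wp_mono (hs s₁ w q hf hL₁ h1 h2 hvw hq) ?_
    rintro s' k - ⟨g1, g2, g3, g4⟩
    refine ⟨⟨g1, htrans h2 g2, fun w' hw' => ?_⟩, g4⟩
    rcases Finset.mem_insert.1 hw' with rfl | hw'
    · exact g3
    · exact hA g2 (h3 w' hw')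
  · rintro s' k - ⟨⟨h1, h2, h3⟩, h4⟩
    exact ⟨h1, h2, fun w hw => h3 w (by simpa using hw), h4⟩

theorem wp_testAdj {s : Store} {a b : Reg} {u w : V} (hL : Lists G idx D s.arr)
    (hu : s.reg a = idx u) (hw : s.reg b = idx w) (ha : a ≠ .fl) (hb : b ≠ .fl) (hb' : b ≠ .i) :
    (testAdj a b).wp s fun s' k => s'.reg .fl = (if G.Adj u w then 1 else 0) ∧ k ≤ 17 * D := by
  rw [testAdj, wp_seq, wp_set]
  have hD := hL.one_le
  refine wp_mono (wp_forSlots (v := u) (fun S s' => s'.reg .fl = if w ∈ S then 1 else 0) (fun _ =>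
    0) 7
    hL (by simp [hu, ha]) (by simp) ?_) ?_
  · intro S s₁ w' q hf hL₁ hI hS hadj hq
    have hb1 : s₁.reg b = idx w := by
      rw [hf.reg b (by simp [forSlots, writesReg, ifThen, hb.symm, hb'.symm])]
      simp [hb, hw]
    rw [wp_ifThen, wp_set]
    simp only [Test.val_eq, Exp.val_get, Exp.val_reg, Store.setReg_arr, Store.setReg_reg, if_true,
      hb', if_false, hb1, hq.2.2, Finset.mem_insert, Exp.val_one, Test.cost_eq, Exp.cost_get,
      Exp.cost_reg, Exp.cost_one, coe_idx_inj, reduceCtorEq]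
    refine ⟨?_, ?_⟩
    · rintro rfl
      simp
    · intro h
      simp [hI, Ne.symm h]
  · rintro s' k - ⟨h1, h2⟩
    simp only [SimpleGraph.mem_neighborFinset] at h1
    refine ⟨h1, ?_⟩
    simp only [Exp.cost_zero]
    omega

/-- The edges `ab` and `ac` span exactly one square, and this square is chordless. -/
def UniqueChordless (G : SimpleGraph V) (a b c : V) : Prop :=
  ∃ x, ChordlessSquare G a b x c ∧ ∀ y, Square G a b y c → y = x

set_option maxHeartbeats 400000 in
/-- After `countSquares`, the registers `cnt` and `chord` tell whether the edges span exactly one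
square and this square is chordless. -/
theorem wp_countSquares {s : Store} {a b c : Reg} {va vb vc : V} (hL : Lists G idx D s.arr)
    (ha : s.reg a = idx va) (hb : s.reg b = idx vb) (hc : s.reg c = idx vc)
    (hab : G.Adj va vb) (hac : G.Adj va vc) (hbc : vb ≠ vc)
    (ha' : a = .v ∨ a = .u ∨ a = .w) (hb' : b = .v ∨ b = .u ∨ b = .w)
    (hc' : c = .v ∨ c = .u ∨ c = .w) :
    (countSquares a b c).wp s fun s' k =>
      ((s'.reg .cnt = 1 ∧ s'.reg .chord = 0) ↔ UniqueChordless G va vb vc) ∧ k ≤ 84 * D ^ 2 := by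
  have hD := hL.one_le
  have key : ∀ r : Reg, r = .v ∨ r = .u ∨ r = .w →
      r ≠ .cnt ∧ r ≠ .chord ∧ r ≠ .fl ∧ r ≠ .r ∧ r ≠ .x ∧ r ≠ .i := by
    rintro r (rfl | rfl | rfl) <;> simp
  obtain ⟨ha1, ha2, ha3, ha4, ha5, ha6⟩ := key a ha'
  obtain ⟨hb1, hb2, hb3, hb4, hb5, hb6⟩ := key b hb'
  obtain ⟨hc1, hc2, hc3, hc4, hc5, hc6⟩ := key c hc'
  have hT : ∀ {r : Reg} {x y : Reg} {s s' : Store}, r = .v ∨ r = .u ∨ r = .w →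
      Frame (testAdj x y) s s' → s'.reg r = s.reg r := by
    rintro r x y s s' (rfl | rfl | rfl) h <;> exact h.reg _
  rw [countSquares, wp_seq, wp_set, wp_seq]
  refine wp_mono (wp_testAdj (G := G) (idx := idx) (D := D) (u := vb) (w := vc) hL (by simp [hb,
    hb1])
    (by simp [hc, hc1]) hb3 hc3 hc6) ?_
  rintro s₁ k₁ hf₁ ⟨hfl₁, hk₁⟩
  have hL₁ : Lists G idx D s₁.arr := hL.congr (hf₁.arr .off) (hf₁.arr .tgt)
  rw [wp_seq, wp_set]
  have cnt₁ : s₁.reg .cnt = 0 := by rw [hf₁.reg .cnt]; simp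
  -- the squares counted so far
  let Q : Finset V → Finset V := fun S => {x ∈ S | x ≠ va ∧ G.Adj x vc}
  let P : Finset V → Prop := fun S => G.Adj vb vc ∨ ∃ x ∈ Q S, G.Adj va x
  have regs : ∀ {r : Reg}, r = .v ∨ r = .u ∨ r = .w → s₁.reg r = s.reg r := by
    intro r h
    rw [hT h hf₁, Store.setReg_reg, if_neg (key r h).1]
  refine wp_mono (wp_forSlots (v := vb) (fun S s' => s'.reg .cnt = (Q S).card ∧
    (s'.reg .chord = 0 ↔ ¬ P S)) (fun _ => 0) (17 * D + 17 * D + 20)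
    (s := s₁.setReg .chord ((Exp.reg .fl).val s₁)) hL₁ ?_ ?_ ?_) ?_
  · simp [hb2, regs hb', hb]
  · refine ⟨by simp [Q, cnt₁], ?_⟩
    simp only [P, Q, Exp.val_reg, Store.setReg_reg, if_true, hfl₁]
    simp
  · rintro S s₂ w q hf₂ hL₂ ⟨hcnt, hchord⟩ hwS hbw hq
    have hF : ∀ {r : Reg}, r = .v ∨ r = .u ∨ r = .w → s₂.reg r = s.reg r := by
      intro r h
      rw [← regs h]
      rcases h with rfl | rfl | rfl <;> rw [hf₂.reg _] <;> simp
    have hQ : ∀ h : w = va ∨ ¬ G.Adj w vc, Q (insert w S) = Q S := fun h => by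
      simp only [Q]
      rw [Finset.filter_insert, if_neg (by tauto)]
    have hQ' : ∀ h : w ≠ va ∧ G.Adj w vc, Q (insert w S) = insert w (Q S) := fun h => by
      simp only [Q]
      rw [Finset.filter_insert, if_pos h]
    rw [wp_seq, wp_set, wp_ifNot]
    have hx : (Exp.get .tgt (Exp.reg .r)).val (s₂.setReg .r q) = idx w := by simp [hq.2.2]
    simp only [hx]
    have hxa : (Test.eq (Exp.reg .x) (Exp.reg a)).val ((s₂.setReg .r q).setReg .x (idx w)) = true ↔
        w = va := by
      simp [ha5, ha4, hF ha', ha, coe_idx_inj]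
    rw [hxa]
    refine ⟨fun h => ?_, fun h => ?_⟩
    · rw [hQ (Or.inl h)]
      have hP : P (insert w S) ↔ P S := by simp only [P, hQ (Or.inl h)]
      rw [hP]
      refine ⟨⟨by simpa using hcnt, by simpa using hchord⟩, ?_⟩
      simp; try omega
    rw [wp_seq]
    refine wp_mono (wp_testAdj (G := G) (idx := idx) (D := D) (u := w) (w := vc) hL₂ (by simp)
      (by simp [hc5, hc4, hF hc', hc]) (by simp) hc3 hc6) ?_
    rintro s₃ k₃ hf₃ ⟨hfl₃, hk₃⟩
    have hL₃ : Lists G idx D s₃.arr := hL₂.congr (hf₃.arr .off) (hf₃.arr .tgt)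
    have cnt₃ : s₃.reg .cnt = (Q S).card := by rw [hf₃.reg .cnt]; simp [hcnt]
    have chord₃ : s₃.reg .chord = 0 ↔ ¬ P S := by rw [hf₃.reg .chord]; simp [hchord]
    rw [wp_ifThen]
    have hfl₃' : (Test.eq (Exp.reg .fl) 1).val s₃ = true ↔ G.Adj w vc := by
      simp [hfl₃]
    rw [hfl₃']
    refine ⟨fun hwc => ?_, fun hwc => ?_⟩
    swap
    · have hP : P (insert w S) ↔ P S := by simp only [P, hQ (Or.inr hwc)]
      rw [hP, hQ (Or.inr hwc)]
      refine ⟨⟨cnt₃, chord₃⟩, ?_⟩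
      simp; omega
    have hQc : (Q (insert w S)).card = (Q S).card + 1 := by
      rw [hQ' ⟨h, hwc⟩, Finset.card_insert_of_notMem (by simp [Q, hwS])]
    rw [wp_seq, wp_set, wp_seq]
    refine wp_mono (wp_testAdj (G := G) (idx := idx) (D := D) (u := w) (w := va) hL₃ ?_ ?_ (by
      simp) ha3
      ha6) ?_
    · simp [hf₃.reg .x]
    · have h1 : s₃.reg a = s₂.reg a := by
        rw [hT ha' hf₃]; simp [ha4, ha5]
      simp [ha1, h1, hF ha', ha]
    rintro s₄ k₄ hf₄ ⟨hfl₄, hk₄⟩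
    have cnt₄ : s₄.reg .cnt = (Q S).card + 1 := by rw [hf₄.reg .cnt]; simp [cnt₃]
    have chord₄ : s₄.reg .chord = 0 ↔ ¬ P S := by rw [hf₄.reg .chord]; simp [chord₃]
    have hfl₄' : (Test.eq (Exp.reg .fl) 1).val s₄ = true ↔ G.Adj w va := by
      simp [hfl₄]
    rw [wp_ifThen, wp_set, hfl₄', hQc]
    have hP : P (insert w S) ↔ P S ∨ G.Adj w va := by
      simp only [P, hQ' ⟨h, hwc⟩, Finset.mem_insert, exists_eq_or_imp, G.adj_comm va w]
      rw [or_comm (a := G.Adj w va), or_assoc]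
    clear_value P Q
    refine ⟨fun hwa => ?_, fun hwa => ?_⟩
    · refine ⟨⟨by simp [cnt₄], by simp [hP, hwa]⟩, ?_⟩
      simp; omega
    · refine ⟨⟨by simp [cnt₄], by simp [hP, hwa, chord₄]⟩, ?_⟩
      simp; omega
  · rintro s₂ k₂ - ⟨⟨hcnt, hchord⟩, hk₂⟩
    refine ⟨?_, ?_⟩
    · have hmem : ∀ x, x ∈ Q (G.neighborFinset vb) ↔ Square G va vb x vc := by
        intro x
        simp only [Q, Finset.mem_filter, SimpleGraph.mem_neighborFinset, Square]
        exact ⟨fun ⟨h1, h2, h3⟩ => ⟨hab, h1, h3, hac.symm, h2.symm, hbc⟩,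
          fun ⟨_, h1, h3, _, h2, _⟩ => ⟨h1, h2.symm, h3⟩⟩
      rw [hcnt, hchord, Finset.card_eq_one]
      constructor
      · rintro ⟨⟨x, hx⟩, hP⟩
        have h1 : x ∈ Q (G.neighborFinset vb) := by simp [hx]
        refine ⟨x, ⟨(hmem x).1 h1, fun h => hP (Or.inr ⟨x, h1, h⟩), fun h => hP (Or.inl h)⟩, ?_⟩
        intro y hy
        have := (hmem y).2 hy
        simpa [hx] using this
      · rintro ⟨x, ⟨h1, h2, h3⟩, h4⟩
        have hQx : Q (G.neighborFinset vb) = {x} := by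
          ext y
          rw [hmem, Finset.mem_singleton]
          exact ⟨h4 y, fun h => h ▸ h1⟩
        refine ⟨⟨x, hQx⟩, ?_⟩
        simp [P, hQx, h2, h3]
    · simp only [Exp.cost_zero, Exp.cost_reg]
      have h1 : D ≤ D ^ 2 := by nlinarith
      nlinarith

end Lists

/-! ### The names of the edges -/

section Names

variable {V : Type*} [Fintype V] [DecidableEq V] {G : SimpleGraph V} [DecidableRel G.Adj]
  {idx : V ≃ Fin (Fintype.card V)} {D : ℕ} {M : Arr → ℕ → ℕ}

theorem Lists.off_mono (h : Lists G idx D M) {i j : ℕ} (hij : i ≤ j) (hj : j ≤ Fintype.card V) :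
    M .off i ≤ M .off j := by
  induction j, hij using Nat.le_induction with
  | base => exact le_rfl
  | succ j hij ih =>
    have := h.off_succ (idx.symm ⟨j, hj⟩)
    simp only [Equiv.apply_symm_apply] at this
    have := ih (by omega)
    omega

theorem Lists.off_le (h : Lists G idx D M) (h0 : M .off 0 = 0) {i : ℕ} (hi : i ≤ Fintype.card V) :
    M .off i ≤ i * D := by
  induction i with
  | zero => simp [h0]
  | succ j ih =>
    have h1 := h.off_succ (idx.symm ⟨j, hi⟩)
    simp only [Equiv.apply_symm_apply] at h1
    have h2 := h.degree_le (idx.symm ⟨j, hi⟩)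
    have := ih (by omega)
    rw [Nat.add_mul]
    omega

theorem Lists.slot_injective (h : Lists G idx D M) {v w v' w' : V} {q : ℕ} (hq : IsSlot idx M v w q)
    (hq' : IsSlot idx M v' w' q) : v = v' ∧ w = w' := by
  refine ⟨?_, coe_idx_inj.1 (hq.2.2.symm.trans hq'.2.2)⟩
  obtain ⟨h1, h2, -⟩ := hq
  obtain ⟨h1', h2', -⟩ := hq'
  rcases lt_trichotomy (idx v : ℕ) (idx v') with hlt | heq | hlt
  · have := h.off_mono (i := idx v + 1) (j := idx v') (by omega) (idx v').2.le
    omega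
  · exact coe_idx_inj.1 heq
  · have := h.off_mono (i := idx v' + 1) (j := idx v) (by omega) (idx v).2.le
    omega

theorem Lists.slot_lt (h : Lists G idx D M) {v w : V} {q : ℕ} (hq : IsSlot idx M v w q) :
    q < M .off (Fintype.card V) :=
  hq.2.1.trans_le (h.off_mono (idx v).2 le_rfl)

/-- The name of an edge: its slot at the smaller end. -/
noncomputable def edgeId (idx : V ≃ Fin (Fintype.card V)) (M : Arr → ℕ → ℕ) : Sym2 V → ℕ :=
  Sym2.lift ⟨fun v w => if idx v < idx w then sInf {q | IsSlot idx M v w q}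
    else sInf {q | IsSlot idx M w v q}, fun v w => by
      dsimp only
      rcases lt_trichotomy (idx v) (idx w) with h | h | h
      · rw [if_pos h, if_neg h.not_gt]
      · rw [idx.injective h]
      · rw [if_neg h.not_gt, if_pos h]⟩

theorem Lists.edgeId_eq (h : Lists G idx D M) {v w : V} {q : ℕ} (hq : IsSlot idx M v w q)
    (hvw : (idx v : ℕ) < idx w) : edgeId idx M s(v, w) = q := by
  have h1 : edgeId idx M s(v, w) = sInf {q | IsSlot idx M v w q} := if_pos hvw
  rw [h1]
  exact h.slot_unique (Nat.sInf_mem (s := {q | IsSlot idx M v w q}) ⟨q, hq⟩) hq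

theorem Lists.exists_isSlot_edgeId (h : Lists G idx D M) {e : Sym2 V} (he : e ∈ G.edgeSet) :
    ∃ v w, e = s(v, w) ∧ IsSlot idx M v w (edgeId idx M e) := by
  induction e with
  | _ v w =>
    rw [SimpleGraph.mem_edgeSet] at he
    rcases lt_trichotomy (idx v : ℕ) (idx w) with hlt | heq | hlt
    · obtain ⟨q, hq⟩ := h.exists_slot he
      exact ⟨v, w, rfl, by rwa [h.edgeId_eq hq hlt]⟩
    · exact absurd (coe_idx_inj.1 heq) he.ne
    · obtain ⟨q, hq⟩ := h.exists_slot he.symm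
      exact ⟨w, v, Sym2.eq_swap, by rwa [Sym2.eq_swap, h.edgeId_eq hq hlt]⟩

/-- The arrays `M` hold adjacency lists of `G`, whose edges have the names `id`. -/
structure Named (G : SimpleGraph V) [DecidableRel G.Adj] (idx : V ≃ Fin (Fintype.card V)) (D : ℕ)
    (id : Sym2 V → ℕ) (M : Arr → ℕ → ℕ) : Prop extends Lists G idx D M where
  eid_eq : ∀ {v w q}, IsSlot idx M v w q → M .eid q = id s(v, w)
  id_inj : ∀ {e f}, e ∈ G.edgeSet → f ∈ G.edgeSet → id e = id f → e = f
  id_lt : ∀ {e}, e ∈ G.edgeSet → id e < M .off (Fintype.card V)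

theorem Named.congr {id : Sym2 V → ℕ} {M' : Arr → ℕ → ℕ} (h : Named G idx D id M)
    (ho : M' .off = M .off) (ht : M' .tgt = M .tgt) (he : M' .eid = M .eid) :
    Named G idx D id M' :=
  ⟨h.toLists.congr ho ht, fun hq => by rw [he]; exact h.eid_eq (hq.congr ho.symm ht.symm),
    h.id_inj, by rw [ho]; exact h.id_lt⟩

theorem Named.frame {id : Sym2 V → ℕ} {c : Cmd} {s s' : Store} (h : Named G idx D id s.arr)
    (hf : Frame c s s') (ho : c.writesArr .off = false := by rfl)
    (ht : c.writesArr .tgt = false := by rfl) (he : c.writesArr .eid = false := by rfl) :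
    Named G idx D id s'.arr :=
  h.congr (hf.arr .off ho) (hf.arr .tgt ht) (hf.arr .eid he)

/-- Each cell of `eid` is assigned the name of its edge once, so that cells filled before keep their
values. -/
theorem wp_nameEdges {s : Store} (hL : Lists G idx D s.arr) (hn : s.reg .n = Fintype.card V) :
    nameEdges.wp s fun s' k =>
      Named G idx D (edgeId idx s.arr) s'.arr ∧ k ≤ 200 * (Fintype.card V * D ^ 2) + 3 := by
  have hD := hL.one_le
  have hD2 : D ≤ D ^ 2 := by nlinarith
  -- the slot `q` of the edge `vw` holds the right name
  let A : V → V → Store → Prop := fun v w s₁ =>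
    ∀ q, IsSlot idx s.arr v w q → s₁.arr .eid q = edgeId idx s.arr s(v, w)
  let Step : Store → Store → Prop := fun s₁ s₂ => ∀ v w, A v w s₁ → A v w s₂
  have hrefl : ∀ s, Step s s := fun s v w h => h
  have htrans : ∀ {s₁ s₂ s₃}, Step s₁ s₂ → Step s₂ s₃ → Step s₁ s₃ :=
    fun h1 h2 v w h => h2 v w (h1 v w h)
  have hput : ∀ {s₁ v w q a}, IsSlot idx s.arr v w q → edgeId idx s.arr s(v, w) = a →
      Step s₁ (s₁.setArr .eid q a) ∧ A v w (s₁.setArr .eid q a) := by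
    intro s₁ v w q a hq ha
    refine ⟨fun v' w' h q' hq' => ?_, fun q' hq' => ?_⟩
    · simp only [Store.setArr_arr, if_true, Function.update_apply]
      split_ifs with hqq
      · subst hqq
        obtain ⟨rfl, rfl⟩ := hL.slot_injective hq hq'
        exact ha.symm
      · exact h q' hq'
    · obtain rfl := hL.slot_unique hq hq'
      simp [ha]
  refine wp_mono (wp_loop (fun i s₁ k => (∀ v, (idx v : ℕ) < i → ∀ w, A v w s₁) ∧
    k ≤ i * ((16 + 16 * D + 8) * D + 1)) (by simp) ?_) ?_
  · rintro i s₁ k hi hf ⟨h1, hk⟩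
    have hL₁ : Lists G idx D s₁.arr := hL.congr (hf.arr .off) (hf.arr .tgt)
    simp only [Exp.val_reg, hn, Exp.val_zero, Nat.sub_zero] at hi
    obtain ⟨v, hv⟩ : ∃ v, (idx v : ℕ) = i := ⟨idx.symm ⟨i, hi⟩, by simp⟩
    refine wp_mono (wp_forSlots_forall (v := v) (fun _ => True) Step (fun w => A v w) (fun _ => 0)
      (16 + 16 * D) hL₁ (by simp [hv]) trivial hrefl htrans (fun h => h _ _) ?_) ?_
    · rintro s₂ w q hf₂ hL₂ - - hvw hq
      have hq₀ : IsSlot idx s.arr v w q := (hq.congr (hf₂.arr .off).symm (hf₂.arr .tgt).symm).congr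
        (hf.arr .off).symm (hf.arr .tgt).symm
      have hv₂ : s₂.reg .v = idx v := by rw [hf₂.reg .v]; simp [hv]
      rw [wp_seq, wp_set, wp_ite]
      simp only [Test.val_lt, Exp.val_reg, Exp.val_get, Store.setReg_reg, Store.setReg_arr, hq.2.2,
        if_true, reduceCtorEq, if_false, hv₂]
      refine ⟨fun hlt => ?_, fun hlt => ?_⟩
      · rw [wp_put]
        have := hput (s₁ := (s₂.setReg .p q).setReg .w (idx w)) hq₀ (hL.edgeId_eq hq₀ hlt)
        simp only [Exp.val_reg, Store.setReg_reg, if_true, reduceCtorEq, if_false]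
        refine ⟨trivial, this.1, this.2, ?_⟩
        simp
        try omega
      · refine wp_mono (wp_forSlots_forall (v := w) (fun _ => True) Step (fun y s' => y = v → A v w
          s')
          (fun _ => 0) 8 (s := (s₂.setReg .p q).setReg .w (idx w)) hL₂ (by simp) trivial hrefl
            htrans
          (fun h h' hy => h _ _ (h' hy)) ?_) ?_
        · rintro s₃ y q' hf₃ hL₃ - - hwy hq'
          have hv₃ : s₃.reg .v = idx v := by rw [hf₃.reg .v]; simp [hv₂]
          have hp₃ : s₃.reg .p = q := by rw [hf₃.reg .p]; simp
          have hq'₀ : IsSlot idx s.arr w y q' :=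
            ((hq'.congr (hf₃.arr .off).symm (hf₃.arr .tgt).symm).congr (M' := s₁.arr)
              (hf₂.arr .off).symm (hf₂.arr .tgt).symm).congr (hf.arr .off).symm (hf.arr .tgt).symm
          rw [wp_ifThen, wp_put]
          simp only [Test.val_eq, Exp.val_reg, Exp.val_get, Store.setReg_reg, Store.setReg_arr,
            hq'.2.2, if_true, reduceCtorEq, if_false, hv₃, hp₃, coe_idx_inj]
          refine ⟨?_, fun h => ⟨trivial, hrefl _, fun h' => absurd h' h, by simp⟩⟩
          rintro rfl
          have hwv : (idx w : ℕ) < idx y :=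
            lt_of_le_of_ne (not_lt.1 hlt) fun h => hvw.ne (coe_idx_inj.1 h).symm
          have := hput (s₁ := s₃.setReg .q q') (a := q') hq₀
            (by rw [Sym2.eq_swap]; exact hL.edgeId_eq hq'₀ hwv)
          exact ⟨trivial, this.1, fun _ => this.2, by simp⟩
        · rintro s' k' - ⟨-, h2, h3, h4⟩
          refine ⟨trivial, h2, h3 v hvw.symm rfl, ?_⟩
          simp
          omega
    · rintro s' k' - ⟨-, h2, h3, h4⟩
      refine ⟨fun v' hv' w => ?_, ?_⟩
      · rcases Nat.lt_succ_iff_lt_or_eq.1 hv' with h | h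
        · exact h2 v' w (h1 v' h w)
        · obtain rfl : v' = v := coe_idx_inj.1 (h.trans hv.symm)
          by_cases hvw : G.Adj v' w
          · exact h3 w hvw
          · exact fun q hq => absurd (hL.adj_of_isSlot hq) hvw
      · rw [Nat.add_mul i 1]
        omega
  · rintro s' k hf ⟨k', rfl, h1, h2⟩
    simp only [Exp.val_reg, hn, Exp.val_zero, Nat.sub_zero] at h1 h2
    have ho := hf.arr .off
    have ht := hf.arr .tgt
    refine ⟨⟨hL.congr ho ht, fun {v w q} hq => h1 v (idx v).2 w q (hq.congr ho.symm ht.symm), ?_,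
      ?_⟩,
      ?_⟩
    · intro e f he hf h
      obtain ⟨v, w, rfl, hq⟩ := hL.exists_isSlot_edgeId he
      obtain ⟨v', w', rfl, hq'⟩ := hL.exists_isSlot_edgeId hf
      rw [h] at hq
      obtain ⟨rfl, rfl⟩ := hL.slot_injective hq hq'
      rfl
    · intro e he
      obtain ⟨v, w, -, hq⟩ := hL.exists_isSlot_edgeId he
      rw [ho]
      exact hL.slot_lt hq
    · simp only [Exp.cost_reg, Exp.cost_zero]
      have : ((16 + 16 * D + 8) * D + 1) ≤ 200 * D ^ 2 := by nlinarith
      have := Nat.mul_le_mul_left (Fintype.card V) this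
      rw [mul_left_comm] at this
      omega

end Names

/-! ### The local classes at a vertex -/

section Local

variable {V : Type*} [Fintype V] [DecidableEq V] {G : SimpleGraph V} [DecidableRel G.Adj]
  {idx : V ≃ Fin (Fintype.card V)} {D : ℕ} {id : Sym2 V → ℕ} {R : Sym2 V → Sym2 V → Prop}

/-- The relation `R` is an equivalence relation that contains `δ(G)`. -/
structure ContainsDelta (G : SimpleGraph V) (R : Sym2 V → Sym2 V → Prop) : Prop where
  equiv : Equivalence R
  adjacent : ∀ {a b c}, G.Adj a b → G.Adj a c → b ≠ c → ¬ UniqueChordless G a b c →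
    R s(a, b) s(a, c)
  opposite : ∀ {a b x c}, ChordlessSquare G a b x c → R s(a, b) s(x, c)

/-- The edges that are incident with a neighbour of `v`. -/
def nearEdges (G : SimpleGraph V) [DecidableRel G.Adj] (v : V) : Finset (Sym2 V) :=
  (G.neighborFinset v).biUnion fun u => (G.neighborFinset u).image fun w => s(u, w)

theorem mem_nearEdges {v u w : V} (hu : G.Adj v u) (hw : G.Adj u w) : s(u, w) ∈ nearEdges G v := by
  simp only [nearEdges, Finset.mem_biUnion, Finset.mem_image, SimpleGraph.mem_neighborFinset]
  exact ⟨u, hu, w, hw, rfl⟩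

theorem mem_nearEdges_self {v u : V} (hu : G.Adj v u) : s(v, u) ∈ nearEdges G v := by
  rw [Sym2.eq_swap]
  exact mem_nearEdges hu hu.symm

theorem exists_of_mem_nearEdges {v : V} {e : Sym2 V} (he : e ∈ nearEdges G v) :
    ∃ u w, G.Adj v u ∧ G.Adj u w ∧ e = s(u, w) := by
  simp only [nearEdges, Finset.mem_biUnion, Finset.mem_image, SimpleGraph.mem_neighborFinset] at he
  obtain ⟨u, hu, w, hw, rfl⟩ := he
  exact ⟨u, w, hu, hw, rfl⟩

theorem mem_edgeSet_of_mem_nearEdges {v : V} {e : Sym2 V} (he : e ∈ nearEdges G v) :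
    e ∈ G.edgeSet := by
  obtain ⟨u, w, -, hw, rfl⟩ := exists_of_mem_nearEdges he
  exact hw

theorem card_nearEdges_le (hD : ∀ v, G.degree v ≤ D) (v : V) : (nearEdges G v).card ≤ D ^ 2 := by
  rw [sq]
  refine (Finset.card_biUnion_le_card_mul _ _ D fun u _ => ?_).trans
    (Nat.mul_le_mul_right D (hD v))
  exact Finset.card_image_le.trans (hD u)

/-- The array `lc` divides the edges near `v` into classes named by edges near `v`, and edges
in the same class are related by `R`. -/
structure LocalClasses (G : SimpleGraph V) [DecidableRel G.Adj] (id : Sym2 V → ℕ)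
    (R : Sym2 V → Sym2 V → Prop) (v : V) (lc : ℕ → ℕ) : Prop where
  sound : ∀ g ∈ nearEdges G v, ∀ h ∈ nearEdges G v, lc (id g) = lc (id h) → R g h
  exists_name : ∀ g ∈ nearEdges G v, ∃ h ∈ nearEdges G v, lc (id g) = id h

/-- The classes near `v` in `lc` are contained in those in `lc'`. -/
def Coarser (G : SimpleGraph V) [DecidableRel G.Adj] (id : Sym2 V → ℕ) (v : V) (lc lc' : ℕ → ℕ) :
    Prop :=
  ∀ g ∈ nearEdges G v, ∀ h ∈ nearEdges G v, lc (id g) = lc (id h) → lc' (id g) = lc' (id h)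

theorem Coarser.refl (v : V) (lc : ℕ → ℕ) : Coarser G id v lc lc := fun _ _ _ _ h => h

theorem Coarser.trans {v : V} {lc₁ lc₂ lc₃ : ℕ → ℕ} (h : Coarser G id v lc₁ lc₂)
    (h' : Coarser G id v lc₂ lc₃) : Coarser G id v lc₁ lc₃ :=
  fun g hg f hf hgf => h' g hg f hf (h g hg f hf hgf)

/-- The potential for the amortized analysis of the merging of classes: `O(D²)` steps for each
class. -/
def potential (G : SimpleGraph V) [DecidableRel G.Adj] (D : ℕ) (id : Sym2 V → ℕ) (v : V)
    (lc : ℕ → ℕ) : ℕ :=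
  40 * D ^ 2 * ((nearEdges G v).image fun g => lc (id g)).card

theorem potential_le (hD : ∀ v, G.degree v ≤ D) (v : V) (lc : ℕ → ℕ) :
    potential G D id v lc ≤ 40 * D ^ 4 := by
  have h1 := Nat.mul_le_mul_left (40 * D ^ 2) ((Finset.card_image_le (s := nearEdges G v)
    (f := fun g => lc (id g))).trans (card_nearEdges_le hD v))
  calc potential G D id v lc ≤ _ := h1
    _ = 40 * D ^ 4 := by ring

/-- Merging the classes of two related edges takes a bounded number of steps if they are equal
already, and otherwise `O(D²)` steps, which the decrease of the potential pays for. -/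
theorem wp_mergeClasses {s : Store} {v : V} {e f : Sym2 V} (hN : Named G idx D id s.arr)
    (hv : s.reg .v = idx v) (hse : s.reg .e = id e) (hsf : s.reg .f = id f)
    (he : e ∈ nearEdges G v) (hf : f ∈ nearEdges G v)
    (hR : Equivalence R) (hI : LocalClasses G id R v (s.arr .lc)) (hef : R e f) :
    mergeClasses.wp s fun s' k => LocalClasses G id R v (s'.arr .lc) ∧
      Coarser G id v (s.arr .lc) (s'.arr .lc) ∧ s'.arr .lc (id e) = s'.arr .lc (id f) ∧
      k + potential G D id v (s'.arr .lc) ≤ 10 + potential G D id v (s.arr .lc) := by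
  have hD := hN.one_le
  rw [mergeClasses, wp_seq, wp_set, wp_seq, wp_set, wp_ifNot]
  simp only [Exp.val_get, Exp.val_reg, Store.setReg_reg, Store.setReg_arr, reduceCtorEq, if_true,
    if_false, hse, hsf, Test.val_eq]
  refine ⟨fun h => ⟨hI, Coarser.refl _ _, h, by simp⟩, fun hne => ?_⟩
  set lc := s.arr .lc with hlc
  set la := lc (id e) with hla
  set lb := lc (id f) with hlb
  refine wp_mono (wp_forSlots_forall (v := v)
    (fun s' => ∀ i, s'.arr .lc i = lc i ∨ (lc i = lb ∧ s'.arr .lc i = la))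
    (fun s₁ s₂ => ∀ i, s₁.arr .lc i ≠ lb → s₂.arr .lc i ≠ lb)
    (fun u s' => ∀ w, G.Adj u w → s'.arr .lc (id s(u, w)) ≠ lb) (fun _ => 0) (3 + 17 * D)
    (s := (s.setReg .la la).setReg .lb lb) hN.toLists (by simp [hv]) (fun i => Or.inl rfl)
    (fun _ _ h => h) (fun h h' i hi => h' i (h i hi)) (fun h h' w hw => h _ (h' w hw)) ?_) ?_
  · rintro s₁ u q hf₁ hL₁ hI₁ - hvu hq
    rw [wp_seq, wp_set]
    have hN₁ : Named G idx D id s₁.arr := Named.frame (s := (s.setReg .la la).setReg .lb lb) hN hf₁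
    simp only [Exp.val_get, Exp.val_reg, Store.setReg_reg, Store.setReg_arr, if_true, hq.2.2]
    refine wp_mono (wp_forSlots_forall (v := u)
      (fun s' => ∀ i, s'.arr .lc i = lc i ∨ (lc i = lb ∧ s'.arr .lc i = la))
      (fun s₁ s₂ => ∀ i, s₁.arr .lc i ≠ lb → s₂.arr .lc i ≠ lb)
      (fun w s' => s'.arr .lc (id s(u, w)) ≠ lb) (fun _ => 0) 9
      (s := (s₁.setReg .i q).setReg .y (idx u)) hL₁ (by simp) (by simpa using hI₁) (fun _ _ h => h)
      (fun h h' i hi => h' i (h i hi)) (fun h h' => h _ h') ?_) ?_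
    · rintro s₂ w q' hf₂ hL₂ hI₂ - huw hq'
      have hN₂ : Named G idx D id s₂.arr := Named.frame (s := (s₁.setReg .i q).setReg .y (idx u))
        hN₁
        hf₂
      have hla₂ : s₂.reg .la = la := by
        rw [hf₂.reg .la]; simp [hf₁.reg .la]
      have hlb₂ : s₂.reg .lb = lb := by
        rw [hf₂.reg .lb]; simp [hf₁.reg .lb]
      rw [wp_ifThen, wp_put]
      simp only [Exp.val_get, Exp.val_reg, Store.setReg_reg, Store.setReg_arr, if_true, Test.val_eq,
        reduceCtorEq, if_false, hla₂, hlb₂, hN₂.eid_eq hq']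
      refine ⟨fun h => ?_, fun h => ⟨hI₂, fun _ h => h, h, by simp⟩⟩
      refine ⟨fun i => ?_, fun i hi => ?_, ?_, by simp⟩
      · simp only [Store.setArr_arr, if_true, Function.update_apply, Store.setReg_arr]
        split_ifs with hi
        · subst hi
          refine Or.inr ⟨?_, rfl⟩
          rcases hI₂ (id s(u, w)) with h1 | h1
          · rw [← h1, h]
          · exact h1.1
        · exact hI₂ i
      · simp only [Store.setArr_arr, if_true, Function.update_apply, Store.setReg_arr]
        split_ifs
        · exact hne
        · exact hi
      · simpa using hne
    · rintro s' k - ⟨h1, h2, h3, h4⟩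
      refine ⟨h1, h2, h3, ?_⟩
      simp
      omega
  · rintro s' k hf' ⟨h1, -, h3, h4⟩
    have hm : ∀ g ∈ nearEdges G v, s'.arr .lc (id g) = if lc (id g) = lb then la else lc (id g) :=
      by
      intro g hg
      obtain ⟨u, w, hu, hw, rfl⟩ := exists_of_mem_nearEdges hg
      have h5 := h3 u hu w hw
      rcases h1 (id s(u, w)) with h6 | ⟨h6, h7⟩
      · rw [if_neg (h6 ▸ h5), h6]
      · rw [if_pos h6, h7]
    refine ⟨⟨fun g hg h hh hgh => ?_, fun g hg => ?_⟩, fun g hg h hh hgh => ?_, ?_, ?_⟩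
    · rw [hm g hg, hm h hh] at hgh
      split_ifs at hgh with c1 c2 c2
      · exact hI.sound g hg h hh (c1.trans c2.symm)
      · exact hR.trans (hI.sound g hg f hf c1) (hR.trans (hR.symm hef) (hI.sound e he h hh hgh))
      · exact hR.trans (hI.sound g hg e he hgh) (hR.trans hef (hI.sound f hf h hh c2.symm))
      · exact hI.sound g hg h hh hgh
    · rw [hm g hg]
      split_ifs
      · exact hI.exists_name e he
      · exact hI.exists_name g hg
    · rw [hm g hg, hm h hh, hgh]
    · rw [hm e he, hm f hf, if_neg hne, if_pos rfl]
    · -- the class `lb` has disappeared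
      have hsub : ((nearEdges G v).image fun g => s'.arr .lc (id g)) ⊆
          ((nearEdges G v).image fun g => lc (id g)).erase lb := by
        intro a ha
        obtain ⟨g, hg, rfl⟩ := Finset.mem_image.1 ha
        rw [hm g hg, Finset.mem_erase]
        split_ifs with c1
        · exact ⟨hne, Finset.mem_image.2 ⟨e, he, rfl⟩⟩
        · exact ⟨c1, Finset.mem_image.2 ⟨g, hg, rfl⟩⟩
      have hcard := Finset.card_le_card hsub
      have hmem : lb ∈ (nearEdges G v).image fun g => lc (id g) := Finset.mem_image.2 ⟨f, hf, rfl⟩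
      have hpos := Finset.card_pos.2 ⟨_, hmem⟩
      rw [Finset.card_erase_of_mem hmem] at hcard
      have h5 := Nat.mul_le_mul_left (40 * D ^ 2) (Nat.add_le_of_le_sub hpos hcard)
      have h6 : (3 + 17 * D + 8) * D ≤ 28 * D ^ 2 := by nlinarith
      have h7 : 1 ≤ D ^ 2 := Nat.one_le_pow _ _ hD
      rw [Nat.mul_add] at h5
      simp only [potential, Exp.cost_get, Exp.cost_reg, Test.cost_eq]
      omega

/-- From the memory `s` to the memory `s'`, the local classes near `v` have only been merged. -/
def LocalStep (G : SimpleGraph V) [DecidableRel G.Adj] (id : Sym2 V → ℕ) (v : V) (s s' : Store) :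
    Prop :=
  Coarser G id v (s.arr .lc) (s'.arr .lc)

/-- The rule for a command that is executed unless `P` holds, where `P` is the outcome of a
preceding `countSquares`. -/
theorem wp_unlessUniqueChordless {s : Store} {d : Cmd} {Q : Store → ℕ → Prop} {P : Prop}
    (hP : (s.reg .cnt = 1 ∧ s.reg .chord = 0) ↔ P) (h1 : P → Q s 7)
    (h2 : ¬ P → d.wp s fun s' k => ∀ k' ≤ k + 6, Q s' k') :
    (unlessUniqueChordless d).wp s Q := by
  rw [unlessUniqueChordless, wp_ite, wp_ifNot]
  simp only [Test.val_eq, Exp.val_reg, Exp.val_one, Exp.val_zero]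
  refine ⟨fun ha => ⟨fun hb => h1 (hP.1 ⟨ha, hb⟩), fun hb => ?_⟩, fun ha => ?_⟩
  · refine wp_mono (h2 fun h => hb (hP.2 h).2) fun s' k _ h => h _ ?_
    simp only [Test.cost_eq, Exp.cost_reg, Exp.cost_one, Exp.cost_zero]
    omega
  · refine wp_mono (h2 fun h => ha (hP.2 h).1) fun s' k _ h => h _ ?_
    simp only [Test.cost_eq, Exp.cost_reg, Exp.cost_one]
    omega

/-- The part of `localClasses` that merges, for given neighbours `u` and `w` of `v`, the class of
`vu` with the classes of the edges opposite to `vu` in the chordless squares spanned by `vu` and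
`vw`. -/
def mergeOpposite : Cmd :=
  forSlots .r .u (
    .x ::= Exp.get .tgt Reg.r ;;
    ifNot (.eq Reg.x Reg.v) (
      testAdj .x .v ;;
      ifThen (.eq Reg.fl 0) (
        forSlots .q .w (
          ifThen (.eq (Exp.get .tgt Reg.q) Reg.x) (
            .f ::= Exp.get .eid Reg.q ;; mergeClasses)))))

theorem wp_mergeOpposite {s : Store} {v u w : V} (hN : Named G idx D id s.arr)
    (hR : ContainsDelta G R) (hI : LocalClasses G id R v (s.arr .lc)) (hsv : s.reg .v = idx v)
    (hsu : s.reg .u = idx u) (hsw : s.reg .w = idx w) (hse : s.reg .e = id s(v, u))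
    (hvu : G.Adj v u) (hvw : G.Adj v w) (hne : u ≠ w) (huw : ¬ G.Adj u w) :
    mergeOpposite.wp s fun s' k => LocalClasses G id R v (s'.arr .lc) ∧ LocalStep G id v s s' ∧
      (∀ x, ChordlessSquare G v u x w → s'.arr .lc (id s(v, u)) = s'.arr .lc (id s(x, w))) ∧
      k + potential G D id v (s'.arr .lc) ≤ 68 * D ^ 2 + potential G D id v (s.arr .lc) := by
  have hD := hN.one_le
  refine wp_mono (wp_forSlots_forall (v := u) (fun s' => LocalClasses G id R v (s'.arr .lc))
    (LocalStep G id v) (fun x s' => ChordlessSquare G v u x w →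
      s'.arr .lc (id s(v, u)) = s'.arr .lc (id s(x, w)))
    (fun s' => potential G D id v (s'.arr .lc)) (60 * D) hN.toLists hsu hI (fun _ => Coarser.refl _
      _)
    Coarser.trans ?_ ?_) ?_
  · intro x s₁ s₂ h h' hx
    refine h _ (mem_nearEdges_self hvu) _ ?_ (h' hx)
    rw [Sym2.eq_swap]
    exact mem_nearEdges hvw hx.1.2.2.1.symm
  · rintro s₁ x q hf₁ hL₁ hI₁ - hux hq
    rw [wp_seq, wp_set, wp_ifNot]
    have hN₁ : Named G idx D id s₁.arr := hN.frame hf₁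
    have hv₁ : s₁.reg .v = idx v := by rw [hf₁.reg .v, hsv]
    simp only [Exp.val_get, Exp.val_reg, Store.setReg_reg, Store.setReg_arr, if_true, hq.2.2,
      Test.val_eq, reduceCtorEq, if_false, hv₁, coe_idx_inj]
    refine ⟨?_, fun hxv => ?_⟩
    · rintro rfl
      exact ⟨hI₁, Coarser.refl _ _, fun h => absurd rfl h.1.2.2.2.2.1, by simp; omega⟩
    rw [wp_seq]
    refine wp_mono (wp_testAdj (G := G) (idx := idx) (D := D) (u := x) (w := v) hL₁ (by simp)
      (by simp [hv₁]) (by simp) (by simp) (by simp)) ?_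
    rintro s₂ k₂ hf₂ ⟨hfl, hk₂⟩
    have hlc₂ : s₂.arr .lc = s₁.arr .lc := by rw [hf₂.arr .lc]; rfl
    have hN₂ : Named G idx D id s₂.arr := Named.frame (s := (s₁.setReg .r q).setReg .x (idx x)) hN₁
      hf₂
    have hx₂ : s₂.reg .x = idx x := by rw [hf₂.reg .x]; simp
    have hw₂ : s₂.reg .w = idx w := by rw [hf₂.reg .w]; simp [hf₁.reg .w, hsw]
    have hv₂ : s₂.reg .v = idx v := by rw [hf₂.reg .v]; simp [hv₁]
    have he₂ : s₂.reg .e = id s(v, u) := by rw [hf₂.reg .e]; simp [hf₁.reg .e, hse]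
    rw [wp_ifThen]
    simp only [Test.val_eq, Exp.val_reg, hfl, Exp.val_zero, ite_eq_right_iff, one_ne_zero,
      imp_false]
    refine ⟨fun hxv' => ?_, fun h => ?_⟩
    swap
    · refine ⟨hlc₂ ▸ hI₁, ?_, fun h' => absurd (not_not.1 h).symm h'.2.1, ?_⟩
      · rw [LocalStep, hlc₂]; exact Coarser.refl _ _
      · rw [hlc₂]; simp; omega
    refine wp_mono (wp_forSlots_forall (v := w) (fun s' => LocalClasses G id R v (s'.arr .lc))
      (LocalStep G id v) (fun y s' => y = x → G.Adj w x →
        s'.arr .lc (id s(v, u)) = s'.arr .lc (id s(x, w)))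
      (fun s' => potential G D id v (s'.arr .lc)) 20 hN₂.toLists hw₂ (hlc₂ ▸ hI₁)
      (fun _ => Coarser.refl _ _) Coarser.trans ?_ ?_) ?_
    · intro y s₁ s₂ h h' hyx hwx
      refine h _ (mem_nearEdges_self hvu) _ ?_ (h' hyx hwx)
      rw [Sym2.eq_swap]
      exact mem_nearEdges hvw hwx
    · rintro s₃ y q' hf₃ hL₃ hI₃ - hwy hq'
      have hN₃ : Named G idx D id s₃.arr := hN₂.frame hf₃
      rw [wp_ifThen, wp_seq, wp_set]
      simp only [Exp.val_get, Exp.val_reg, Store.setReg_reg, Store.setReg_arr, if_true, hq'.2.2,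
        Test.val_eq, reduceCtorEq, if_false, hf₃.reg .x, hx₂, coe_idx_inj, hN₃.eid_eq hq']
      refine ⟨?_, fun h => ⟨hI₃, Coarser.refl _ _, fun h' => absurd h' h, by simp⟩⟩
      rintro rfl
      have hsq : ChordlessSquare G v u y w :=
        ⟨⟨hvu, hux, hwy.symm, hvw.symm, Ne.symm hxv, hne⟩, fun h => hxv' h.symm, huw⟩
      have hRR : R s(v, u) s(w, y) := by
        rw [Sym2.eq_swap (a := w)]; exact hR.opposite hsq
      refine wp_mono (wp_mergeClasses (v := v) (e := s(v, u)) (f := s(w, y)) (R := R)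
        (s := (s₃.setReg .q q').setReg .f (id s(w, y))) hN₃
        (by simp [hf₃.reg .v, hv₂]) (by simp [hf₃.reg .e, he₂]) (by simp) (mem_nearEdges_self hvu)
        (mem_nearEdges hvw hwy) hR.equiv hI₃ hRR) ?_
      rintro s' k - ⟨h1, h2, h3, h4⟩
      refine ⟨h1, h2, fun _ _ => ?_, ?_⟩
      · rw [Sym2.eq_swap (a := y)]; exact h3
      · simp at h4 ⊢; omega
    · rintro s' k - ⟨h1, h2, h3, h4⟩
      refine ⟨h1, ?_, fun h => h3 x h.1.2.2.1.symm rfl h.1.2.2.1.symm, ?_⟩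
      · rw [LocalStep, hlc₂] at h2; exact h2
      · rw [hlc₂] at h4; simp; omega
  · rintro s' k - ⟨h1, h2, h3, h4⟩
    refine ⟨h1, h2, fun x hx => h3 x hx.1.2.1 hx, ?_⟩
    have : (60 * D + 8) * D ≤ 68 * D ^ 2 := by nlinarith
    omega

/-- The edges `vu` and `vw`, and the edges opposite to `vu` in the chordless squares spanned by
them, are in the class where `δ(G)` wants them to be. -/
def PairMerged (G : SimpleGraph V) (id : Sym2 V → ℕ) (v u w : V) (lc : ℕ → ℕ) : Prop :=
  (¬ UniqueChordless G v u w → lc (id s(v, u)) = lc (id s(v, w))) ∧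
    ∀ x, ChordlessSquare G v u x w → lc (id s(v, u)) = lc (id s(x, w))

theorem PairMerged.mono {v u w : V} {lc lc' : ℕ → ℕ} (h : Coarser G id v lc lc') (hu : G.Adj v u)
    (hw : G.Adj v w) (h' : PairMerged G id v u w lc) : PairMerged G id v u w lc' := by
  refine ⟨fun hp => h _ (mem_nearEdges_self hu) _ (mem_nearEdges_self hw) (h'.1 hp), fun x hx =>
    h _ (mem_nearEdges_self hu) _ ?_ (h'.2 x hx)⟩
  rw [Sym2.eq_swap]
  exact mem_nearEdges hw hx.1.2.2.1.symm

/-- The part of `localClasses` that treats a pair of edges `vu` and `vw`. -/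
def mergePair : Cmd :=
  .w ::= Exp.get .tgt Reg.s ;;
  ifNot (.eq Reg.u Reg.w) (
    countSquares .v .u .w ;;
    unlessUniqueChordless (.f ::= Exp.get .eid Reg.s ;; mergeClasses) ;;
    testAdj .u .w ;;
    ifThen (.eq Reg.fl 0) mergeOpposite)

theorem wp_mergePair {s : Store} {v u w : V} {q : ℕ} (hN : Named G idx D id s.arr)
    (hR : ContainsDelta G R) (hI : LocalClasses G id R v (s.arr .lc)) (hsv : s.reg .v = idx v)
    (hsu : s.reg .u = idx u) (hss : s.reg .s = q) (hse : s.reg .e = id s(v, u))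
    (hvu : G.Adj v u) (hvw : G.Adj v w) (hq : IsSlot idx s.arr v w q) :
    mergePair.wp s fun s' k => LocalClasses G id R v (s'.arr .lc) ∧ LocalStep G id v s s' ∧
      (u ≠ w → PairMerged G id v u w (s'.arr .lc)) ∧
      k + potential G D id v (s'.arr .lc) ≤ 200 * D ^ 2 + potential G D id v (s.arr .lc) := by
  have hD := hN.one_le
  have hD2 : D ≤ D ^ 2 := by nlinarith
  rw [mergePair, wp_seq, wp_set, wp_ifNot]
  simp only [Exp.val_get, Exp.val_reg, Store.setReg_reg, if_true, hss, hq.2.2,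
    Test.val_eq, reduceCtorEq, if_false, hsu, coe_idx_inj]
  refine ⟨?_, fun huw => ?_⟩
  · rintro rfl
    exact ⟨hI, Coarser.refl _ _, fun h => absurd rfl h, by simp; omega⟩
  rw [wp_seq]
  refine wp_mono (wp_countSquares (G := G) (idx := idx) (D := D) (va := v) (vb := u) (vc := w)
    (s := s.setReg .w (idx w)) hN.toLists (by simp [hsv]) (by simp [hsu]) (by simp) hvu hvw huw
    (by simp) (by simp) (by simp)) ?_
  rintro s₁ k₁ hf₁ ⟨huc, hk₁⟩
  have hlc₁ : s₁.arr .lc = s.arr .lc := by rw [hf₁.arr .lc]; rfl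
  have hN₁ : Named G idx D id s₁.arr := Named.frame (s := s.setReg .w (idx w)) hN hf₁
  have hs₁ : s₁.reg .s = q := by rw [hf₁.reg .s]; simp [hss]
  have hv₁ : s₁.reg .v = idx v := by rw [hf₁.reg .v]; simp [hsv]
  have hu₁ : s₁.reg .u = idx u := by rw [hf₁.reg .u]; simp [hsu]
  have hw₁ : s₁.reg .w = idx w := by rw [hf₁.reg .w]; simp
  have he₁ : s₁.reg .e = id s(v, u) := by rw [hf₁.reg .e]; simp [hse]
  have hq₁ : IsSlot idx s₁.arr v w q := hq.congr (hf₁.arr .off) (hf₁.arr .tgt)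
  have main : (unlessUniqueChordless (.f ::= Exp.get .eid Reg.s ;; mergeClasses)).wp s₁ fun s₂ k₂ =>
      LocalClasses G id R v (s₂.arr .lc) ∧ LocalStep G id v s s₂ ∧
      (¬ UniqueChordless G v u w → s₂.arr .lc (id s(v, u)) = s₂.arr .lc (id s(v, w))) ∧
      k₂ + potential G D id v (s₂.arr .lc) ≤ 19 + potential G D id v (s.arr .lc) := by
    refine wp_unlessUniqueChordless huc (fun h => ?_) (fun h => ?_)
    · rw [LocalStep, hlc₁]
      exact ⟨hI, Coarser.refl _ _, fun h' => absurd h h', by omega⟩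
    rw [wp_seq, wp_set]
    simp only [Exp.val_get, Exp.val_reg, hs₁, hN₁.eid_eq hq₁]
    refine wp_mono (wp_mergeClasses (v := v) (e := s(v, u)) (f := s(v, w)) (R := R)
      (s := s₁.setReg .f (id s(v, w))) hN₁ (by simp [hv₁]) (by simp [he₁]) (by simp)
      (mem_nearEdges_self hvu) (mem_nearEdges_self hvw) hR.equiv (by simpa [hlc₁] using hI)
      (hR.adjacent hvu hvw huw h)) ?_
    rintro s' k - ⟨h1, h2, h3, h4⟩ k' hk'
    simp only [Store.setReg_arr, hlc₁] at h2 h4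
    refine ⟨h1, h2, fun _ => h3, ?_⟩
    simp at hk'
    omega
  rw [wp_seq]
  refine wp_mono main ?_
  rintro s₂ k₂ hf₂ ⟨hI₂, hstep₂, hpair, hk₂⟩
  have hN₂ : Named G idx D id s₂.arr := hN₁.frame hf₂
  rw [wp_seq]
  refine wp_mono (wp_testAdj (G := G) (idx := idx) (D := D) (u := u) (w := w) hN₂.toLists
    (by rw [hf₂.reg .u, hu₁]) (by rw [hf₂.reg .w, hw₁]) (by simp) (by simp) (by simp)) ?_
  rintro s₃ k₃ hf₃ ⟨hfl, hk₃⟩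
  have hN₃ : Named G idx D id s₃.arr := hN₂.frame hf₃
  have hlc₃ : s₃.arr .lc = s₂.arr .lc := hf₃.arr .lc
  rw [wp_ifThen]
  simp only [Test.val_eq, Exp.val_reg, hfl, Exp.val_zero, ite_eq_right_iff, one_ne_zero, imp_false]
  refine ⟨fun hn => ?_, fun h => ?_⟩
  · refine wp_mono (wp_mergeOpposite hN₃ hR (v := v) (u := u) (w := w) (hlc₃ ▸ hI₂)
      (by rw [hf₃.reg .v, hf₂.reg .v, hv₁]) (by rw [hf₃.reg .u, hf₂.reg .u, hu₁])
      (by rw [hf₃.reg .w, hf₂.reg .w, hw₁]) (by rw [hf₃.reg .e, hf₂.reg .e, he₁]) hvu hvw huw hn) ?_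
    rintro s' k - ⟨h1, h2, h3, h4⟩
    rw [LocalStep, hlc₃] at h2
    rw [hlc₃] at h4
    refine ⟨h1, hstep₂.trans h2, fun _ => ⟨fun h => h2 _ (mem_nearEdges_self hvu) _
      (mem_nearEdges_self hvw) (hpair h), h3⟩, ?_⟩
    simp
    omega
  · refine ⟨hlc₃ ▸ hI₂, ?_, fun _ => ⟨by rwa [hlc₃], fun x hx => absurd hx.2.2 h⟩, ?_⟩
    · rw [LocalStep, hlc₃]; exact hstep₂
    · rw [hlc₃]; simp; omega

/-- The first part of `localClasses`. -/
def initClasses : Cmd :=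
  forSlots .p .v (
    .u ::= Exp.get .tgt Reg.p ;;
    forSlots .q .u (
      put .lc (Exp.get .eid Reg.q) (Exp.get .eid Reg.q) ;;
      put .num (Exp.get .eid Reg.q) 0))

theorem wp_initClasses {s : Store} {v : V} (hN : Named G idx D id s.arr) (hsv : s.reg .v = idx v) :
    initClasses.wp s fun s' k =>
      (∀ e ∈ nearEdges G v, s'.arr .lc (id e) = id e ∧ s'.arr .num (id e) = 0) ∧ k ≤ 40 * D ^ 2 :=
        by
  have hD := hN.one_le
  let P : Sym2 V → Store → Prop := fun e s' => s'.arr .lc (id e) = id e ∧ s'.arr .num (id e) = 0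
  refine wp_mono (wp_forSlots_forall (v := v) (fun _ => True)
    (fun s₁ s₂ => ∀ e, P e s₁ → P e s₂) (fun u s' => ∀ w, G.Adj u w → P s(u, w) s') (fun _ => 0)
    (3 + 18 * D) hN.toLists hsv trivial (fun _ _ h => h) (fun h h' e he => h' e (h e he))
    (fun h h' w hw => h _ (h' w hw)) ?_) ?_
  · rintro s₁ u q hf₁ hL₁ - - hvu hq
    rw [wp_seq, wp_set]
    have hN₁ : Named G idx D id s₁.arr := hN.frame hf₁
    simp only [Exp.val_get, Exp.val_reg, Store.setReg_reg, Store.setReg_arr, if_true, hq.2.2]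
    refine wp_mono (wp_forSlots_forall (v := u) (fun _ => True)
      (fun s₁ s₂ => ∀ e, P e s₁ → P e s₂) (fun w s' => P s(u, w) s') (fun _ => 0) 10
      (s := (s₁.setReg .p q).setReg .u (idx u)) hL₁ (by simp) trivial (fun _ _ h => h)
      (fun h h' e he => h' e (h e he)) (fun h h' => h _ h') ?_) ?_
    · rintro s₂ w q' hf₂ hL₂ - - huw hq'
      have hN₂ : Named G idx D id s₂.arr := Named.frame (s := (s₁.setReg .p q).setReg .u (idx u))
        hN₁
        hf₂
      rw [wp_seq, wp_put, wp_put]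
      simp only [Exp.val_get, Exp.val_reg, Store.setReg_reg, Store.setReg_arr, if_true,
        reduceCtorEq, if_false, hN₂.eid_eq hq', Store.setArr_reg, Store.setArr_arr, Exp.val_zero]
      refine ⟨trivial, fun e he => ?_, ?_, by simp⟩
      · simp only [P, Store.setArr_arr, if_true, reduceCtorEq, if_false, Function.update_apply,
          Store.setReg_arr]
        exact ⟨by split_ifs with h; exacts [h.symm, he.1], by split_ifs; exacts [rfl, he.2]⟩
      · simp [P]
    · rintro s' k - ⟨-, h2, h3, h4⟩
      refine ⟨trivial, h2, h3, ?_⟩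
      simp
      omega
  · rintro s' k - ⟨-, -, h3, h4⟩
    refine ⟨fun e he => ?_, ?_⟩
    · obtain ⟨u, w, hu, hw, rfl⟩ := exists_of_mem_nearEdges he
      exact h3 u hu w hw
    · nlinarith

/-- The second part of `localClasses`. -/
def mergePairs : Cmd :=
  forSlots .p .v (
    .u ::= Exp.get .tgt Reg.p ;;
    .e ::= Exp.get .eid Reg.p ;;
    forSlots .s .v mergePair)

theorem wp_mergePairs {s : Store} {v : V} (hN : Named G idx D id s.arr)
    (hR : ContainsDelta G R) (hI : LocalClasses G id R v (s.arr .lc)) (hsv : s.reg .v = idx v) :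
    mergePairs.wp s fun s' k => LocalClasses G id R v (s'.arr .lc) ∧
      (∀ u, G.Adj v u → ∀ w, G.Adj v w → u ≠ w → PairMerged G id v u w (s'.arr .lc)) ∧
      k + potential G D id v (s'.arr .lc) ≤ 230 * D ^ 4 + potential G D id v (s.arr .lc) := by
  have hD := hN.one_le
  refine wp_mono (wp_forSlots_forall (v := v) (fun s' => LocalClasses G id R v (s'.arr .lc))
    (LocalStep G id v)
    (fun u s' => G.Adj v u → ∀ w, G.Adj v w → u ≠ w → PairMerged G id v u w (s'.arr .lc))
    (fun s' => potential G D id v (s'.arr .lc)) (6 + (200 * D ^ 2 + 8) * D) hN.toLists hsv hI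
    (fun _ => Coarser.refl _ _) Coarser.trans
    (fun h h' hu w hw huw => (h' hu w hw huw).mono h hu hw) ?_) ?_
  · rintro s₁ u q hf₁ hL₁ hI₁ - hvu hq
    have hN₁ : Named G idx D id s₁.arr := hN.frame hf₁
    rw [wp_seq, wp_set, wp_seq, wp_set]
    simp only [Exp.val_get, Exp.val_reg, Store.setReg_reg, Store.setReg_arr, if_true, hq.2.2,
      reduceCtorEq, if_false, hN₁.eid_eq hq]
    refine wp_mono (wp_forSlots_forall (v := v) (fun s' => LocalClasses G id R v (s'.arr .lc))
      (LocalStep G id v)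
      (fun w s' => G.Adj v w → u ≠ w → PairMerged G id v u w (s'.arr .lc))
      (fun s' => potential G D id v (s'.arr .lc)) (200 * D ^ 2)
      (s := ((s₁.setReg .p q).setReg .u (idx u)).setReg .e (id s(v, u))) hL₁
      (by simp [hf₁.reg .v, hsv]) hI₁
      (fun _ => Coarser.refl _ _) Coarser.trans (fun h h' hw huw => (h' hw huw).mono h hvu hw) ?_)
        ?_
    · rintro s₂ w q' hf₂ hL₂ hI₂ - hvw hq'
      have hN₂ : Named G idx D id s₂.arr := Named.frame
        (s := ((s₁.setReg .p q).setReg .u (idx u)).setReg .e (id s(v, u))) hN₁ hf₂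
      refine wp_mono (wp_mergePair (s := s₂.setReg .s q') (v := v) (u := u) (w := w) (q := q') (R
        := R)
        hN₂ hR hI₂ (by simp [hf₂.reg .v, hf₁.reg .v, hsv]) (by simp [hf₂.reg .u]) (by simp)
        (by simp [hf₂.reg .e]) hvu hvw hq') ?_
      rintro s' k - ⟨h1, h2, h3, h4⟩
      exact ⟨h1, h2, fun _ => h3, h4⟩
    · rintro s' k - ⟨h1, h2, h3, h4⟩
      refine ⟨h1, h2, fun _ w hw => h3 w hw hw, ?_⟩
      simp at h4 ⊢
      omega
  · rintro s' k - ⟨h1, h2, h3, h4⟩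
    refine ⟨h1, fun u hu => h3 u hu hu, ?_⟩
    have h5 : D ≤ D ^ 2 := by nlinarith
    have h6 : D ^ 2 ≤ D ^ 4 := Nat.pow_le_pow_right hD (by omega)
    have h7 : D ^ 3 ≤ D ^ 4 := Nat.pow_le_pow_right hD (by omega)
    have h9 : (6 + (200 * D ^ 2 + 8) * D + 8) * D = 200 * D ^ 4 + 8 * D ^ 2 + 14 * D := by ring
    omega

/-- The third part of `localClasses`. -/
def mergeAtNeighbours : Cmd :=
  forSlots .p .v (
    .u ::= Exp.get .tgt Reg.p ;;
    .e ::= Exp.get .eid Reg.p ;;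
    forSlots .q .u (
      .w ::= Exp.get .tgt Reg.q ;;
      ifNot (.eq Reg.w Reg.v) (
        countSquares .u .v .w ;;
        unlessUniqueChordless (.f ::= Exp.get .eid Reg.q ;; mergeClasses))))

theorem wp_mergeAtNeighbours {s : Store} {v : V} (hN : Named G idx D id s.arr)
    (hR : ContainsDelta G R) (hI : LocalClasses G id R v (s.arr .lc)) (hsv : s.reg .v = idx v) :
    mergeAtNeighbours.wp s fun s' k => LocalClasses G id R v (s'.arr .lc) ∧ LocalStep G id v s s' ∧
      k + potential G D id v (s'.arr .lc) ≤ 150 * D ^ 4 + potential G D id v (s.arr .lc) := by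
  have hD := hN.one_le
  have h5 : D ≤ D ^ 2 := by nlinarith
  refine wp_mono (wp_forSlots_forall (v := v) (fun s' => LocalClasses G id R v (s'.arr .lc))
    (LocalStep G id v) (fun _ _ => True)
    (fun s' => potential G D id v (s'.arr .lc)) (6 + (84 * D ^ 2 + 26 + 8) * D) hN.toLists hsv hI
    (fun _ => Coarser.refl _ _) Coarser.trans (fun _ _ => trivial) ?_) ?_
  · rintro s₁ u q hf₁ hL₁ hI₁ - hvu hq
    have hN₁ : Named G idx D id s₁.arr := hN.frame hf₁
    rw [wp_seq, wp_set, wp_seq, wp_set]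
    simp only [Exp.val_get, Exp.val_reg, Store.setReg_reg, Store.setReg_arr, if_true, hq.2.2,
      reduceCtorEq, if_false, hN₁.eid_eq hq]
    refine wp_mono (wp_forSlots_forall (v := u) (fun s' => LocalClasses G id R v (s'.arr .lc))
      (LocalStep G id v) (fun _ _ => True)
      (fun s' => potential G D id v (s'.arr .lc)) (84 * D ^ 2 + 26)
      (s := ((s₁.setReg .p q).setReg .u (idx u)).setReg .e (id s(v, u))) hL₁
      (by simp) hI₁ (fun _ => Coarser.refl _ _) Coarser.trans (fun _ _ => trivial) ?_) ?_
    · rintro s₂ w q' hf₂ hL₂ hI₂ - huw hq'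
      have hN₂ : Named G idx D id s₂.arr := Named.frame
        (s := ((s₁.setReg .p q).setReg .u (idx u)).setReg .e (id s(v, u))) hN₁ hf₂
      have hv₂ : s₂.reg .v = idx v := by rw [hf₂.reg .v]; simp [hf₁.reg .v, hsv]
      have hu₂ : s₂.reg .u = idx u := by rw [hf₂.reg .u]; simp
      have he₂ : s₂.reg .e = id s(v, u) := by rw [hf₂.reg .e]; simp
      rw [wp_seq, wp_set, wp_ifNot]
      simp only [Exp.val_get, Exp.val_reg, Store.setReg_reg, Store.setReg_arr, if_true, hq'.2.2,
        reduceCtorEq, if_false, Test.val_eq, hv₂, coe_idx_inj]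
      refine ⟨fun _ => ⟨hI₂, Coarser.refl _ _, trivial, by simp⟩, fun hwv => ?_⟩
      rw [wp_seq]
      refine wp_mono (wp_countSquares (G := G) (idx := idx) (D := D) (va := u) (vb := v) (vc := w)
        (s := (s₂.setReg .q q').setReg .w (idx w)) hL₂ (by simp [hu₂]) (by simp [hv₂]) (by simp)
        hvu.symm huw (Ne.symm hwv) (by simp) (by simp) (by simp)) ?_
      rintro s₃ k₃ hf₃ ⟨huc, hk₃⟩
      have hlc₃ : s₃.arr .lc = s₂.arr .lc := by rw [hf₃.arr .lc]; rfl
      have hN₃ : Named G idx D id s₃.arr :=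
        Named.frame (s := (s₂.setReg .q q').setReg .w (idx w)) hN₂ hf₃
      have hq₃ : IsSlot idx s₃.arr u w q' := IsSlot.congr hq' (hf₃.arr .off) (hf₃.arr .tgt)
      have hqq : s₃.reg .q = q' := by rw [hf₃.reg .q]; simp
      refine wp_unlessUniqueChordless huc (fun h => ?_) (fun h => ?_)
      · rw [LocalStep, hlc₃]
        exact ⟨hI₂, Coarser.refl _ _, trivial, by simp; omega⟩
      rw [wp_seq, wp_set]
      simp only [Exp.val_get, Exp.val_reg, hqq, hN₃.eid_eq hq₃]
      refine wp_mono (wp_mergeClasses (v := v) (e := s(v, u)) (f := s(u, w)) (R := R)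
        (s := s₃.setReg .f (id s(u, w))) hN₃ (by simp [hf₃.reg .v, hv₂]) (by simp [hf₃.reg .e, he₂])
        (by simp) (mem_nearEdges_self hvu) (mem_nearEdges hvu huw) hR.equiv
        (by simpa [hlc₃] using hI₂) ?_) ?_
      · rw [Sym2.eq_swap]
        exact hR.adjacent hvu.symm huw (Ne.symm hwv) h
      rintro s' k - ⟨h1, h2, h3, h4⟩ k' hk'
      simp only [Store.setReg_arr, hlc₃] at h2 h4
      refine ⟨h1, h2, trivial, ?_⟩
      simp at hk' ⊢
      omega
    · rintro s' k - ⟨h1, h2, -, h4⟩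
      refine ⟨h1, h2, trivial, ?_⟩
      simp at h4 ⊢
      omega
  · rintro s' k - ⟨h1, h2, -, h4⟩
    refine ⟨h1, h2, ?_⟩
    have h6 : D ^ 2 ≤ D ^ 4 := Nat.pow_le_pow_right hD (by omega)
    have h9 : (6 + (84 * D ^ 2 + 26 + 8) * D + 8) * D = 84 * D ^ 4 + 34 * D ^ 2 + 14 * D := by ring
    omega

theorem localClasses_eq : localClasses = initClasses ;; mergePairs ;; mergeAtNeighbours := rfl

theorem wp_localClasses {s : Store} {v : V} (hN : Named G idx D id s.arr)
    (hR : ContainsDelta G R) (hsv : s.reg .v = idx v) :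
    localClasses.wp s fun s' k => LocalClasses G id R v (s'.arr .lc) ∧
      (∀ e ∈ nearEdges G v, s'.arr .num (id e) = 0) ∧
      (∀ u, G.Adj v u → ∀ w, G.Adj v w → u ≠ w → PairMerged G id v u w (s'.arr .lc)) ∧
      k ≤ 460 * D ^ 4 := by
  have hD := hN.one_le
  rw [localClasses_eq, wp_seq]
  refine wp_mono (wp_initClasses hN hsv) ?_
  rintro s₁ k₁ hf₁ ⟨h1, hk₁⟩
  have hN₁ : Named G idx D id s₁.arr := hN.frame hf₁
  have hI₁ : LocalClasses G id R v (s₁.arr .lc) := by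
    refine ⟨fun g hg h hh hgh => ?_, fun g hg => ⟨g, hg, (h1 g hg).1⟩⟩
    rw [(h1 g hg).1, (h1 h hh).1] at hgh
    rw [hN.id_inj (mem_edgeSet_of_mem_nearEdges hg) (mem_edgeSet_of_mem_nearEdges hh) hgh]
    exact hR.equiv.refl h
  rw [wp_seq]
  refine wp_mono (wp_mergePairs hN₁ hR hI₁ (by rw [hf₁.reg .v, hsv])) ?_
  rintro s₂ k₂ hf₂ ⟨hI₂, h2, hk₂⟩
  refine wp_mono (wp_mergeAtNeighbours (hN₁.frame hf₂) hR hI₂ (by rw [hf₂.reg .v, hf₁.reg .v,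
    hsv])) ?_
  rintro s₃ k₃ hf₃ ⟨hI₃, h3, hk₃⟩
  refine ⟨hI₃, fun e he => ?_, fun u hu w hw huw => (h2 u hu w hw huw).mono h3 hu hw, ?_⟩
  · rw [hf₃.arr .num, hf₂.arr .num]
    exact (h1 e he).2
  · have := potential_le hN.degree_le v (s₁.arr .lc) (id := id)
    have h6 : D ^ 2 ≤ D ^ 4 := Nat.pow_le_pow_right hD (by omega)
    omega

end Local

/-! ### The colour graph -/

/-- The `k`-th entry of the list of neighbours of the colour `a`. -/
def colourPtr (s : Store) (a k : ℕ) : ℕ := (s.arr .nxt)^[k] (s.arr .head a)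

/-- The colour graph, as it is stored in linked lists, has an arc from `a` to `b`. -/
def Arc (s : Store) (a b : ℕ) : Prop :=
  1 ≤ a ∧ a ≤ s.reg .nc ∧ ∃ k < s.arr .gdeg a, s.arr .dst (colourPtr s a k) = b

/-- The colours `a` and `b` lie in the same component of the colour graph. -/
def Conn (s : Store) : ℕ → ℕ → Prop := Relation.EqvGen (Arc s)

/-- The lists of neighbours in the colour graph use only the entries `1, …, ne` that have been
allocated so far, and no more of them in total. -/
structure Chains (s : Store) : Prop where
  ptr_le : ∀ a, 1 ≤ a → a ≤ s.reg .nc → ∀ k < s.arr .gdeg a, colourPtr s a k ≤ s.reg .ne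
  sum_le : ∑ a ∈ Finset.Icc 1 (s.reg .nc), s.arr .gdeg a ≤ s.reg .ne

theorem iterate_update_of_lt {f : ℕ → ℕ} {m z h : ℕ} : ∀ {k : ℕ}, (∀ j < k, f^[j] h < m) →
    (Function.update f m z)^[k] h = f^[k] h
  | 0, _ => rfl
  | k + 1, hk => by
    rw [Function.iterate_succ_apply', Function.iterate_succ_apply',
      iterate_update_of_lt fun j hj => hk j (by omega), Function.update_of_ne (hk k (by omega)).ne]

/-- Putting a new entry at the head of the list of `x` adds an arc to the colour graph. -/
theorem Chains.add {s s' : Store} (h : Chains s) {x y : ℕ} (hx : 1 ≤ x) (hx' : x ≤ s.reg .nc)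
    (hnc : s'.reg .nc = s.reg .nc) (hne : s'.reg .ne = s.reg .ne + 1)
    (hdst : s'.arr .dst = Function.update (s.arr .dst) (s.reg .ne + 1) y)
    (hnxt : s'.arr .nxt = Function.update (s.arr .nxt) (s.reg .ne + 1) (s.arr .head x))
    (hhead : s'.arr .head = Function.update (s.arr .head) x (s.reg .ne + 1))
    (hgdeg : s'.arr .gdeg = Function.update (s.arr .gdeg) x (s.arr .gdeg x + 1)) :
    Chains s' ∧ ∀ a b, Arc s' a b ↔ Arc s a b ∨ (a = x ∧ b = y) := by
  have hlt : ∀ a, 1 ≤ a → a ≤ s.reg .nc → ∀ k < s.arr .gdeg a,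
      colourPtr s a k < s.reg .ne + 1 :=
    fun a h1 h2 k hk => Nat.lt_succ_of_le (h.ptr_le a h1 h2 k hk)
  have hptr : ∀ a, 1 ≤ a → a ≤ s.reg .nc → a ≠ x → ∀ k < s.arr .gdeg a,
      colourPtr s' a k = colourPtr s a k := by
    intro a h1 h2 hax k hk
    rw [colourPtr, colourPtr, hnxt, hhead, Function.update_of_ne hax]
    exact iterate_update_of_lt fun j hj => hlt a h1 h2 j (hj.trans hk)
  have hptr0 : colourPtr s' x 0 = s.reg .ne + 1 := by simp [colourPtr, hhead]
  have hptr1 : ∀ k < s.arr .gdeg x, colourPtr s' x (k + 1) = colourPtr s x k := by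
    intro k hk
    rw [colourPtr, colourPtr, hnxt, hhead, Function.iterate_succ_apply, Function.update_self,
      Function.update_self]
    exact iterate_update_of_lt fun j hj => hlt x hx hx' j (hj.trans hk)
  refine ⟨⟨fun a h1 h2 k hk => ?_, ?_⟩, fun a b => ?_⟩
  · rw [hnc] at h2
    rw [hne]
    by_cases hax : a = x
    · subst hax
      rw [hgdeg, Function.update_self] at hk
      cases k with
      | zero => rw [hptr0]
      | succ k =>
        rw [hptr1 k (by omega)]
        exact (hlt a h1 h2 k (by omega)).le
    · rw [hgdeg, Function.update_of_ne hax] at hk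
      rw [hptr a h1 h2 hax k hk]
      exact (hlt a h1 h2 k hk).le
  · rw [hnc, hne, hgdeg, Finset.sum_update_of_mem (Finset.mem_Icc.2 ⟨hx, hx'⟩)]
    have h1 := h.sum_le
    rw [← Finset.add_sum_erase _ _ (Finset.mem_Icc.2 ⟨hx, hx'⟩)] at h1
    rw [Finset.sdiff_singleton_eq_erase]
    omega
  · rw [Arc, Arc, hnc, hgdeg, hdst]
    by_cases hax : a = x
    · subst hax
      rw [Function.update_self]
      constructor
      · rintro ⟨h1, h2, k, hk, hb⟩
        cases k with
        | zero =>
          rw [hptr0, Function.update_self] at hb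
          exact Or.inr ⟨rfl, hb.symm⟩
        | succ k =>
          have hk' : k < s.arr .gdeg a := by omega
          rw [hptr1 k hk', Function.update_of_ne (hlt a h1 h2 k hk').ne] at hb
          exact Or.inl ⟨h1, h2, k, hk', hb⟩
      · rintro (⟨h1, h2, k, hk, hb⟩ | ⟨-, rfl⟩)
        · refine ⟨h1, h2, k + 1, by omega, ?_⟩
          rw [hptr1 k hk, Function.update_of_ne (hlt a h1 h2 k hk).ne, hb]
        · exact ⟨hx, hx', 0, by omega, by rw [hptr0, Function.update_self]⟩
    · rw [Function.update_of_ne hax]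
      simp only [hax, false_and, or_false]
      refine and_congr_right fun h1 => and_congr_right fun h2 => exists_congr fun k =>
        and_congr_right fun hk => ?_
      rw [hptr a h1 h2 hax k hk, Function.update_of_ne (hlt a h1 h2 k hk).ne]

theorem wp_addColourArc {s : Store} {a b : Reg} (h : Chains s) (ha : a ≠ .ne) (hb : b ≠ .ne)
    (h1 : 1 ≤ s.reg a) (h2 : s.reg a ≤ s.reg .nc) :
    (addColourArc a b).wp s fun s' k => Chains s' ∧
      (∀ i j, Arc s' i j ↔ Arc s i j ∨ (i = s.reg a ∧ j = s.reg b)) ∧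
      s'.reg .ne = s.reg .ne + 1 ∧ k ≤ 25 := by
  simp only [addColourArc, wp_seq, wp_set, wp_put]
  have := h.add (s' := (((((s.setReg .ne (s.reg .ne + 1)).setArr .dst (s.reg .ne + 1) (s.reg
    b)).setArr
    .nxt (s.reg .ne + 1) (s.arr .head (s.reg a))).setArr .head (s.reg a) (s.reg .ne + 1)).setArr
    .gdeg (s.reg a) (s.arr .gdeg (s.reg a) + 1))) (y := s.reg b) h1 h2 (by simp) (by simp) (by simp)
    (by simp) (by simp) (by simp)
  simp only [Exp.val_add, Exp.val_reg, Exp.val_one, Store.setArr_reg, Store.setReg_reg, if_true,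
    Exp.val_get, Store.setArr_arr, reduceCtorEq, if_false, ha, hb, Store.setReg_arr]
  exact ⟨this.1, this.2, trivial, by simp⟩

/-- The memories hold the same colour graph and the same colours of the edges. -/
structure SameColours (s s' : Store) : Prop where
  nc : s'.reg .nc = s.reg .nc
  ne : s'.reg .ne = s.reg .ne
  gc : s'.arr .gc = s.arr .gc
  head : s'.arr .head = s.arr .head
  gdeg : s'.arr .gdeg = s.arr .gdeg
  nxt : s'.arr .nxt = s.arr .nxt
  dst : s'.arr .dst = s.arr .dst
  comp : s'.arr .comp = s.arr .comp

theorem SameColours.of_frame {c : Cmd} {s s' : Store} (hf : Frame c s s')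
    (h1 : c.writesReg .nc = false := by rfl) (h2 : c.writesReg .ne = false := by rfl)
    (h3 : c.writesArr .gc = false := by rfl) (h4 : c.writesArr .head = false := by rfl)
    (h5 : c.writesArr .gdeg = false := by rfl) (h6 : c.writesArr .nxt = false := by rfl)
    (h7 : c.writesArr .dst = false := by rfl) (h8 : c.writesArr .comp = false := by rfl) :
    SameColours s s' :=
  ⟨hf.reg _ h1, hf.reg _ h2, hf.arr _ h3, hf.arr _ h4, hf.arr _ h5, hf.arr _ h6, hf.arr _ h7,
    hf.arr _ h8⟩

theorem SameColours.setReg (s : Store) {x : Reg} {a : ℕ} (h1 : x ≠ .nc) (h2 : x ≠ .ne) :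
    SameColours s (s.setReg x a) := by
  constructor <;> simp [h1.symm, h2.symm]

theorem SameColours.trans {s₁ s₂ s₃ : Store} (h : SameColours s₁ s₂) (h' : SameColours s₂ s₃) :
    SameColours s₁ s₃ :=
  ⟨h'.nc.trans h.nc, h'.ne.trans h.ne, h'.gc.trans h.gc, h'.head.trans h.head, h'.gdeg.trans h.gdeg,
    h'.nxt.trans h.nxt, h'.dst.trans h.dst, h'.comp.trans h.comp⟩

theorem SameColours.colourPtr_eq {s s' : Store} (h : SameColours s s') :
    colourPtr s' = colourPtr s := by
  funext a k
  rw [colourPtr, colourPtr, h.nxt, h.head]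

theorem SameColours.arc_eq {s s' : Store} (h : SameColours s s') : Arc s' = Arc s := by
  funext a b
  rw [Arc, Arc, h.nc, h.gdeg, h.dst, h.colourPtr_eq]

theorem SameColours.conn_eq {s s' : Store} (h : SameColours s s') : Conn s' = Conn s := by
  rw [Conn, Conn, h.arc_eq]

theorem SameColours.chains {s s' : Store} (h : SameColours s s') (hs : Chains s) : Chains s' := by
  obtain ⟨h1, h2⟩ := hs
  exact ⟨by rwa [h.nc, h.gdeg, h.colourPtr_eq, h.ne], by rwa [h.nc, h.gdeg, h.ne]⟩

theorem Conn.refl (s : Store) (a : ℕ) : Conn s a a := Relation.EqvGen.refl a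

theorem Conn.symm {s : Store} {a b : ℕ} (h : Conn s a b) : Conn s b a := Relation.EqvGen.symm _ _ h

theorem Conn.trans {s : Store} {a b c : ℕ} (h : Conn s a b) (h' : Conn s b c) : Conn s a c :=
  Relation.EqvGen.trans _ _ _ h h'

section Colour

variable {V : Type*} [Fintype V] [DecidableEq V] {G : SimpleGraph V} [DecidableRel G.Adj]
  {idx : V ≃ Fin (Fintype.card V)} {D : ℕ} {id : Sym2 V → ℕ} {R : Sym2 V → Sym2 V → Prop}
  {κ : ℕ → Sym2 V}

/-- The edges `e` and `f` are coloured, and their colours lie in the same component. -/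
def SameClass (id : Sym2 V → ℕ) (s : Store) (e f : Sym2 V) : Prop :=
  s.arr .gc (id e) ≠ 0 ∧ s.arr .gc (id f) ≠ 0 ∧ Conn s (s.arr .gc (id e)) (s.arr .gc (id f))

/-- The colour graph is symmetric, and each colour `a` can be labelled with an edge `κ a` in such
a way that an edge with colour `a` is related to `κ a` and the labels of adjacent colours are
related. -/
structure Colouring (G : SimpleGraph V) (id : Sym2 V → ℕ) (R : Sym2 V → Sym2 V → Prop)
    (κ : ℕ → Sym2 V) (s : Store) : Prop where
  chains : Chains s
  arc_le : ∀ {a b}, Arc s a b → 1 ≤ b ∧ b ≤ s.reg .nc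
  arc_symm : ∀ {a b}, Arc s a b → Arc s b a
  arc_sound : ∀ {a b}, Arc s a b → R (κ a) (κ b)
  gc_le : ∀ {e}, e ∈ G.edgeSet → s.arr .gc (id e) ≤ s.reg .nc
  gc_sound : ∀ {e}, e ∈ G.edgeSet → s.arr .gc (id e) ≠ 0 → R (κ (s.arr .gc (id e))) e
  comp_eq : ∀ a, 1 ≤ a → a ≤ s.reg .nc → s.arr .comp a = 0

theorem Colouring.congr {s s' : Store} (h : Colouring G id R κ s) (hs : SameColours s s') :
    Colouring G id R κ s' := by
  obtain ⟨h1, h2, h3, h4, h5, h6, h7⟩ := h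
  refine ⟨hs.chains h1, ?_, ?_, ?_, ?_, ?_, ?_⟩
  · rwa [hs.arc_eq, hs.nc]
  · rwa [hs.arc_eq]
  · rwa [hs.arc_eq]
  · rwa [hs.gc, hs.nc]
  · rwa [hs.gc]
  · rwa [hs.comp, hs.nc]

/-- The components of the colour graph grow, and the new colour of an edge lies in the component of
its old colour. -/
structure ColourStep (G : SimpleGraph V) (id : Sym2 V → ℕ) (s s' : Store) : Prop where
  conn : ∀ {a b}, Conn s a b → Conn s' a b
  gc_ne : ∀ {e}, e ∈ G.edgeSet → s.arr .gc (id e) ≠ 0 → s'.arr .gc (id e) ≠ 0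
  gc_conn : ∀ {e}, e ∈ G.edgeSet → s.arr .gc (id e) ≠ 0 →
    Conn s' (s.arr .gc (id e)) (s'.arr .gc (id e))

theorem ColourStep.of_same {s s' : Store} (h : SameColours s s') : ColourStep G id s s' :=
  ⟨fun hab => by rwa [h.conn_eq], fun _ h1 => by rwa [h.gc], fun _ _ => by
    rw [h.gc]; exact Conn.refl _ _⟩

theorem ColourStep.refl (s : Store) : ColourStep G id s s := ⟨fun h => h, fun _ h => h, fun _ _ =>
  Conn.refl _ _⟩

theorem ColourStep.trans {s₁ s₂ s₃ : Store} (h : ColourStep G id s₁ s₂)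
    (h' : ColourStep G id s₂ s₃) : ColourStep G id s₁ s₃ :=
  ⟨fun hab => h'.conn (h.conn hab), fun he h1 => h'.gc_ne he (h.gc_ne he h1), fun he h1 =>
    (h'.conn (h.gc_conn he h1)).trans (h'.gc_conn he (h.gc_ne he h1))⟩

theorem SameClass.mono {s s' : Store} {e f : Sym2 V} (he : e ∈ G.edgeSet) (hf : f ∈ G.edgeSet)
    (hs : ColourStep G id s s') (h : SameClass id s e f) : SameClass id s' e f :=
  ⟨hs.gc_ne he h.1, hs.gc_ne hf h.2.1, ((hs.gc_conn he h.1).symm.trans (hs.conn h.2.2)).trans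
    (hs.gc_conn hf h.2.1)⟩

/-- The component of the colour `a` contains the colour of an edge. -/
def Used (G : SimpleGraph V) (id : Sym2 V → ℕ) (s : Store) (a : ℕ) : Prop :=
  ∃ e ∈ G.edgeSet, s.arr .gc (id e) ≠ 0 ∧ Conn s (s.arr .gc (id e)) a

theorem Used.mono {s s' : Store} {a : ℕ} (hs : ColourStep G id s s') :
    Used G id s a → Used G id s' a := by
  rintro ⟨e, he, h1, h2⟩
  exact ⟨e, he, hs.gc_ne he h1, (hs.gc_conn he h1).symm.trans (hs.conn h2)⟩

/-- The edge `e` has a colour in the component of the colour `a`. -/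
def ColouredBy (id : Sym2 V → ℕ) (s : Store) (e : Sym2 V) (a : ℕ) : Prop :=
  s.arr .gc (id e) ≠ 0 ∧ Conn s (s.arr .gc (id e)) a

theorem ColouredBy.mono {s s' : Store} {e : Sym2 V} {a : ℕ} (he : e ∈ G.edgeSet)
    (hs : ColourStep G id s s') (h : ColouredBy id s e a) : ColouredBy id s' e a :=
  ⟨hs.gc_ne he h.1, (hs.gc_conn he h.1).symm.trans (hs.conn h.2)⟩

/-- When the edge `e` gets the colour `a` of its local class, its old colour and `a` are joined.
The bound on the number of steps covers the growth of the colour graph, too. -/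
theorem wp_colourEdge {s : Store} {p : Reg} {e : Sym2 V} {a : ℕ} (hR : Equivalence R)
    (hN : Named G idx D id s.arr)
    (hI : Colouring G id R κ s) (he : e ∈ G.edgeSet) (hp : s.arr .eid (s.reg p) = id e)
    (ha : s.arr .num (s.arr .lc (id e)) = a) (ha0 : a ≠ 0) (ha' : a ≤ s.reg .nc) (hκ : R (κ a) e) :
    (colourEdge p).wp s fun s' k => Colouring G id R κ s' ∧ ColourStep G id s s' ∧
      ColouredBy id s' e a ∧ k + (s'.reg .nc + s'.reg .ne) ≤ 75 + (s.reg .nc + s.reg .ne) := by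
  set o := s.arr .gc (id e) with ho
  set s₁ := ((s.setReg .f (id e)).setReg .new a).setReg .old o with hs₁
  have hsame : SameColours s s₁ :=
    ((SameColours.setReg s (by simp) (by simp)).trans (SameColours.setReg _ (by simp) (by
      simp))).trans
      (SameColours.setReg _ (by simp) (by simp))
  -- the effect of the program, without the invariants
  have raw : (colourEdge p).wp s fun s' k => Chains s' ∧
      (∀ i j, Arc s' i j ↔ Arc s i j ∨ (o ≠ 0 ∧ ((i = o ∧ j = a) ∨ (i = a ∧ j = o)))) ∧
      s'.arr .gc = Function.update (s.arr .gc) (id e) a ∧ s'.reg .ne ≤ s.reg .ne + 2 ∧ k ≤ 73 := by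
    simp only [colourEdge, wp_seq, wp_set, wp_put, wp_ifNot]
    simp only [Exp.val_get, Exp.val_reg, Store.setReg_reg, Store.setReg_arr, if_true, hp, ha,
      reduceCtorEq, if_false, ← ho, Test.val_eq, ← hs₁, Exp.val_zero]
    have hs₁n : s₁.reg .new = a := by simp [hs₁]
    have hs₁o : s₁.reg .old = o := by simp [hs₁]
    have hs₁f : s₁.reg .f = id e := by simp [hs₁]
    refine ⟨fun ho0 => ?_, fun ho0 => ?_⟩
    · set s₂ := s₁.setArr .gc (s₁.reg .f) (s₁.reg .new) with hs₂
      have hA : Arc s₂ = Arc s := by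
        rw [← hsame.arc_eq]
        funext i j
        simp [Arc, colourPtr, hs₂]
      have hC : Chains s₂ := by
        have := hsame.chains hI.chains
        exact ⟨by simpa [colourPtr, hs₂] using this.ptr_le, by simpa [hs₂] using this.sum_le⟩
      refine ⟨hC, fun i j => ?_, ?_, ?_, ?_⟩
      · rw [hs₁o] at ho0
        simp [hA, ho0]
      · simp [hs₂, hs₁n, hs₁f, hsame.gc]
      · simp [hs₂, hsame.ne]
      · simp
    · have ho' : o ≤ s.reg .nc := hI.gc_le he
      refine wp_mono (wp_addColourArc (s := s₁) (a := .old) (b := .new) (hsame.chains hI.chains)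
        (by simp) (by simp) (by rw [hs₁o]; omega) (by rw [hs₁o, hsame.nc]; exact ho')) ?_
      rintro s₂ k₂ hf₂ ⟨hC₂, hA₂, hne₂, hk₂⟩
      rw [hs₁n, hs₁o, hsame.arc_eq] at hA₂
      rw [hsame.ne] at hne₂
      have hs₂n : s₂.reg .new = a := by rw [hf₂.reg .new, hs₁n]
      have hs₂o : s₂.reg .old = o := by rw [hf₂.reg .old, hs₁o]
      have hs₂f : s₂.reg .f = id e := by rw [hf₂.reg .f, hs₁f]
      refine wp_mono (wp_addColourArc (s := s₂) (a := .new) (b := .old) hC₂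
        (by simp) (by simp) (by rw [hs₂n]; omega) (by
          rw [hs₂n, hf₂.reg .nc, hsame.nc]; exact ha')) ?_
      rintro s₃ k₃ hf₃ ⟨hC₃, hA₃, hne₃, hk₃⟩
      rw [hs₂n, hs₂o] at hA₃
      have hs₃n : s₃.reg .new = a := by rw [hf₃.reg .new, hs₂n]
      have hs₃f : s₃.reg .f = id e := by rw [hf₃.reg .f, hs₂f]
      have hgc : s₃.arr .gc = s.arr .gc := by rw [hf₃.arr .gc, hf₂.arr .gc, hsame.gc]
      set s₄ := s₃.setArr .gc (s₃.reg .f) (s₃.reg .new) with hs₄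
      have hA : Arc s₄ = Arc s₃ := by
        funext i j
        simp [Arc, colourPtr, hs₄]
      have hC : Chains s₄ :=
        ⟨by simpa [colourPtr, hs₄] using hC₃.ptr_le, by simpa [hs₄] using hC₃.sum_le⟩
      refine ⟨hC, fun i j => ?_, ?_, ?_, ?_⟩
      · rw [hA, hA₃, hA₂, or_assoc]
        rw [hs₁o] at ho0
        simp [ho0]
      · simp [hs₄, hs₃n, hs₃f, hgc]
      · simp [hs₄]; omega
      · simp; omega
  refine wp_mono raw ?_
  rintro s' k hf ⟨hC, hA, hgc, hne, hk⟩
  have hnc : s'.reg .nc = s.reg .nc := hf.reg .nc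
  have hconn : ∀ {i j}, Conn s i j → Conn s' i j := fun h =>
    Relation.EqvGen.mono (fun i j h => (hA i j).2 (Or.inl h)) _ _ h
  have hid : ∀ f ∈ G.edgeSet, s'.arr .gc (id f) = if f = e then a else s.arr .gc (id f) := by
    intro f hfe
    rw [hgc, Function.update_apply]
    by_cases h : f = e
    · simp [h]
    · rw [if_neg h, if_neg fun h' => h (hN.id_inj hfe he h')]
  have hge : s'.arr .gc (id e) = a := by rw [hid e he, if_pos rfl]
  refine ⟨⟨hC, ?_, ?_, ?_, ?_, ?_, ?_⟩, ⟨hconn, ?_, ?_⟩,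
    ⟨by rwa [hge], by rw [hge]; exact Conn.refl _ _⟩, by omega⟩
  · intro i j hij
    rw [hnc]
    rcases (hA i j).1 hij with h | ⟨ho0, ⟨rfl, rfl⟩ | ⟨rfl, rfl⟩⟩
    · exact hI.arc_le h
    · omega
    · exact ⟨Nat.one_le_iff_ne_zero.2 ho0, hI.gc_le he⟩
  · intro i j hij
    rw [hA] at hij ⊢
    rcases hij with h | ⟨ho0, h⟩
    · exact Or.inl (hI.arc_symm h)
    · exact Or.inr ⟨ho0, by tauto⟩
  · intro i j hij
    rcases (hA i j).1 hij with h | ⟨ho0, ⟨rfl, rfl⟩ | ⟨rfl, rfl⟩⟩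
    · exact hI.arc_sound h
    · exact hR.trans (hI.gc_sound he ho0) (hR.symm hκ)
    · exact hR.trans hκ (hR.symm (hI.gc_sound he ho0))
  · intro f hfe
    rw [hid f hfe, hnc]
    split_ifs
    · exact ha'
    · exact hI.gc_le hfe
  · intro f hfe
    rw [hid f hfe]
    split_ifs with h
    · rw [h]; exact fun _ => hκ
    · exact hI.gc_sound hfe
  · rw [hnc, hf.arr .comp]
    exact hI.comp_eq
  · intro f hfe h0
    rw [hid f hfe]
    split_ifs
    · exact ha0
    · exact h0
  · intro f hfe h0
    rw [hid f hfe]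
    split_ifs with h
    · subst h
      exact Relation.EqvGen.rel _ _ ((hA _ _).2 (Or.inr ⟨h0, Or.inl ⟨rfl, rfl⟩⟩))
    · exact Conn.refl _ _

end Colour

/-! ### Colouring a partial star product -/

section Star

variable {V : Type*} [Fintype V] [DecidableEq V] {G : SimpleGraph V} [DecidableRel G.Adj]
  {idx : V ≃ Fin (Fintype.card V)} {D : ℕ} {id : Sym2 V → ℕ} {R : Sym2 V → Sym2 V → Prop}
  {κ : ℕ → Sym2 V}

/-- A new colour is an isolated vertex of the colour graph, and can be labelled with any edge. -/
theorem Colouring.new_colour {s s' : Store} (h : Colouring G id R κ s) (e : Sym2 V)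
    (hnc : s'.reg .nc = s.reg .nc + 1) (hne : s'.reg .ne = s.reg .ne)
    (hgc : s'.arr .gc = s.arr .gc) (hnxt : s'.arr .nxt = s.arr .nxt) (hdst : s'.arr .dst = s.arr
      .dst)
    (hhead : s'.arr .head = Function.update (s.arr .head) (s.reg .nc + 1) 0)
    (hgdeg : s'.arr .gdeg = Function.update (s.arr .gdeg) (s.reg .nc + 1) 0)
    (hcomp : s'.arr .comp = Function.update (s.arr .comp) (s.reg .nc + 1) 0) :
    Colouring G id R (Function.update κ (s.reg .nc + 1) e) s' ∧ Arc s' = Arc s := by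
  have hptr : ∀ a k, a ≤ s.reg .nc → colourPtr s' a k = colourPtr s a k := by
    intro a k ha
    rw [colourPtr, colourPtr, hnxt, hhead, Function.update_of_ne (by omega)]
  have hA : Arc s' = Arc s := by
    funext a b
    rw [Arc, Arc, hnc, hgdeg, hdst, eq_iff_iff]
    rcases Nat.lt_or_ge (s.reg .nc) a with ha | ha
    · refine iff_of_false ?_ (by omega)
      rintro ⟨-, h2, k, hk, -⟩
      obtain rfl : a = s.reg .nc + 1 := by omega
      simp at hk
    · rw [Function.update_of_ne (by omega)]
      simp only [hptr a _ ha, ha, ha.trans (Nat.le_succ _), true_and]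
  refine ⟨⟨⟨fun a h1 h2 k hk => ?_, ?_⟩, fun hab => ?_, ?_, fun {a b} hab => ?_, fun he => ?_,
    fun {f} hf h0 => ?_, fun a h1 h2 => ?_⟩, hA⟩
  · rw [hgdeg] at hk
    rcases Nat.lt_or_ge (s.reg .nc) a with ha | ha
    · obtain rfl : a = s.reg .nc + 1 := by omega
      simp at hk
    · rw [Function.update_of_ne (by omega)] at hk
      rw [hptr a k ha, hne]
      exact h.chains.ptr_le a h1 ha k hk
  · rw [hnc, hne, hgdeg, Finset.sum_Icc_succ_top (by omega), Function.update_self, add_zero]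
    refine le_trans (le_of_eq (Finset.sum_congr rfl fun a ha => ?_)) h.chains.sum_le
    have := (Finset.mem_Icc.1 ha).2
    rw [Function.update_of_ne (by omega)]
  · rw [hA] at hab
    have := h.arc_le hab
    omega
  · rw [hA]
    exact h.arc_symm
  · rw [hA] at hab
    have h1 := hab.2.1
    have h2 := (h.arc_le hab).2
    rw [Function.update_of_ne (by omega), Function.update_of_ne (by omega)]
    exact h.arc_sound hab
  · have := h.gc_le he
    rw [hgc]
    omega
  · have h1 := h.gc_le hf
    rw [hgc] at h0 ⊢
    rw [Function.update_of_ne (by omega)]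
    exact h.gc_sound hf h0
  · rw [hcomp, Function.update_apply]
    split_ifs with ha
    · rfl
    · exact h.comp_eq a h1 (by omega)

/-- The state while the partial star product at `v` is coloured: `num` holds the colours of the
local classes. -/
structure StarColouring (G : SimpleGraph V) [DecidableRel G.Adj] (id : Sym2 V → ℕ)
    (R : Sym2 V → Sym2 V → Prop) (κ : ℕ → Sym2 V) (v : V) (lc : ℕ → ℕ) (s : Store) : Prop where
  colouring : Colouring G id R κ s
  num_le : ∀ g ∈ nearEdges G v, s.arr .num (lc (id g)) ≤ s.reg .nc
  num_sound : ∀ g ∈ nearEdges G v, s.arr .num (lc (id g)) ≠ 0 → R (κ (s.arr .num (lc (id g)))) g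
  used : ∀ a, 1 ≤ a → a ≤ s.reg .nc →
    Used G id s a ∨ ∃ u, G.Adj v u ∧ s.arr .num (lc (id s(v, u))) = a

/-- The first part of `colourStarProduct`. -/
def createColours : Cmd :=
  forSlots .p .v (
    .la ::= Exp.get .lc (Exp.get .eid Reg.p) ;;
    ifThen (.eq (Exp.get .num Reg.la) 0) (
      .nc ::= Reg.nc + 1 ;;
      put .num Reg.la Reg.nc ;;
      put .head Reg.nc 0 ;;
      put .gdeg Reg.nc 0 ;;
      put .comp Reg.nc 0))

theorem wp_createColours {s : Store} {v : V} (hN : Named G idx D id s.arr)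
    (hI : LocalClasses G id R v (s.arr .lc)) (hsv : s.reg .v = idx v)
    (hS : StarColouring G id R κ v (s.arr .lc) s) :
    createColours.wp s fun s' k => (∃ κ', StarColouring G id R κ' v (s'.arr .lc) s') ∧
      ColourStep G id s s' ∧ (∀ u, G.Adj v u → s'.arr .num (s'.arr .lc (id s(v, u))) ≠ 0) ∧
      k + (s'.reg .nc + s'.reg .ne) ≤ 40 * D + (s.reg .nc + s.reg .ne) := by
  set lc := s.arr .lc with hlc
  refine wp_mono (wp_forSlots_forall (v := v) (fun s' => ∃ κ', StarColouring G id R κ' v lc s')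
    (fun s₁ s₂ => ColourStep G id s₁ s₂ ∧ ∀ i, s₁.arr .num i ≠ 0 → s₂.arr .num i ≠ 0)
    (fun u s' => s'.arr .num (lc (id s(v, u))) ≠ 0)
    (fun s' => s'.reg .nc + s'.reg .ne) 30 hN.toLists hsv ⟨κ, hS⟩
    (fun s => ⟨ColourStep.refl s, fun _ h => h⟩)
    (fun h h' => ⟨h.1.trans h'.1, fun i hi => h'.2 i (h.2 i hi)⟩) (fun h h' => h.2 _ h') ?_) ?_
  · rintro s₁ u q hf₁ hL₁ ⟨κ₁, hS₁⟩ - hvu hq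
    have hN₁ : Named G idx D id s₁.arr := hN.frame hf₁
    have hlc₁ : s₁.arr .lc = lc := hf₁.arr .lc
    have hnear : s(v, u) ∈ nearEdges G v := mem_nearEdges_self hvu
    rw [wp_seq, wp_set, wp_ifThen]
    simp only [Exp.val_get, Exp.val_reg, Store.setReg_reg, Store.setReg_arr, if_true, hlc₁,
      hN₁.eid_eq hq, Test.val_eq, Exp.val_zero]
    set la := lc (id s(v, u)) with hla
    set s₂ := (s₁.setReg .p q).setReg .la la with hs₂
    have hsame : SameColours s₁ s₂ :=
      (SameColours.setReg s₁ (by simp) (by simp)).trans (SameColours.setReg _ (by simp) (by simp))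
    have hnum₂ : s₂.arr .num = s₁.arr .num := rfl
    refine ⟨fun h0 => ?_, fun h0 => ?_⟩
    · simp only [wp_seq, wp_set, wp_put]
      simp only [Exp.val_add, Exp.val_reg, Exp.val_one, Exp.val_zero, Store.setArr_reg,
        Store.setReg_reg, if_true, reduceCtorEq, if_false]
      have hs₂la : s₂.reg .la = la := by simp [hs₂]
      rw [hs₂la, hsame.nc]
      set s' := ((((s₂.setReg .nc (s₁.reg .nc + 1)).setArr .num la (s₁.reg .nc + 1)).setArr .head
        (s₁.reg .nc + 1) 0).setArr .gdeg (s₁.reg .nc + 1) 0).setArr .comp (s₁.reg .nc + 1) 0 with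
          hs'
      have hnc' : s'.reg .nc = s₁.reg .nc + 1 := by simp [hs']
      have hne' : s'.reg .ne = s₁.reg .ne := by simp [hs', hsame.ne]
      have hgc' : s'.arr .gc = s₁.arr .gc := by simp [hs', hsame.gc]
      have hnum' : s'.arr .num = Function.update (s₁.arr .num) la (s₁.reg .nc + 1) := by
        simp [hs', hnum₂]
      obtain ⟨hC, hA⟩ := hS₁.colouring.new_colour (s' := s') s(v, u) hnc' hne' hgc'
        (by simp [hs', hsame.nxt]) (by simp [hs', hsame.dst]) (by simp [hs', hsame.head])
        (by simp [hs', hsame.gdeg]) (by simp [hs', hsame.comp])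
      have hstep : ColourStep G id s₁ s' := by
        refine ⟨fun h => ?_, fun _ h => by rwa [hgc'], fun _ _ => ?_⟩
        · rwa [Conn, hA]
        · rw [hgc']; exact Conn.refl _ _
      refine ⟨⟨_, hC, fun g hg => ?_, fun g hg h => ?_, fun a h1 h2 => ?_⟩, ⟨hstep, fun i hi =>
        ?_⟩, ?_,
        ?_⟩
      · rw [hnum', hnc', Function.update_apply]
        split_ifs
        · exact le_rfl
        · exact (hS₁.num_le g hg).trans (Nat.le_succ _)
      · by_cases hgl : lc (id g) = la
        · rw [hnum', hgl, Function.update_self, Function.update_self]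
          exact hI.sound _ hnear _ hg hgl.symm
        · have := hS₁.num_le g hg
          rw [hnum', Function.update_of_ne hgl] at h ⊢
          rw [Function.update_of_ne (by omega)]
          exact hS₁.num_sound g hg h
      · rw [hnc'] at h2
        rcases Nat.lt_or_ge (s₁.reg .nc) a with ha | ha
        · exact Or.inr ⟨u, hvu, by rw [hnum', Function.update_self]; omega⟩
        · rcases hS₁.used a h1 ha with h | ⟨w, hw, h⟩
          · exact Or.inl (h.mono hstep)
          · refine Or.inr ⟨w, hw, ?_⟩
            rw [hnum', Function.update_of_ne, h]
            rintro hwl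
            rw [hwl, h0] at h
            omega
      · rw [hnum', Function.update_apply]
        split_ifs
        · omega
        · exact hi
      · rw [hnum', Function.update_self]
        omega
      · rw [hsame.ne]
        simp
        omega
    · refine ⟨⟨κ₁, hS₁.colouring.congr hsame, ?_, hS₁.num_sound, fun a h1 h2 => ?_⟩,
        ⟨ColourStep.of_same hsame, fun _ h => h⟩, h0, ?_⟩
      · rw [hsame.nc]; exact hS₁.num_le
      · rw [hsame.nc] at h2
        exact (hS₁.used a h1 h2).imp_left fun h => h.mono (ColourStep.of_same hsame)
      · simp
  · rintro s' k hf ⟨h1, ⟨h2, -⟩, h3, h4⟩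
    have hlc' : s'.arr .lc = lc := hf.arr .lc
    rw [hlc']
    exact ⟨h1, h2, h3, by omega⟩

/-- The second part of `colourStarProduct`. -/
def colourIncident : Cmd := forSlots .p .v (colourEdge .p)

theorem wp_colourIncident {s : Store} {v : V} (hN : Named G idx D id s.arr) (hR : Equivalence R)
    (hsv : s.reg .v = idx v) (hS : StarColouring G id R κ v (s.arr .lc) s)
    (hpos : ∀ u, G.Adj v u → s.arr .num (s.arr .lc (id s(v, u))) ≠ 0) :
    colourIncident.wp s fun s' k => Colouring G id R κ s' ∧ ColourStep G id s s' ∧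
      (∀ u, G.Adj v u → ColouredBy id s' s(v, u) (s.arr .num (s.arr .lc (id s(v, u))))) ∧
      k + (s'.reg .nc + s'.reg .ne) ≤ 83 * D + (s.reg .nc + s.reg .ne) := by
  refine wp_mono (wp_forSlots_forall (v := v) (Colouring G id R κ) (ColourStep G id)
    (fun u s' => G.Adj v u → ColouredBy id s' s(v, u) (s.arr .num (s.arr .lc (id s(v, u)))))
    (fun s' => s'.reg .nc + s'.reg .ne) 75 hN.toLists hsv hS.colouring ColourStep.refl
    ColourStep.trans (fun h h' hu => (h' hu).mono hu h) ?_) ?_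
  · rintro s₁ u q hf₁ hL₁ hI₁ - hvu hq
    have hN₁ : Named G idx D id s₁.arr := hN.frame hf₁
    have hsame : SameColours s₁ (s₁.setReg .p q) := SameColours.setReg s₁ (by simp) (by simp)
    have hnear : s(v, u) ∈ nearEdges G v := mem_nearEdges_self hvu
    refine wp_mono (wp_colourEdge (s := s₁.setReg .p q) (e := s(v, u)) hR hN₁ (hI₁.congr hsame)
      hvu ?_ ?_ (hpos u hvu) ?_ (hS.num_sound _ hnear (hpos u hvu))) ?_
    · simp [hN₁.eid_eq hq]
    · rw [Store.setReg_arr, hf₁.arr .num, hf₁.arr .lc]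
    · rw [hsame.nc, hf₁.reg .nc]
      exact hS.num_le _ hnear
    · rintro s' k - ⟨h1, h2, h3, h4⟩
      rw [hsame.nc, hsame.ne] at h4
      exact ⟨h1, (ColourStep.of_same hsame).trans h2, fun _ => h3, h4⟩
  · rintro s' k - ⟨h1, h2, h3, h4⟩
    exact ⟨h1, h2, fun u hu => h3 u hu hu, h4⟩

/-- The third part of `colourStarProduct`. -/
def colourOpposite : Cmd :=
  forSlots .p .v (
    .u ::= Exp.get .tgt Reg.p ;;
    forSlots .s .v (
      .w ::= Exp.get .tgt Reg.s ;;
      ifNot (.eq (Exp.get .lc (Exp.get .eid Reg.p)) (Exp.get .lc (Exp.get .eid Reg.s))) (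
        forSlots .r .u (
          .x ::= Exp.get .tgt Reg.r ;;
          ifNot (.eq Reg.x Reg.v) (
            testAdj .x .w ;;
            ifThen (.eq Reg.fl 1) (colourEdge .r))))))

theorem wp_colourOpposite {s : Store} {v : V} {num lc : ℕ → ℕ} {nc : ℕ}
    (hN : Named G idx D id s.arr) (hR : Equivalence R)
    (hsv : s.reg .v = idx v) (hI : Colouring G id R κ s) (hnum : s.arr .num = num)
    (hlc : s.arr .lc = lc) (hnc : s.reg .nc = nc)
    (hnum_le : ∀ g ∈ nearEdges G v, num (lc (id g)) ≤ nc)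
    (hsound : ∀ g ∈ nearEdges G v, num (lc (id g)) ≠ 0 → R (κ (num (lc (id g)))) g)
    (hpos : ∀ u, G.Adj v u → ∀ w, G.Adj v w → lc (id s(v, u)) ≠ lc (id s(v, w)) →
      ∀ x, G.Adj u x → x ≠ v → G.Adj x w → num (lc (id s(u, x))) ≠ 0) :
    colourOpposite.wp s fun s' k => Colouring G id R κ s' ∧ ColourStep G id s s' ∧
      (∀ u, G.Adj v u → ∀ w, G.Adj v w → lc (id s(v, u)) ≠ lc (id s(v, w)) →
        ∀ x, G.Adj u x → x ≠ v → G.Adj x w → ColouredBy id s' s(u, x) (num (lc (id s(u, x))))) ∧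
      k + (s'.reg .nc + s'.reg .ne) ≤ 150 * D ^ 4 + (s.reg .nc + s.reg .ne) := by
  have hD := hN.one_le
  have hD2 : D ≤ D ^ 2 := by nlinarith
  refine wp_mono (wp_forSlots_forall (v := v) (Colouring G id R κ) (ColourStep G id)
    (fun u s' => ∀ w, G.Adj v w → lc (id s(v, u)) ≠ lc (id s(v, w)) →
      ∀ x, G.Adj u x → x ≠ v → G.Adj x w → ColouredBy id s' s(u, x) (num (lc (id s(u, x)))))
    (fun s' => s'.reg .nc + s'.reg .ne) (3 + (130 * D ^ 2 + 8) * D) hN.toLists hsv hI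
      ColourStep.refl
    ColourStep.trans (fun h h' w hw hne x hux hxv hxw => (h' w hw hne x hux hxv hxw).mono hux h)
      ?_) ?_
  · rintro s₁ u q hf₁ hL₁ hI₁ - hvu hq
    have hN₁ : Named G idx D id s₁.arr := hN.frame hf₁
    rw [wp_seq, wp_set]
    simp only [Exp.val_get, Exp.val_reg, Store.setReg_reg, Store.setReg_arr, if_true, hq.2.2]
    set s₂ := (s₁.setReg .p q).setReg .u (idx u) with hs₂
    have hsame : SameColours s₁ s₂ :=
      (SameColours.setReg s₁ (by simp) (by simp)).trans (SameColours.setReg _ (by simp) (by simp))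
    refine wp_mono (wp_forSlots_forall (v := v) (Colouring G id R κ) (ColourStep G id)
      (fun w s' => lc (id s(v, u)) ≠ lc (id s(v, w)) →
        ∀ x, G.Adj u x → x ≠ v → G.Adj x w → ColouredBy id s' s(u, x) (num (lc (id s(u, x)))))
      (fun s' => s'.reg .nc + s'.reg .ne) (130 * D ^ 2) (s := s₂) hL₁ (by simp [hs₂, hf₁.reg .v,
        hsv])
      (hI₁.congr hsame) ColourStep.refl ColourStep.trans
      (fun h h' hne x hux hxv hxw => (h' hne x hux hxv hxw).mono hux h) ?_) ?_
    · rintro s₃ w q' hf₃ hL₃ hI₃ - hvw hq'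
      have hN₃ : Named G idx D id s₃.arr := Named.frame (s := s₂) hN₁ hf₃
      have hp₃ : s₃.reg .p = q := by rw [hf₃.reg .p]; simp [hs₂]
      have hq₃ : IsSlot idx s₃.arr v u q := IsSlot.congr hq (hf₃.arr .off) (hf₃.arr .tgt)
      have hlc₃ : s₃.arr .lc = lc := by rw [hf₃.arr .lc, ← hlc, ← hf₁.arr .lc]; rfl
      rw [wp_seq, wp_set, wp_ifNot]
      simp only [Exp.val_get, Exp.val_reg, Store.setReg_reg, Store.setReg_arr, if_true, hq'.2.2,
        reduceCtorEq, if_false, Test.val_eq, hp₃, hN₃.eid_eq hq₃, hN₃.eid_eq hq', hlc₃]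
      set s₄ := (s₃.setReg .s q').setReg .w (idx w) with hs₄
      have hsame₄ : SameColours s₃ s₄ :=
        (SameColours.setReg s₃ (by simp) (by simp)).trans (SameColours.setReg _ (by simp) (by simp))
      refine ⟨fun h => ⟨hI₃.congr hsame₄, ColourStep.of_same hsame₄, fun h' => absurd h h', ?_⟩,
        fun hne => ?_⟩
      · simp; omega
      refine wp_mono (wp_forSlots_forall (v := u) (Colouring G id R κ) (ColourStep G id)
        (fun x s' => G.Adj u x → x ≠ v → G.Adj x w → ColouredBy id s' s(u, x) (num (lc (id s(u,
          x)))))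
        (fun s' => s'.reg .nc + s'.reg .ne) (110 * D) (s := s₄) hL₃
        (by simp [hs₄, hf₃.reg .u, hs₂])
        (hI₃.congr hsame₄) ColourStep.refl ColourStep.trans
        (fun h h' hux hxv hxw => (h' hux hxv hxw).mono hux h) ?_) ?_
      · rintro s₅ x r hf₅ hL₅ hI₅ - hux hr
        have hN₅ : Named G idx D id s₅.arr := Named.frame (s := s₄) hN₃ hf₅
        have hv₅ : s₅.reg .v = idx v := by
          rw [hf₅.reg .v]; simp [hs₄, hf₃.reg .v, hs₂, hf₁.reg .v, hsv]
        rw [wp_seq, wp_set, wp_ifNot]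
        simp only [Exp.val_get, Exp.val_reg, Store.setReg_reg, Store.setReg_arr, if_true, hr.2.2,
          reduceCtorEq, if_false, Test.val_eq, hv₅, coe_idx_inj]
        set s₆ := (s₅.setReg .r r).setReg .x (idx x) with hs₆
        have hsame₆ : SameColours s₅ s₆ :=
          (SameColours.setReg s₅ (by simp) (by simp)).trans
            (SameColours.setReg _ (by simp) (by simp))
        refine ⟨fun h => ⟨hI₅.congr hsame₆, ColourStep.of_same hsame₆, fun _ h' => absurd h h', ?_⟩,
          fun hxv => ?_⟩
        · simp; omega
        rw [wp_seq]
        refine wp_mono (wp_testAdj (G := G) (idx := idx) (D := D) (u := x) (w := w) (s := s₆) hL₅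
          (by simp [hs₆]) (by simp [hs₆, hf₅.reg .w, hs₄]) (by simp) (by simp) (by simp)) ?_
        rintro s₇ k₇ hf₇ ⟨hfl, hk₇⟩
        have hN₇ : Named G idx D id s₇.arr := Named.frame (s := s₆) hN₅ hf₇
        have hsame₇ : SameColours s₅ s₇ := hsame₆.trans (SameColours.of_frame hf₇)
        have hr₇ : s₇.reg .r = r := by rw [hf₇.reg .r]; simp [hs₆]
        have hrs : IsSlot idx s₇.arr u x r := IsSlot.congr hr (hf₇.arr .off) (hf₇.arr .tgt)
        have hlc₇ : s₇.arr .lc = lc := by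
          rw [hf₇.arr .lc, ← hlc₃]; exact hf₅.arr .lc
        have hnum₇ : s₇.arr .num = num := by
          rw [hf₇.arr .num, ← hnum, ← hf₁.arr .num]
          exact (hf₅.arr .num).trans (hf₃.arr .num)
        have hnc₇ : s₇.reg .nc = nc := by
          rw [hsame₇.nc, hf₅.reg .nc, hsame₄.nc, hf₃.reg .nc, hsame.nc, hf₁.reg .nc, hnc]
        rw [wp_ifThen]
        have hfl₇ : (Test.eq (Exp.reg .fl) 1).val s₇ = true ↔ G.Adj x w := by simp [hfl]
        rw [hfl₇]
        refine ⟨fun hxw => ?_, fun hxw => ⟨hI₅.congr hsame₇, ColourStep.of_same hsame₇,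
          fun _ _ h => absurd h hxw, ?_⟩⟩
        · have hnear : s(u, x) ∈ nearEdges G v := mem_nearEdges hvu hux
          have h0 := hpos u hvu w hvw hne x hux hxv hxw
          refine wp_mono (wp_colourEdge (e := s(u, x)) hR hN₇ (hI₅.congr hsame₇) hux
            (by rw [hr₇, hN₇.eid_eq hrs]) (by rw [hnum₇, hlc₇]) h0
            (by rw [hnc₇]; exact hnum_le _ hnear) (hsound _ hnear h0)) ?_
          rintro s' k - ⟨h1, h2, h3, h4⟩
          refine ⟨h1, (ColourStep.of_same hsame₇).trans h2, fun _ _ _ => h3, ?_⟩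
          rw [hsame₇.nc, hsame₇.ne] at h4
          simp
          omega
        · rw [hsame₇.nc, hsame₇.ne]; simp; omega
      · rintro s' k - ⟨h1, h2, h3, h4⟩
        refine ⟨h1, (ColourStep.of_same hsame₄).trans h2, fun _ x hux => h3 x hux hux, ?_⟩
        rw [hsame₄.nc, hsame₄.ne] at h4
        have : (110 * D + 8) * D ≤ 118 * D ^ 2 := by nlinarith
        simp
        omega
    · rintro s' k - ⟨h1, h2, h3, h4⟩
      refine ⟨h1, (ColourStep.of_same hsame).trans h2, h3, ?_⟩
      rw [hsame.nc, hsame.ne] at h4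
      simp
      omega
  · rintro s' k - ⟨h1, h2, h3, h4⟩
    refine ⟨h1, h2, h3, ?_⟩
    have h5 : D ^ 2 ≤ D ^ 4 := Nat.pow_le_pow_right hD (by omega)
    have h6 : (3 + (130 * D ^ 2 + 8) * D + 8) * D = 130 * D ^ 4 + 8 * D ^ 2 + 11 * D := by ring
    omega

theorem colourStarProduct_eq :
    colourStarProduct = createColours ;; colourIncident ;; colourOpposite := rfl

/-- The pairs of edges at `v` that are related by `δ(G)` have colours in the same component, and so
has each pair of opposite edges of a chordless square at `v`, unless the two edges of this square
at `v` have colours in the same component. -/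
def StarDone (G : SimpleGraph V) (id : Sym2 V → ℕ) (v : V) (s : Store) : Prop :=
  ∀ u, G.Adj v u → s.arr .gc (id s(v, u)) ≠ 0 ∧ ∀ w, G.Adj v w → u ≠ w →
    (¬ UniqueChordless G v u w → SameClass id s s(v, u) s(v, w)) ∧
    ∀ x, ChordlessSquare G v u x w →
      SameClass id s s(v, u) s(v, w) ∨ SameClass id s s(v, u) s(x, w)

theorem StarDone.mono {s s' : Store} {v : V} (hs : ColourStep G id s s') (h : StarDone G id v s) :
    StarDone G id v s' := by
  intro u hu
  refine ⟨hs.gc_ne hu (h u hu).1, fun w hw huw => ?_⟩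
  obtain ⟨h1, h2⟩ := (h u hu).2 w hw huw
  refine ⟨fun hn => (h1 hn).mono hu hw hs, fun x hx => ?_⟩
  exact (h2 x hx).imp (fun h => h.mono hu hw hs) fun h => h.mono (f := s(x, w)) hu hx.1.2.2.1 hs

theorem ColouredBy.sameClass {s : Store} {e f : Sym2 V} {a : ℕ} (he : ColouredBy id s e a)
    (hf : ColouredBy id s f a) : SameClass id s e f :=
  ⟨he.1, hf.1, he.2.trans hf.2.symm⟩

theorem ChordlessSquare.symm {a b x c : V} (h : ChordlessSquare G a b x c) :
    ChordlessSquare G a c x b := by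
  obtain ⟨⟨h1, h2, h3, h4, h5, h6⟩, h7, h8⟩ := h
  exact ⟨⟨h4.symm, h3.symm, h2.symm, h1.symm, h5, h6.symm⟩, h7, fun h => h8 h.symm⟩

/-- One round of the main loop. -/
theorem wp_starRound {s : Store} {v : V} (hN : Named G idx D id s.arr) (hR : ContainsDelta G R)
    (hsv : s.reg .v = idx v) (hI : Colouring G id R κ s)
    (hused : ∀ a, 1 ≤ a → a ≤ s.reg .nc → Used G id s a) :
    (localClasses ;; colourStarProduct).wp s fun s' k =>
      (∃ κ', Colouring G id R κ' s') ∧ (∀ a, 1 ≤ a → a ≤ s'.reg .nc → Used G id s' a) ∧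
      ColourStep G id s s' ∧ StarDone G id v s' ∧
      k + (s'.reg .nc + s'.reg .ne) ≤ 800 * D ^ 4 + (s.reg .nc + s.reg .ne) := by
  have hD := hN.one_le
  rw [wp_seq]
  refine wp_mono (wp_localClasses hN hR hsv) ?_
  rintro s₁ k₁ hf₁ ⟨hl₁, hnum₁, hpair₁, hk₁⟩
  have hN₁ : Named G idx D id s₁.arr := hN.frame hf₁
  have hsame : SameColours s s₁ := SameColours.of_frame hf₁
  have hv₁ : s₁.reg .v = idx v := by rw [hf₁.reg .v, hsv]
  have hnum₁' : ∀ g ∈ nearEdges G v, s₁.arr .num (s₁.arr .lc (id g)) = 0 := by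
    intro g hg
    obtain ⟨h, hh, hgh⟩ := hl₁.exists_name g hg
    rw [hgh]
    exact hnum₁ h hh
  have hS₁ : StarColouring G id R κ v (s₁.arr .lc) s₁ := by
    refine ⟨hI.congr hsame, fun g hg => ?_, fun g hg h => absurd (hnum₁' g hg) h, fun a h1 h2 => ?_⟩
    · rw [hnum₁' g hg]; exact Nat.zero_le _
    · rw [hsame.nc] at h2
      exact Or.inl ((hused a h1 h2).mono (ColourStep.of_same hsame))
  rw [colourStarProduct_eq, wp_seq]
  refine wp_mono (wp_createColours hN₁ hl₁ hv₁ hS₁) ?_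
  rintro s₂ k₂ hf₂ ⟨⟨κ', hS₂⟩, hstep₂, hpos₂, hk₂⟩
  have hN₂ : Named G idx D id s₂.arr := hN₁.frame hf₂
  have hv₂ : s₂.reg .v = idx v := by rw [hf₂.reg .v, hv₁]
  have hlc₂ : s₂.arr .lc = s₁.arr .lc := hf₂.arr .lc
  rw [wp_seq]
  refine wp_mono (wp_colourIncident hN₂ hR.equiv hv₂ hS₂ hpos₂) ?_
  rintro s₃ k₃ hf₃ ⟨hI₃, hstep₃, hcol₃, hk₃⟩
  have hN₃ : Named G idx D id s₃.arr := hN₂.frame hf₃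
  have hv₃ : s₃.reg .v = idx v := by rw [hf₃.reg .v, hv₂]
  set num := s₂.arr .num with hnum
  set lc := s₂.arr .lc with hlc
  rw [← hlc₂] at hpair₁
  -- two edges at `v` in different classes span a unique square, which is chordless
  have hsq : ∀ u, G.Adj v u → ∀ w, G.Adj v w → lc (id s(v, u)) ≠ lc (id s(v, w)) →
      ∀ x, G.Adj u x → x ≠ v → G.Adj x w → lc (id s(v, w)) = lc (id s(u, x)) := by
    intro u hu w hw hne x hux hxv hxw
    have huw : u ≠ w := by rintro rfl; exact hne rfl
    have huc : UniqueChordless G v u w := by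
      by_contra h
      exact hne ((hpair₁ u hu w hw huw).1 h)
    obtain ⟨y, hy, hy'⟩ := huc
    obtain rfl := hy' x ⟨hu, hux, hxw, hw.symm, hxv.symm, huw⟩
    rw [Sym2.eq_swap (a := u)]
    exact (hpair₁ w hw u hu huw.symm).2 x hy.symm
  refine wp_mono (wp_colourOpposite (num := num) (lc := lc) (nc := s₂.reg .nc) hN₃ hR.equiv hv₃ hI₃
    (hf₃.arr .num) (hf₃.arr .lc) (hf₃.reg .nc) hS₂.num_le hS₂.num_sound ?_) ?_
  · intro u hu w hw hne x hux hxv hxw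
    rw [← hsq u hu w hw hne x hux hxv hxw]
    exact hpos₂ w hw
  rintro s₄ k₄ hf₄ ⟨hI₄, hstep₄, hcol₄, hk₄⟩
  have hnc₄ : s₄.reg .nc = s₂.reg .nc := by rw [hf₄.reg .nc, hf₃.reg .nc]
  have hcolv : ∀ u, G.Adj v u → ColouredBy id s₄ s(v, u) (num (lc (id s(v, u)))) :=
    fun u hu => (hcol₃ u hu).mono hu hstep₄
  refine ⟨⟨κ', hI₄⟩, fun a h1 h2 => ?_, ?_, fun u hu => ⟨(hcolv u hu).1, fun w hw huw => ⟨fun hn =>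
    ?_,
    fun x hx => ?_⟩⟩, ?_⟩
  · rw [hnc₄] at h2
    rcases hS₂.used a h1 h2 with h | ⟨u, hu, rfl⟩
    · exact h.mono (hstep₃.trans hstep₄)
    · exact ⟨_, hu, hcolv u hu⟩
  · exact (ColourStep.of_same hsame).trans (hstep₂.trans (hstep₃.trans hstep₄))
  · have h1 := (hpair₁ u hu w hw huw).1 hn
    refine (hcolv u hu).sameClass ?_
    rw [h1]
    exact hcolv w hw
  · by_cases hne : lc (id s(v, u)) = lc (id s(v, w))
    · left
      refine (hcolv u hu).sameClass ?_
      rw [hne]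
      exact hcolv w hw
    · right
      have hwx : G.Adj w x := hx.1.2.2.1.symm
      have h1 := hcol₄ w hw u hu (Ne.symm hne) x hwx (Ne.symm hx.1.2.2.2.2.1) hx.1.2.1.symm
      rw [← hsq w hw u hu (Ne.symm hne) x hwx (Ne.symm hx.1.2.2.2.2.1) hx.1.2.1.symm] at h1
      rw [Sym2.eq_swap (a := x)]
      exact (hcolv u hu).sameClass h1
  · rw [hsame.nc, hsame.ne] at hk₂
    have h5 : D ≤ D ^ 4 := by
      calc D = D ^ 1 := (pow_one D).symm
        _ ≤ D ^ 4 := Nat.pow_le_pow_right hD (by omega)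
    omega

end Star

/-! ### The components of the colour graph -/

/-- The invariant of a breadth-first search in a graph with arcs `E` between the vertices `1, …,
nc`: the vertices that have been reached, those with `comp a ≠ 0`, make up the queue, the first
`qh` of them have been explored, the other ones belong to the current component `numComp`, and the
vertices `1, …, c` have been reached. -/
structure Search (E : ℕ → ℕ → Prop) (nc qh qt c numComp : ℕ) (que comp : ℕ → ℕ) : Prop where
  qh_le : qh ≤ qt
  c_le : c ≤ nc
  bijOn : Set.BijOn que (Set.Iio qt) {a | 1 ≤ a ∧ a ≤ nc ∧ comp a ≠ 0}
  reached : ∀ a, 1 ≤ a → a ≤ c → comp a ≠ 0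
  comp_le : ∀ a, 1 ≤ a → a ≤ nc → comp a ≤ numComp
  surj : ∀ m, 1 ≤ m → m ≤ numComp → ∃ a, 1 ≤ a ∧ a ≤ nc ∧ comp a = m
  closed : ∀ i < qh, ∀ b, E (que i) b → comp b = comp (que i)
  pending : ∀ i, qh ≤ i → i < qt → comp (que i) = numComp
  sound : ∀ a b, 1 ≤ a → a ≤ nc → 1 ≤ b → b ≤ nc → comp a = comp b → comp a ≠ 0 →
    Relation.EqvGen E a b

namespace Search

variable {E : ℕ → ℕ → Prop} {nc qh qt c numComp : ℕ} {que comp : ℕ → ℕ}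

/-- A vertex `x` that was not reached before is put into the queue and into the component `m`, which
is the current component or, if the queue is empty, a new one. -/
theorem add (h : Search E nc qh qt c numComp que comp) {x m : ℕ} (hx : 1 ≤ x) (hx' : x ≤ nc)
    (hx0 : comp x = 0) (hm : 1 ≤ m) (hm1 : numComp ≤ m) (hm2 : m ≤ numComp + 1)
    (hpend : ∀ i, qh ≤ i → i < qt → comp (que i) = m)
    (hsound : ∀ a, 1 ≤ a → a ≤ nc → comp a = m → Relation.EqvGen E a x) :
    Search E nc qh (qt + 1) c m (Function.update que qt x) (Function.update comp x m) := by
  have hq : ∀ i < qt, comp (que i) ≠ 0 := fun i hi => (h.bijOn.mapsTo hi).2.2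
  have hqx : ∀ i < qt, que i ≠ x := fun i hi h' => hq i hi (h' ▸ hx0)
  have hne : ∀ a, comp a ≠ 0 → Function.update comp x m a = comp a := fun a ha =>
    Function.update_of_ne (by rintro rfl; exact ha hx0) _ _
  have hle := h.qh_le
  refine ⟨hle.trans (Nat.le_succ _), h.c_le, ⟨?_, ?_, ?_⟩, fun a h1 h2 => ?_, fun a h1 h2 => ?_,
    fun m' h1 h2 => ?_, fun i hi b hb => ?_, fun i h1 h2 => ?_, fun a b h1 h2 h3 h4 hab h0 => ?_⟩
  · intro i hi
    rcases Nat.lt_succ_iff_lt_or_eq.1 hi with hi | rfl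
    · obtain ⟨h1, h2, h3⟩ := h.bijOn.mapsTo hi
      rw [Function.update_of_ne hi.ne]
      exact ⟨h1, h2, by rwa [hne _ h3]⟩
    · rw [Function.update_self]
      exact ⟨hx, hx', by rw [Function.update_self]; omega⟩
  · intro i hi j hj hij
    rcases Nat.lt_succ_iff_lt_or_eq.1 hi with hi | rfl <;>
      rcases Nat.lt_succ_iff_lt_or_eq.1 hj with hj | rfl
    · rw [Function.update_of_ne hi.ne, Function.update_of_ne hj.ne] at hij
      exact h.bijOn.injOn hi hj hij
    · rw [Function.update_of_ne hi.ne, Function.update_self] at hij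
      exact absurd hij (hqx i hi)
    · rw [Function.update_of_ne hj.ne, Function.update_self] at hij
      exact absurd hij.symm (hqx j hj)
    · rfl
  · rintro a ⟨h1, h2, h3⟩
    by_cases hax : a = x
    · exact ⟨qt, Nat.lt_succ_self qt, by rw [Function.update_self, hax]⟩
    · rw [Function.update_of_ne hax] at h3
      obtain ⟨i, hi, hia⟩ := h.bijOn.surjOn ⟨h1, h2, h3⟩
      exact ⟨i, Nat.lt_succ_of_lt hi, by rw [Function.update_of_ne (ne_of_lt hi), hia]⟩
  · rw [hne _ (h.reached a h1 h2)]
    exact h.reached a h1 h2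
  · rw [Function.update_apply]
    split_ifs
    · exact le_rfl
    · exact (h.comp_le a h1 h2).trans hm1
  · rcases Nat.lt_or_ge numComp m' with hlt | hge
    · exact ⟨x, hx, hx', by rw [Function.update_self]; omega⟩
    · obtain ⟨a, h3, h4, h5⟩ := h.surj m' h1 hge
      exact ⟨a, h3, h4, by rw [hne a (by omega), h5]⟩
  · have hi' : i < qt := hi.trans_le hle
    rw [Function.update_of_ne hi'.ne] at hb ⊢
    have h1 := h.closed i hi b hb
    rw [hne _ (hq i hi'), hne b (by rw [h1]; exact hq i hi'), h1]
  · rcases Nat.lt_succ_iff_lt_or_eq.1 h2 with h2 | rfl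
    · rw [Function.update_of_ne h2.ne, hne _ (hq i h2), hpend i h1 h2]
    · rw [Function.update_self, Function.update_self]
  · by_cases hax : a = x <;> by_cases hbx : b = x
    · rw [hax, hbx]
      exact Relation.EqvGen.refl _
    · rw [hax, Function.update_self, Function.update_of_ne hbx] at hab
      rw [hax]
      exact Relation.EqvGen.symm _ _ (hsound b h3 h4 hab.symm)
    · rw [hbx, Function.update_self, Function.update_of_ne hax] at hab
      rw [hbx]
      exact hsound a h1 h2 hab
    · rw [Function.update_of_ne hax] at hab h0
      rw [Function.update_of_ne hbx] at hab
      exact h.sound a b h1 h2 h3 h4 hab h0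

theorem qt_le (h : Search E nc qh qt c numComp que comp) : qt ≤ nc := by
  have := Finset.card_le_card_of_injOn que (s := Finset.range qt) (t := Finset.Icc 1 nc)
    (fun i hi => by
      obtain ⟨h1, h2, -⟩ := h.bijOn.mapsTo (Finset.mem_range.1 hi)
      exact Finset.mem_Icc.2 ⟨h1, h2⟩)
    (fun i hi j hj => h.bijOn.injOn (Finset.mem_range.1 hi) (Finset.mem_range.1 hj))
  simpa using this

/-- If the vertices `1, …, nc` have been reached, then all of them are in the queue. -/
theorem le_qt (h : Search E nc qh qt nc numComp que comp) : nc ≤ qt := by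
  have : Finset.Icc 1 nc ⊆ (Finset.range qt).image que := fun a ha => by
    obtain ⟨h1, h2⟩ := Finset.mem_Icc.1 ha
    obtain ⟨i, hi, hia⟩ := h.bijOn.surjOn ⟨h1, h2, h.reached a h1 h2⟩
    exact Finset.mem_image.2 ⟨i, Finset.mem_range.2 hi, hia⟩
  simpa using (Finset.card_le_card this).trans Finset.card_image_le

theorem sum_le (h : Search E nc qh qt c numComp que comp) (f : ℕ → ℕ) :
    ∑ i ∈ Finset.range qh, f (que i) ≤ ∑ a ∈ Finset.Icc 1 nc, f a := by
  have hlt : ∀ i ∈ Finset.range qh, i < qt := fun i hi => (Finset.mem_range.1 hi).trans_le h.qh_le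
  rw [← Finset.sum_image (f := f) fun i hi j hj => h.bijOn.injOn (hlt i hi) (hlt j hj)]
  refine Finset.sum_le_sum_of_subset fun a ha => ?_
  obtain ⟨i, hi, rfl⟩ := Finset.mem_image.1 ha
  obtain ⟨h1, h2, -⟩ := h.bijOn.mapsTo (hlt i hi)
  exact Finset.mem_Icc.2 ⟨h1, h2⟩

/-- The endpoint of an arc from the first vertex in the queue that has not been explored belongs to
the current component, if it has been reached. -/
theorem comp_eq_of_arc (h : Search E nc qh qt c numComp que comp) (hE : ∀ {a b}, E a b → E b a)
    (hlt : qh < qt) {x : ℕ} (hx : 1 ≤ x) (hx' : x ≤ nc) (hyx : E (que qh) x) (h0 : comp x ≠ 0) :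
    comp x = numComp := by
  obtain ⟨j, hj, rfl⟩ := h.bijOn.surjOn ⟨hx, hx', h0⟩
  rcases Nat.lt_or_ge j qh with hjq | hjq
  · rw [← h.closed j hjq _ (hE hyx), h.pending qh le_rfl hlt]
  · exact h.pending j hjq hj

end Search

/-- While the colour at position `qh` of the queue is explored, it still counts as pending. -/
theorem wp_exploreColour {s : Store} {c qh : ℕ}
    (harc : ∀ {a b}, Arc s a b → 1 ≤ b ∧ b ≤ s.reg .nc) (hsymm : ∀ {a b}, Arc s a b → Arc s b a)
    (hqh : s.reg .qh = qh) (hlt : qh < s.reg .qt)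
    (hS : Search (Arc s) (s.reg .nc) qh (s.reg .qt) c (s.reg .numComp) (s.arr .que) (s.arr .comp)) :
    exploreColour.wp s fun s' k =>
      Search (Arc s) (s.reg .nc) (qh + 1) (s'.reg .qt) c (s.reg .numComp) (s'.arr .que)
        (s'.arr .comp) ∧
      (∀ i ≤ qh, s'.arr .que i = s.arr .que i) ∧ s'.reg .qh = qh + 1 ∧
      k ≤ 15 + 30 * s.arr .gdeg (s.arr .que qh) := by
  set y := s.arr .que qh with hy
  obtain ⟨hy1, hy2, hy3⟩ := hS.bijOn.mapsTo (show qh ∈ Set.Iio _ from hlt)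
  rw [← hy] at hy1 hy2 hy3
  have hnc1 : 1 ≤ s.reg .numComp := by
    have := hS.comp_le y hy1 hy2
    omega
  rw [exploreColour, wp_seq, wp_set, wp_seq, wp_set, wp_seq, wp_set]
  simp only [Exp.val_get, Exp.val_reg, Store.setReg_reg, Store.setReg_arr, if_true, reduceCtorEq,
    if_false, hqh, Exp.val_add, Exp.val_one, ← hy]
  set s₁ := ((s.setReg .y y).setReg .qh (qh + 1)).setReg .ptr (s.arr .head y) with hs₁
  refine wp_mono (wp_loop (s := s₁) (fun i s' k =>
    Search (Arc s) (s.reg .nc) qh (s'.reg .qt) c (s.reg .numComp) (s'.arr .que) (s'.arr .comp) ∧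
    (∀ j ≤ qh, s'.arr .que j = s.arr .que j) ∧ qh < s'.reg .qt ∧
    s'.reg .ptr = colourPtr s y i ∧
    (∀ j < i, s'.arr .comp (s.arr .dst (colourPtr s y j)) = s.reg .numComp) ∧ k ≤ i * 30) ?_ ?_) ?_
  · refine ⟨by simpa [hs₁] using hS, fun _ _ => rfl, by simpa [hs₁] using hlt, by simp [hs₁,
      colourPtr],
      by simp, by simp⟩
  · rintro i s₂ k hi hf₂ ⟨h1, h2, h3, h4, h5, h6⟩
    have hgy : (Exp.get .gdeg (Exp.reg .y)).val s₁ - (0 : Exp).val s₁ = s.arr .gdeg y := by simp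
      [hs₁]
    rw [hgy] at hi
    have hdst : s₂.arr .dst = s.arr .dst := hf₂.arr .dst
    have hnxt : s₂.arr .nxt = s.arr .nxt := hf₂.arr .nxt
    have hnumc : s₂.reg .numComp = s.reg .numComp := by rw [hf₂.reg .numComp]; simp [hs₁]
    set x := s.arr .dst (colourPtr s y i) with hx
    have hyx : Arc s y x := ⟨hy1, hy2, i, hi, rfl⟩
    obtain ⟨hx1, hx2⟩ := harc hyx
    have hqy : s₂.arr .que qh = y := h2 qh le_rfl
    have hptr : s.arr .nxt (colourPtr s y i) = colourPtr s y (i + 1) := by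
      rw [colourPtr, colourPtr, Function.iterate_succ_apply']
    rw [wp_seq, wp_set, wp_seq, wp_ifThen]
    simp only [Exp.val_get, Exp.val_reg, Store.setReg_reg, Store.setReg_arr, if_true, reduceCtorEq,
      if_false, h4, hdst, ← hx, Test.val_eq, Exp.val_zero]
    refine ⟨fun h0 => ?_, fun h0 => ?_⟩
    · simp only [wp_seq, wp_set, wp_put]
      simp only [Exp.val_get, Exp.val_reg, Store.setReg_reg, Store.setReg_arr, if_true,
        reduceCtorEq,
        if_false, Store.setArr_reg, Store.setArr_arr, h4, hnxt, hptr, hnumc, Exp.val_add,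
          Exp.val_one]
      have hpend : ∀ a, 1 ≤ a → a ≤ s.reg .nc → s₂.arr .comp a = s.reg .numComp →
          Relation.EqvGen (Arc s) a x := by
        intro a ha1 ha2 ha
        have hcy : s₂.arr .comp y = s.reg .numComp := by rw [← hqy]; exact h1.pending qh le_rfl h3
        exact (h1.sound a y ha1 ha2 hy1 hy2 (ha.trans hcy.symm) (by omega)).trans _ _ _
          (Relation.EqvGen.rel _ _ hyx)
      refine ⟨h1.add hx1 hx2 h0 hnc1 le_rfl (Nat.le_succ _) h1.pending hpend, fun j hj => ?_, by
        omega,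
        trivial, fun j hj => ?_, ?_⟩
      · rw [Function.update_of_ne (by omega), h2 j hj]
      · rcases Nat.lt_succ_iff_lt_or_eq.1 hj with hj | rfl
        · have := h5 j hj
          rw [Function.update_of_ne, this]
          intro h
          rw [h, h0] at this
          omega
        · rw [← hx, Function.update_self]
      · simp
        omega
    · simp only [wp_set, Exp.val_get, Exp.val_reg, Store.setReg_reg, Store.setReg_arr, if_true,
        reduceCtorEq, if_false, h4, hnxt, hptr]
      refine ⟨h1, h2, h3, trivial, fun j hj => ?_, ?_⟩
      · rcases Nat.lt_succ_iff_lt_or_eq.1 hj with hj | rfl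
        · exact h5 j hj
        · exact h1.comp_eq_of_arc hsymm h3 hx1 hx2 (by rw [hqy]; exact hyx) h0
      · simp
        omega
  · rintro s' k hf' ⟨k', rfl, h1, h2, h3, h4, h5, h6⟩
    have hgy : (Exp.get .gdeg (Exp.reg .y)).val s₁ - (0 : Exp).val s₁ = s.arr .gdeg y := by simp
      [hs₁]
    rw [hgy] at h4 h5 h6
    have hqy : s'.arr .que qh = y := h2 qh le_rfl
    refine ⟨⟨h3, h1.c_le, h1.bijOn, h1.reached, h1.comp_le, h1.surj, fun i hi b hb => ?_,
      fun i hi => h1.pending i (by omega), h1.sound⟩, h2, ?_, ?_⟩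
    · rcases Nat.lt_succ_iff_lt_or_eq.1 hi with hi | rfl
      · exact h1.closed i hi b hb
      · rw [h1.pending i le_rfl h3]
        rw [hqy] at hb
        obtain ⟨-, -, j, hj, rfl⟩ := hb
        exact h5 j hj
    · rw [hf'.reg .qh]
      simp [hs₁]
    · simp
      omega

/-- In each round, the number of explored colours or the number of passed colours increases by
one. -/
theorem wp_components {s : Store} (hC : Chains s)
    (harc : ∀ {a b}, Arc s a b → 1 ≤ b ∧ b ≤ s.reg .nc) (hsymm : ∀ {a b}, Arc s a b → Arc s b a)
    (hcomp : ∀ a, 1 ≤ a → a ≤ s.reg .nc → s.arr .comp a = 0) :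
    components.wp s fun s' k =>
      (∀ a b, 1 ≤ a → a ≤ s.reg .nc → 1 ≤ b → b ≤ s.reg .nc →
        (s'.arr .comp a = s'.arr .comp b ↔ Conn s a b)) ∧
      (∀ a, 1 ≤ a → a ≤ s.reg .nc → 1 ≤ s'.arr .comp a ∧ s'.arr .comp a ≤ s'.reg .numComp) ∧
      (∀ m, 1 ≤ m → m ≤ s'.reg .numComp → ∃ a, 1 ≤ a ∧ a ≤ s.reg .nc ∧ s'.arr .comp a = m) ∧
      k ≤ 100 * (s.reg .nc + s.reg .ne) + 20 := by
  simp only [components, wp_seq, wp_set, wp_put]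
  simp only [Exp.val_zero]
  set s₁ := ((((s.setArr .comp 0 0).setReg .numComp 0).setReg .qh 0).setReg .qt 0).setReg .c 0 with
    hs₁
  set nc := s.reg .nc with hnc
  have hval : (Exp.reg .nc + Exp.reg .nc).val s₁ - (0 : Exp).val s₁ = nc + nc := by simp [hs₁, hnc]
  have hA₁ : Arc s₁ = Arc s := by
    funext a b
    simp [Arc, colourPtr, hs₁]
  refine wp_mono (wp_loop (s := s₁) (fun t s' k =>
    Search (Arc s) nc (s'.reg .qh) (s'.reg .qt) (s'.reg .c) (s'.reg .numComp) (s'.arr .que)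
      (s'.arr .comp) ∧ s'.reg .qh + s'.reg .c = t ∧
      k ≤ t * 40 + 30 * ∑ i ∈ Finset.range (s'.reg .qh), s.arr .gdeg (s'.arr .que i)) ?_ ?_) ?_
  · have h0 : ∀ a, 1 ≤ a → a ≤ nc → s₁.arr .comp a = 0 := by
      intro a h1 h2
      simp only [hs₁, Store.setReg_arr, Store.setArr_arr, if_true]
      rw [Function.update_of_ne (by omega)]
      exact hcomp a h1 h2
    have hreg : s₁.reg .qh = 0 ∧ s₁.reg .qt = 0 ∧ s₁.reg .c = 0 ∧ s₁.reg .numComp = 0 := by simp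
      [hs₁]
    obtain ⟨g1, g2, g3, g4⟩ := hreg
    rw [g1, g2, g3, g4]
    refine ⟨⟨le_rfl, Nat.zero_le _, ?_, by omega, fun a h1 h2 => (h0 a h1 h2).le, by omega, by
      omega,
      by omega, fun a b h1 h2 _ _ _ h => absurd (h0 a h1 h2) h⟩, rfl, by simp⟩
    have : {a | 1 ≤ a ∧ a ≤ nc ∧ s₁.arr .comp a ≠ 0} = ∅ :=
      Set.eq_empty_of_forall_notMem fun a ⟨h1, h2, h3⟩ => h3 (h0 a h1 h2)
    rw [this]
    simp
  · rintro t s₂ k ht hf₂ ⟨h1, h2, h3⟩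
    rw [hval] at ht
    have hsame : Arc s₂ = Arc s := by
      rw [← hA₁]
      funext a b
      rw [Arc, Arc, hf₂.reg .nc, hf₂.arr .gdeg, hf₂.arr .dst]
      simp only [colourPtr, hf₂.arr .nxt, hf₂.arr .head]
    have hnc₂ : s₂.reg .nc = nc := by rw [hf₂.reg .nc]; simp [hs₁, hnc]
    have hgdeg₂ : s₂.arr .gdeg = s.arr .gdeg := by rw [hf₂.arr .gdeg]; simp [hs₁]
    set t' := (0 : Exp).val s₁ + t with ht'
    set s₃ := s₂.setReg .t t' with hs₃
    have hA₃ : Arc s₃ = Arc s := by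
      rw [← hsame]
      funext a b
      simp [Arc, colourPtr, hs₃]
    have hr : ∀ r, r ≠ .t → s₃.reg r = s₂.reg r := fun r h => by simp [hs₃, h]
    rw [wp_ite]
    simp only [Test.val_lt, Exp.val_reg, hr .qh (by simp), hr .qt (by simp)]
    refine ⟨fun hlt => ?_, fun hge => ?_⟩
    · refine wp_mono (wp_exploreColour (s := s₃) (c := s₂.reg .c) (qh := s₂.reg .qh) ?_ ?_
        (hr .qh (by simp)) ?_ ?_) ?_
      · rw [hA₃, hr .nc (by simp), hnc₂]; exact harc
      · rw [hA₃]; exact hsymm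
      · rw [hr .qt (by simp)]; exact hlt
      · rw [hA₃, hr .nc (by simp), hnc₂, hr .qt (by simp), hr .numComp (by simp)]
        exact h1
      · rintro s' k' hf' ⟨g1, g2, g3, g4⟩
        rw [hA₃, hr .nc (by simp), hnc₂, hr .numComp (by simp)] at g1
        have hc : s'.reg .c = s₂.reg .c := by rw [hf'.reg .c, hr .c (by simp)]
        have hn : s'.reg .numComp = s₂.reg .numComp := by
          rw [hf'.reg .numComp, hr .numComp (by simp)]
        rw [g3, hc, hn]
        refine ⟨g1, by omega, ?_⟩
        have hsum : ∑ i ∈ Finset.range (s₂.reg .qh + 1), s.arr .gdeg (s'.arr .que i) =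
            ∑ i ∈ Finset.range (s₂.reg .qh), s.arr .gdeg (s₂.arr .que i) +
              s₃.arr .gdeg (s₃.arr .que (s₂.reg .qh)) := by
          rw [Finset.sum_range_succ, g2 _ le_rfl]
          congr 1
          · refine Finset.sum_congr rfl fun i hi => ?_
            rw [g2 i (Finset.mem_range.1 hi).le]
            rfl
          · rw [hs₃, Store.setReg_arr, hgdeg₂]
        rw [hsum]
        simp
        omega
    · have hqq : s₂.reg .qh = s₂.reg .qt := le_antisymm h1.qh_le (not_lt.1 hge)
      have hc : s₂.reg .c < nc := by
        refine lt_of_le_of_ne h1.c_le fun h => ?_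
        rw [h] at h1
        have := h1.le_qt
        omega
      simp only [wp_seq, wp_set, wp_put, wp_ifThen]
      simp only [Exp.val_get, Exp.val_reg, Store.setReg_reg, Store.setReg_arr, if_true,
        reduceCtorEq,
        if_false, Store.setArr_reg, Store.setArr_arr, Exp.val_add, Exp.val_one, hs₃, Test.val_eq,
        Exp.val_zero]
      have hreach : ∀ comp : ℕ → ℕ, (∀ a, s₂.arr .comp a ≠ 0 → comp a ≠ 0) →
          comp (s₂.reg .c + 1) ≠ 0 → ∀ a, 1 ≤ a → a ≤ s₂.reg .c + 1 → comp a ≠ 0 := by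
        intro comp g1 g2 a ha1 ha2
        rcases Nat.lt_succ_iff_lt_or_eq.1 (Nat.lt_succ_of_le ha2) with h | rfl
        · exact g1 a (h1.reached a ha1 (by omega))
        · exact g2
      refine ⟨fun h0 => ?_, fun h0 => ?_⟩
      · have g := h1.add (x := s₂.reg .c + 1) (m := s₂.reg .numComp + 1) (by omega) hc h0 (by omega)
          (Nat.le_succ _) le_rfl (by omega) (fun a ha1 ha2 ha => by
            have := h1.comp_le a ha1 ha2
            omega)
        refine ⟨⟨g.qh_le, hc, g.bijOn, hreach _ (fun a ha => ?_) ?_, g.comp_le, g.surj, g.closed,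
          g.pending, g.sound⟩, by omega, ?_⟩
        · rw [Function.update_apply]
          split_ifs
          · omega
          · exact ha
        · rw [Function.update_self]
          omega
        · have hsum : ∑ i ∈ Finset.range (s₂.reg .qh), s.arr .gdeg
              (Function.update (s₂.arr .que) (s₂.reg .qt) (s₂.reg .c + 1) i) =
              ∑ i ∈ Finset.range (s₂.reg .qh), s.arr .gdeg (s₂.arr .que i) := by
            refine Finset.sum_congr rfl fun i hi => ?_
            have := Finset.mem_range.1 hi
            rw [Function.update_of_ne (by omega)]
          rw [hsum]
          simp
          omega
      · refine ⟨⟨h1.qh_le, hc, h1.bijOn, hreach _ (fun _ h => h) h0, h1.comp_le, h1.surj, h1.closed,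
          h1.pending, h1.sound⟩, by omega, ?_⟩
        simp
        omega
  · rintro s' k hf' ⟨k', rfl, h1, h2, h3⟩
    rw [hval] at h2 h3
    have hqt := h1.qt_le
    have hqh := h1.qh_le
    have hcle := h1.c_le
    have hc : s'.reg .c = nc := by omega
    have hq : s'.reg .qh = nc := by omega
    have hq' : s'.reg .qt = nc := by omega
    rw [hc, hq, hq'] at h1
    have hpos : ∀ a, 1 ≤ a → a ≤ nc → s'.arr .comp a ≠ 0 := h1.reached
    refine ⟨fun a b ha1 ha2 hb1 hb2 => ⟨fun h => h1.sound a b ha1 ha2 hb1 hb2 h (hpos a ha1 ha2),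
      fun h => ?_⟩, fun a ha1 ha2 => ⟨Nat.one_le_iff_ne_zero.2 (hpos a ha1 ha2), h1.comp_le a ha1
        ha2⟩,
      h1.surj, ?_⟩
    · have hE : ∀ a b, Arc s a b → s'.arr .comp a = s'.arr .comp b := by
        intro a b hab
        obtain ⟨i, hi, rfl⟩ := h1.bijOn.surjOn ⟨hab.1, hab.2.1, hpos a hab.1 hab.2.1⟩
        exact (h1.closed i hi b hab).symm
      clear ha1 ha2 hb1 hb2
      induction h with
      | rel a b h => exact hE a b h
      | refl => rfl
      | symm _ _ _ ih => exact ih.symm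
      | trans _ _ _ _ _ ih₁ ih₂ => exact ih₁.trans ih₂
    · have g1 := h1.sum_le (s.arr .gdeg)
      have g2 := hC.sum_le
      rw [hq] at h3
      simp only [← hnc] at g2
      simp
      omega

/-! ### The equivalence relation `δ(G)^*` -/

section Delta

variable {V : Type*} {G : SimpleGraph V}

theorem Square.symm {a b x c : V} (h : Square G a b x c) : Square G a c x b :=
  ⟨h.2.2.2.1.symm, h.2.2.1.symm, h.2.1.symm, h.1.symm, h.2.2.2.2.1, h.2.2.2.2.2.symm⟩

theorem ChordlessSquare.rotate {a b x c : V} (h : ChordlessSquare G a b x c) :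
    ChordlessSquare G x c a b := by
  obtain ⟨⟨h1, h2, h3, h4, h5, h6⟩, h7, h8⟩ := h
  exact ⟨⟨h3, h4, h1, h2, h5.symm, h6.symm⟩, fun h => h7 h.symm, fun h => h8 h.symm⟩

theorem ChordlessSquare.reverse {a b x c : V} (h : ChordlessSquare G a b x c) :
    ChordlessSquare G c x b a := by
  obtain ⟨⟨h1, h2, h3, h4, h5, h6⟩, h7, h8⟩ := h
  exact ⟨⟨h3.symm, h2.symm, h1.symm, h4.symm, h6.symm, h5.symm⟩, fun h => h8 h.symm,
    fun h => h7 h.symm⟩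

theorem Delta.symm {e f : G.edgeSet} (h : Delta G e f) : Delta G f e := by
  rcases h with ⟨a, b, c, hbc, he, hf, h⟩ | ⟨a, b, x, c, h, he, hf⟩ | rfl
  · refine Or.inl ⟨a, c, b, hbc.symm, hf, he, ?_⟩
    rintro ⟨x, ⟨hx, hax, hcb⟩, hx'⟩
    exact h ⟨x, ⟨hx.symm, hax, fun h => hcb h.symm⟩, fun y hy => hx' y hy.symm⟩
  · exact Or.inr (Or.inl ⟨x, c, a, b, h.rotate, hf, he⟩)
  · exact Or.inr (Or.inr rfl)

theorem DeltaStar.refl (e : G.edgeSet) : DeltaStar G e e :=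
  Relation.TransGen.single (Or.inr (Or.inr rfl))

theorem DeltaStar.symm {e f : G.edgeSet} (h : DeltaStar G e f) : DeltaStar G f e := by
  induction h with
  | single h => exact Relation.TransGen.single h.symm
  | tail _ h ih => exact Relation.TransGen.head h.symm ih

/-- The relation `δ(G)^*`, extended to all unordered pairs of vertices. -/
def deltaRel (G : SimpleGraph V) (e f : Sym2 V) : Prop :=
  e = f ∨ ∃ he hf, DeltaStar G ⟨e, he⟩ ⟨f, hf⟩

theorem deltaRel_iff {e f : G.edgeSet} : deltaRel G e f ↔ DeltaStar G e f := by
  refine ⟨?_, fun h => Or.inr ⟨e.2, f.2, h⟩⟩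
  rintro (h | ⟨_, _, h⟩)
  · rw [Subtype.ext h]
    exact DeltaStar.refl f
  · exact h

theorem containsDelta_deltaRel [Fintype V] [DecidableEq V] [DecidableRel G.Adj] :
    ContainsDelta G (deltaRel G) where
  equiv := by
    refine ⟨fun e => Or.inl rfl, ?_, ?_⟩
    · rintro e f (rfl | ⟨he, hf, h⟩)
      · exact Or.inl rfl
      · exact Or.inr ⟨hf, he, h.symm⟩
    · rintro e f g (rfl | ⟨he, hf, h⟩) h'
      · exact h'
      · rcases h' with rfl | ⟨_, hg, h'⟩
        · exact Or.inr ⟨he, hf, h⟩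
        · exact Or.inr ⟨he, hg, Relation.TransGen.trans h h'⟩
  adjacent {a b c} hab hac hbc h :=
    Or.inr ⟨hab, hac, Relation.TransGen.single (Or.inl ⟨a, b, c, hbc, rfl, rfl, h⟩)⟩
  opposite {a b x c} h :=
    Or.inr ⟨h.1.1, h.1.2.2.1, Relation.TransGen.single (Or.inr (Or.inl ⟨a, b, x, c, h, rfl, rfl⟩))⟩

end Delta

/-! ### The algorithm -/

section Main

variable {V : Type*} [Fintype V] [DecidableEq V] {G : SimpleGraph V} [DecidableRel G.Adj]
  {idx : V ≃ Fin (Fintype.card V)} {D : ℕ} {id : Sym2 V → ℕ} {R : Sym2 V → Sym2 V → Prop}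
  {κ : ℕ → Sym2 V}

theorem IsInput.lists {s : Store} (h : IsInput G Finset.univ idx s) :
    Lists G idx (max 1 G.maxDegree) s.arr :=
  ⟨h.off_succ, h.tgt_bijOn, fun v => (G.degree_le_maxDegree v).trans (le_max_right _ _),
    le_max_left _ _⟩

theorem SameClass.symm {s : Store} {e f : Sym2 V} (h : SameClass id s e f) : SameClass id s f e :=
  ⟨h.2.1, h.1, h.2.2.symm⟩

theorem SameClass.trans {s : Store} {e f g : Sym2 V} (h : SameClass id s e f)
    (h' : SameClass id s f g) : SameClass id s e g :=
  ⟨h.1, h'.2.1, h.2.2.trans h'.2.2⟩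

theorem StarDone.gc_ne {s : Store} (h : ∀ v, StarDone G id v s) {e : Sym2 V} (he : e ∈ G.edgeSet) :
    s.arr .gc (id e) ≠ 0 := by
  induction e with
  | _ v w => exact (h v w he).1

/-- If all partial star products have been coloured, then edges related by `δ(G)` have colours in
the same component. For opposite edges `ab` and `xc` of a chordless square `abxc`, either this is
clear from the star at `a` or at `c`, or `ab`, `ac` and `cx` have colours in the same component.
-/
theorem StarDone.sameClass_of_delta {s : Store} (h : ∀ v, StarDone G id v s) {e f : G.edgeSet}
    (hef : Delta G e f) : SameClass id s e f := by
  rcases hef with ⟨a, b, c, hbc, he, hf, hn⟩ | ⟨a, b, x, c, hsq, he, hf⟩ | rfl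
  · have hab : G.Adj a b := by rw [← SimpleGraph.mem_edgeSet, ← he]; exact e.2
    have hac : G.Adj a c := by rw [← SimpleGraph.mem_edgeSet, ← hf]; exact f.2
    rw [he, hf]
    exact ((h a b hab).2 c hac hbc).1 hn
  · rw [he, hf]
    have ⟨⟨hab, hbx, hxc, hca, hax, hbc⟩, _⟩ := hsq
    rcases ((h a b hab).2 c hca.symm hbc).2 x hsq with h1 | h1
    · rcases ((h c x hxc.symm).2 a hca hax.symm).2 b hsq.reverse with h2 | h2
      · rw [Sym2.eq_swap (a := x)]
        rw [Sym2.eq_swap (a := c) (b := a)] at h2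
        exact h1.trans h2.symm
      · rw [Sym2.eq_swap (a := x), Sym2.eq_swap (a := a)]
        exact h2.symm
    · exact h1
  · exact ⟨StarDone.gc_ne h e.2, StarDone.gc_ne h e.2, Conn.refl _ _⟩

theorem Colouring.rel_of_conn {s : Store} (hR : Equivalence R) (h : Colouring G id R κ s) {a b : ℕ}
    (hab : Conn s a b) : R (κ a) (κ b) := by
  induction hab with
  | rel a b hab => exact h.arc_sound hab
  | refl a => exact hR.refl _
  | symm _ _ _ ih => exact hR.symm ih
  | trans _ _ _ _ _ ih₁ ih₂ => exact hR.trans ih₁ ih₂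

/-- When all partial star products have been coloured, two edges have colours in the same component
if and only if they are related by `δ(G)^*`. -/
theorem conn_iff_deltaStar {s : Store} (hI : Colouring G id (deltaRel G) κ s)
    (h : ∀ v, StarDone G id v s) (e f : G.edgeSet) :
    Conn s (s.arr .gc (id e)) (s.arr .gc (id f)) ↔ DeltaStar G e f := by
  have hR := (containsDelta_deltaRel (G := G)).equiv
  constructor
  · intro hc
    rw [← deltaRel_iff]
    exact hR.trans (hR.symm (hI.gc_sound e.2 (StarDone.gc_ne h e.2)))
      (hR.trans (hI.rel_of_conn hR hc) (hI.gc_sound f.2 (StarDone.gc_ne h f.2)))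
  · intro hef
    induction hef with
    | single hd => exact (StarDone.sameClass_of_delta h hd).2.2
    | tail _ hd ih => exact ih.trans (StarDone.sameClass_of_delta h hd).2.2

/-- The main loop of the algorithm. -/
def starRounds : Cmd :=
  loop .t 0 Reg.k (
    .v ::= Exp.get .lst Reg.t ;;
    localClasses ;;
    colourStarProduct)

theorem wp_starRounds {s : Store} (hN : Named G idx D id s.arr) (hR : ContainsDelta G R)
    (hk : s.reg .k = Fintype.card V)
    (hlst : Set.BijOn (s.arr .lst) (Set.Iio (Fintype.card V)) (Set.range fun w => (idx w : ℕ)))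
    (hI : Colouring G id R κ s) (hnc : s.reg .nc = 0) (hne : s.reg .ne = 0) :
    starRounds.wp s fun s' k =>
      (∃ κ', Colouring G id R κ' s') ∧ (∀ a, 1 ≤ a → a ≤ s'.reg .nc → Used G id s' a) ∧
      (∀ v, StarDone G id v s') ∧
      k + (s'.reg .nc + s'.reg .ne) ≤ 810 * (Fintype.card V * D ^ 4) + 3 := by
  have hD := hN.one_le
  have hD4 : 1 ≤ D ^ 4 := Nat.one_le_pow _ _ hD
  refine wp_mono (wp_loop (fun t s' k => (∃ κ', Colouring G id R κ' s') ∧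
    (∀ a, 1 ≤ a → a ≤ s'.reg .nc → Used G id s' a) ∧
    (∀ i < t, ∀ v, s.arr .lst i = idx v → StarDone G id v s') ∧
    k + (s'.reg .nc + s'.reg .ne) ≤ t * (810 * D ^ 4)) ?_ ?_) ?_
  · exact ⟨⟨κ, hI⟩, fun a h1 h2 => by omega, by simp, by simp [hnc, hne]⟩
  · rintro t s₁ k ht hf₁ ⟨⟨κ₁, hI₁⟩, hu₁, hd₁, hk₁⟩
    have ht' : t < Fintype.card V := by simpa [hk] using ht
    obtain ⟨v, hv⟩ := hlst.mapsTo ht'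
    dsimp only at hv
    have hN₁ : Named G idx D id s₁.arr := hN.frame hf₁
    rw [wp_seq, wp_set]
    have hval : (Exp.get .lst (Exp.reg .t)).val (s₁.setReg .t ((0 : Exp).val s + t)) = idx v := by
      simp [hf₁.arr .lst, hv]
    rw [hval]
    set s₂ := (s₁.setReg .t ((0 : Exp).val s + t)).setReg .v (idx v) with hs₂
    have hsame : SameColours s₁ s₂ :=
      (SameColours.setReg s₁ (by simp) (by simp)).trans (SameColours.setReg _ (by simp) (by simp))
    refine wp_mono (wp_starRound (s := s₂) (v := v) hN₁ hR (by simp [hs₂]) (hI₁.congr hsame)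
      fun a h1 h2 => (hu₁ a h1 (by rwa [hsame.nc] at h2)).mono (ColourStep.of_same hsame)) ?_
    rintro s' k' - ⟨h1, h2, h3, h4, h5⟩
    refine ⟨h1, h2, fun i hi w hw => ?_, ?_⟩
    · rcases Nat.lt_succ_iff_lt_or_eq.1 hi with hi | rfl
      · exact (hd₁ i hi w hw).mono ((ColourStep.of_same hsame).trans h3)
      · obtain rfl : v = w := coe_idx_inj.1 (hv.trans hw)
        exact h4
    · rw [hsame.nc, hsame.ne] at h5
      rw [Nat.add_mul t 1]
      simp
      omega
  · rintro s' k - ⟨k', rfl, h1, h2, h3, h4⟩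
    have ht : (Exp.reg .k).val s - (0 : Exp).val s = Fintype.card V := by simp [hk]
    rw [ht] at h3 h4
    refine ⟨h1, h2, fun v => ?_, ?_⟩
    · obtain ⟨i, hi, hiv⟩ := hlst.surjOn ⟨v, rfl⟩
      exact h3 i hi v hiv
    · rw [mul_left_comm] at h4
      simp
      omega

/-- The initialization of the colours. -/
def initColours : Cmd := loop .p 0 (Exp.get .off Reg.n) (put .gc Reg.p 0)

theorem wp_initColours {s : Store} :
    initColours.wp s fun s' k => (∀ p < s.arr .off (s.reg .n), s'.arr .gc p = 0) ∧
      k ≤ 4 * s.arr .off (s.reg .n) + 4 := by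
  refine wp_mono (wp_loop (fun i s' k => (∀ p < i, s'.arr .gc p = 0) ∧ k ≤ 4 * i) (by simp) ?_) ?_
  · rintro i s₁ k hi hf₁ ⟨h1, h2⟩
    rw [wp_put]
    simp only [Exp.val_reg, Store.setReg_reg, if_true, Exp.val_zero, Nat.zero_add, Store.setArr_arr,
      Store.setReg_arr, Function.update_apply]
    refine ⟨fun p hp => ?_, ?_⟩
    · split_ifs with hpi
      · rfl
      · exact h1 p (by omega)
    · simp
      omega
  · rintro s' k - ⟨k', rfl, h1, h2⟩
    refine ⟨by simpa using h1, ?_⟩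
    simp at h2 ⊢
    omega

/-- The output of the classes. -/
def output : Cmd :=
  loop .p 0 (Exp.get .off Reg.n) (put .out Reg.p (Exp.get .comp (Exp.get .gc (Exp.get .eid Reg.p))))

theorem wp_output {s : Store} :
    output.wp s fun s' k =>
      (∀ p < s.arr .off (s.reg .n), s'.arr .out p = s.arr .comp (s.arr .gc (s.arr .eid p))) ∧
      k ≤ 7 * s.arr .off (s.reg .n) + 4 := by
  refine wp_mono (wp_loop (fun i s' k =>
    (∀ p < i, s'.arr .out p = s.arr .comp (s.arr .gc (s.arr .eid p))) ∧ k ≤ 7 * i) (by simp) ?_) ?_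
  · rintro i s₁ k hi hf₁ ⟨h1, h2⟩
    rw [wp_put]
    simp only [Exp.val_reg, Store.setReg_reg, if_true, Exp.val_zero, Nat.zero_add, Store.setArr_arr,
      Store.setReg_arr, Function.update_apply, Exp.val_get, hf₁.arr .comp, hf₁.arr .gc, hf₁.arr
        .eid]
    refine ⟨fun p hp => ?_, ?_⟩
    · split_ifs with hpi
      · rw [hpi]
      · exact h1 p (by omega)
    · simp
      omega
  · rintro s' k - ⟨k', rfl, h1, h2⟩
    refine ⟨by simpa using h1, ?_⟩
    simp at h2 ⊢
    omega

theorem localColouring_eq : localColouring =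
    nameEdges ;; initColours ;; .nc ::= 0 ;; .ne ::= 0 ;; starRounds ;; components ;; output := rfl

theorem wp_localColouring {s : Store} (hG : G.Connected) (h : IsInput G Finset.univ idx s) :
    localColouring.wp s fun s' k => OutputsClasses G idx s s' (DeltaStar G) ∧
      k ≤ 100000 * (Fintype.card V * (max 1 G.maxDegree) ^ 4) := by
  set D := max 1 G.maxDegree with hDdef
  have hL : Lists G idx D s.arr := h.lists
  have hD := hL.one_le
  obtain ⟨v₀⟩ := hG.nonempty
  have hV : 1 ≤ Fintype.card V := Fintype.card_pos_iff.2 ⟨v₀⟩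
  set id := edgeId idx s.arr with hid
  rw [localColouring_eq, wp_seq]
  refine wp_mono (wp_nameEdges hL h.card_eq) ?_
  rintro s₁ k₁ hf₁ ⟨hN₁, hk₁⟩
  rw [wp_seq]
  refine wp_mono wp_initColours ?_
  rintro s₂ k₂ hf₂ ⟨hgc₂, hk₂⟩
  have hN₂ : Named G idx D id s₂.arr := hN₁.frame hf₂
  have hn₁ : s₁.reg .n = Fintype.card V := by rw [hf₁.reg .n, h.card_eq]
  have hoff₁ : s₁.arr .off = s.arr .off := hf₁.arr .off
  rw [hn₁, hoff₁] at hgc₂ hk₂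
  rw [wp_seq, wp_set, wp_seq, wp_set]
  set s₃ := (s₂.setReg .nc ((0 : Exp).val s₂)).setReg .ne
    ((0 : Exp).val (s₂.setReg .nc ((0 : Exp).val s₂))) with hs₃
  have hN₃ : Named G idx D id s₃.arr := hN₂
  have hnc₃ : s₃.reg .nc = 0 := by simp [hs₃]
  have hne₃ : s₃.reg .ne = 0 := by simp [hs₃]
  have hgc₃ : ∀ e ∈ G.edgeSet, s₃.arr .gc (id e) = 0 := fun e he =>
    hgc₂ _ (by rw [← hoff₁]; exact hN₁.id_lt he)
  have hI₃ : Colouring G id (deltaRel G) (fun _ => s(v₀, v₀)) s₃ := by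
    refine ⟨⟨fun a h1 h2 => by omega, by simp [hnc₃]⟩, fun h => ?_, fun h => ?_, fun h => ?_,
      fun he => ?_, fun he h => absurd (hgc₃ _ he) h, fun a h1 h2 => by omega⟩
    · have := h.1; have := h.2.1; omega
    · have := h.1; have := h.2.1; omega
    · have := h.1; have := h.2.1; omega
    · rw [hgc₃ _ he]; exact Nat.zero_le _
  rw [wp_seq]
  refine wp_mono (wp_starRounds hN₃ containsDelta_deltaRel ?_ ?_ hI₃ hnc₃ hne₃) ?_
  · simp [hs₃, hf₂.reg .k, hf₁.reg .k, h.length_eq]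
  · have h1 : s₃.arr .lst = s.arr .lst := by rw [← hf₁.arr .lst, ← hf₂.arr .lst]; rfl
    rw [h1]
    simpa using h.lst_bijOn
  rintro s₄ k₄ hf₄ ⟨⟨κ, hI₄⟩, hu₄, hd₄, hk₄⟩
  have hN₄ : Named G idx D id s₄.arr := hN₃.frame hf₄
  rw [wp_seq]
  refine wp_mono (wp_components hI₄.chains hI₄.arc_le hI₄.arc_symm hI₄.comp_eq) ?_
  rintro s₅ k₅ hf₅ ⟨hconn, hle, hsurj, hk₅⟩
  have hN₅ : Named G idx D id s₅.arr := hN₄.frame hf₅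
  have hgc₅ : s₅.arr .gc = s₄.arr .gc := hf₅.arr .gc
  have hoff₅ : s₅.arr .off = s.arr .off := by
    rw [hf₅.arr .off, hf₄.arr .off, ← hoff₁, ← hf₂.arr .off]; rfl
  have htgt₅ : s₅.arr .tgt = s.arr .tgt := by
    rw [hf₅.arr .tgt, hf₄.arr .tgt, ← hf₁.arr .tgt, ← hf₂.arr .tgt]; rfl
  have hn₅ : s₅.reg .n = Fintype.card V := by
    rw [hf₅.reg .n, hf₄.reg .n, ← hn₁, ← hf₂.reg .n]; simp [hs₃]
  refine wp_mono wp_output ?_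
  rintro s₆ k₆ hf₆ ⟨hout, hk₆⟩
  rw [hn₅, hoff₅] at hout hk₆
  have hpos : ∀ e : G.edgeSet, 1 ≤ s₄.arr .gc (id e) := fun e =>
    Nat.one_le_iff_ne_zero.2 (StarDone.gc_ne hd₄ e.2)
  refine ⟨⟨fun e => s₅.arr .comp (s₄.arr .gc (id e)), ?_, fun e f => ?_, fun v w hvw p hp hpw =>
    ?_⟩,
    ?_⟩
  · rw [hf₆.reg .numComp]
    ext m
    constructor
    · rintro ⟨e, rfl⟩
      exact hle _ (hpos e) (hI₄.gc_le e.2)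
    · rintro ⟨h1, h2⟩
      obtain ⟨a, ha1, ha2, rfl⟩ := hsurj m h1 h2
      obtain ⟨e, he, -, hea⟩ := hu₄ a ha1 ha2
      exact ⟨⟨e, he⟩, (hconn _ _ (hpos ⟨e, he⟩) (hI₄.gc_le he) ha1 ha2).2 hea⟩
  · rw [← conn_iff_deltaStar hI₄ hd₄]
    exact hconn _ _ (hpos e) (hI₄.gc_le e.2) (hpos f) (hI₄.gc_le f.2)
  · have hslot : IsSlot idx s.arr v w p := ⟨hp.1, hp.2, hpw⟩
    rw [hout p (hL.slot_lt hslot), hN₅.eid_eq (hslot.congr hoff₅ htgt₅), hgc₅]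
  · have hoff := hL.off_le h.off_zero le_rfl
    have h1 : Fintype.card V * D ^ 2 ≤ Fintype.card V * D ^ 4 := Nat.mul_le_mul_left _
      (Nat.pow_le_pow_right hD (by omega))
    have h2 : Fintype.card V * D ≤ Fintype.card V * D ^ 4 := Nat.mul_le_mul_left _ (Nat.le_self_pow
      (by omega) D)
    have h3 : 1 ≤ Fintype.card V * D ^ 4 := Nat.mul_pos hV (Nat.pow_pos hD)
    simp only [Exp.cost_zero]
    omega

end Main

end PSP

theorem mainTheorem7 :
    ∃ C : ℕ, ∀ (V : Type*) [Fintype V] [DecidableEq V] (G : SimpleGraph V) [DecidableRel G.Adj]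
      (idx : V ≃ Fin (Fintype.card V)) (s : PSP.Store),
      G.Connected → PSP.IsInput G Finset.univ idx s →
        PSP.OutputsClasses G idx s (PSP.localColouring.run s).1 (PSP.DeltaStar G) ∧
        (PSP.localColouring.run s).2 ≤ C * (Fintype.card V * (max 1 G.maxDegree) ^ 4) :=
  ⟨100000, fun _ _ _ _ _ _ _ hG h => PSP.wp_localColouring hG h⟩
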